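/- Let $n\ge 1$, $s\in(0,1)$, $\delta>0$, $p\in(1,\infty)$, and let $\Omega\subset\mathbb{R}^n$ be a bounded Lipschitz domain (open, connected), with $\Omega_\delta:=\{x\in\mathbb{R}^n:\operatorname{dist}(x,\Omega)<\delta\}$. Let $w_\delta:\mathbb{R}^n\to[0,\infty)$ be radial, radially decreasing ($w_\delta(z)\ge w_\delta(\tilde z)$ if $|z|\le|\tilde z|$), smooth with compact support in the open ball $B_\delta(0)$, and equal to $1$ on $B_{\mu\delta}(0)$ for some $\mu\in(0,1)$. Put $\rho_\delta^s(z)=c_{n,s,\delta}\,w_\delta(z)\,|z|^{-(n+s-1)}$, where $c_{n,s,\delta}>0$ is determined by $c_{n,s,\delta}\int_{B_\delta(0)}w_\delta(z)|z|^{-(n+s-1)}\,dz=n$, and for $\psi\in C_c^\infty(\Omega;\mathbb{R}^n)$ (extended by zero) $$\operatorname{div}_\delta^s\psi(x)=\int_{\mathbb{R}^n}\frac{\psi(x)-\psi(y)}{|x-y|}\cdot\frac{x-y}{|x-y|}\,\rho_\delta^s(x-y)\,dy .$$ A function $v\in L^1_{\rm loc}(\Omega;\mathbb{R}^n)$ is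 the weak nonlocal gradient $D_\delta^s u$ of $u\in L^1_{\rm loc}(\Omega_\delta)$ if $\int_\Omega v\cdot\psi\,dx=-\int_{\Omega_\delta}u\,\operatorname{div}_\delta^s\psi\,dx$ for all $\psi\in C_c^\infty(\Omega;\mathbb{R}^n)$. Let $$H^{s,p,\delta}(\Omega)=\{u\in L^p(\Omega_\delta): D_\delta^s u\in L^p(\Omega;\mathbb{R}^n)\},\qquad \|u\|_{H^{s,p,\delta}(\Omega)}=\big(\|u\|_{L^p(\Omega_\delta)}^p+\|D_\delta^s u\|_{L^p(\Omega;\mathbb{R}^n)}^p\big)^{1/p},$$ and $N^{s,p,\delta}(\Omega)=\{h\in H^{s,p,\delta}(\Omega): D_\delta^s h=0 \text{ a.e. in }\Omega\}$. Then every $v\in L^p(\Omega_\delta)$ has exactly one nearest point $\pi_\delta^s(v)$ in $N^{s,p,\delta}(\Omega)$ with respect to the norm of $L^p(\Omega_\delta)$, i.e. $\|v-\pi_\delta^s(v)\|_{L^p(\Omega_\delta)}=\min_{h\in N^{s,p,\delta}(\Omega)}\|v-h\|_{L^p(\Omega_\delta)}$; and if $(u_j)_{j}\subset H^{s,p,\delta}(\Omega)$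 converges weakly in $H^{s,p,\delta}(\Omega)$ to $u\in H^{s,p,\delta}(\Omega)$, then $$u_j-\pi_\delta^s(u_j)\to u-\pi_\delta^s(u)\quad\text{strongly in }L^p(\Omega_\delta)\text{ as }j\to\infty .$$ -/

import Mathlib

open MeasureTheory Filter Topology
open scoped ENNReal NNReal ContDiff Pointwise

noncomputable section

namespace FiniteHorizon

/-- Euclidean space `ℝⁿ`. -/
abbrev Rn (n : ℕ) : Type := EuclideanSpace ℝ (Fin n)

/-- A radial cut-off function `w_δ : ℝⁿ → [0, ∞)` for the horizon `δ`. -/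
structure Cutoff (n : ℕ) (δ : ℝ) where
  toFun : Rn n → ℝ
  radial : ∃ wbar : ℝ → ℝ, (∀ r, 0 ≤ wbar r) ∧ ∀ z, toFun z = wbar ‖z‖
  smooth : ContDiff ℝ ∞ toFun
  hasCompactSupport : HasCompactSupport toFun
  tsupport_subset : tsupport toFun ⊆ Metric.ball 0 δ
  eq_one : ∃ μ : ℝ, 0 < μ ∧ μ < 1 ∧ ∀ z ∈ Metric.ball (0 : Rn n) (μ * δ), toFun z = 1
  decreasing : ∀ z z' : Rn n, ‖z‖ ≤ ‖z'‖ → toFun z' ≤ toFun z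

variable {n : ℕ} {δ : ℝ}

instance : CoeFun (Cutoff n δ) (fun _ => Rn n → ℝ) := ⟨Cutoff.toFun⟩

/-- The scaling constant `c_{n,s,δ}`, i.e. the solution `c` of
`c * ∫_{B_δ(0)} w_δ(z) / |z|^(n+s-1) dz = n`. -/
def scaling (s : ℝ) (w : Cutoff n δ) : ℝ :=
  (n : ℝ) / ∫ z in Metric.ball (0 : Rn n) δ, w z / ‖z‖ ^ ((n : ℝ) + s - 1)

/-- The kernel `ρ_δ^s(z) = c_{n,s,δ} w_δ(z) / |z|^(n+s-1)`. -/
def kernel (s : ℝ) (w : Cutoff n δ) (z : Rn n) : ℝ :=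
  scaling s w * (w z / ‖z‖ ^ ((n : ℝ) + s - 1))

/-- The nonlocal divergence
`div_δ^s ψ(x) = ∫ (ψ(x)-ψ(y))/|x-y| · (x-y)/|x-y| ρ_δ^s(x-y) dy` of a vector field. -/
def nonlocalDiv (s : ℝ) (w : Cutoff n δ) (ψ : Rn n → Rn n) (x : Rn n) : ℝ :=
  ∫ y, inner ℝ (‖x - y‖⁻¹ • (ψ x - ψ y)) (‖x - y‖⁻¹ • (x - y)) * kernel s w (x - y)

/-- `v ∈ L¹_loc(Ω; ℝⁿ)` is the weak nonlocal gradient `D_δ^s u` of `u ∈ L¹_loc(Ω_δ)`; here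
`Ω_δ = Metric.thickening δ Ω` is the set of points at distance less than `δ` from `Ω`. -/
structure IsWeakNonlocalGradient (s : ℝ) (w : Cutoff n δ) (Ω : Set (Rn n))
    (u : Rn n → ℝ) (v : Rn n → Rn n) : Prop where
  locallyIntegrableOn_fun : LocallyIntegrableOn u (Metric.thickening δ Ω)
  locallyIntegrableOn_grad : LocallyIntegrableOn v Ω
  integral_by_parts : ∀ ψ : Rn n → Rn n, ContDiff ℝ ∞ ψ → HasCompactSupport ψ → tsupport ψ ⊆ Ω →
    ∫ x in Ω, inner ℝ (v x) (ψ x) = - ∫ x in Metric.thickening δ Ω, u x * nonlocalDiv s w ψ x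

/-! Auxiliary facts: the integrals in the weak formulation converge. -/

lemma Cutoff.nonneg (w : Cutoff n δ) (z : Rn n) : 0 ≤ w z := by
  obtain ⟨wb, h0, h⟩ := w.radial
  rw [h]; exact h0 _

/-- The scaling constant is positive and normalizes the kernel as required. -/
lemma scaling_spec {s : ℝ} (hs : s < 1) (hδ : 0 < δ) (hn : 0 < n) (w : Cutoff n δ) :
    0 < scaling s w ∧
      scaling s w * ∫ z in Metric.ball (0 : Rn n) δ, w z / ‖z‖ ^ ((n : ℝ) + s - 1) = n := by
  have hw : Measurable w.toFun := w.smooth.continuous.measurable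
  have hi : IntegrableOn (fun z : Rn n => w z / ‖z‖ ^ ((n : ℝ) + s - 1)) (Metric.ball 0 δ) := by
    refine integrableOn_ball_of_norm_le_rpow (C := w 0) (α := (n : ℝ) + s - 1)
      (by simpa [Nat.one_le_iff_ne_zero] using hn.ne') (by simpa using by linarith)
      (Eventually.of_forall fun z => ?_) (Measurable.aestronglyMeasurable (by fun_prop))
    rw [Real.rpow_neg (norm_nonneg _), ← div_eq_mul_inv, Real.norm_of_nonneg
      (div_nonneg (w.nonneg z) (Real.rpow_nonneg (norm_nonneg _) _))]
    gcongr
    exact w.decreasing 0 z (by simp)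
  obtain ⟨m, hm0, hm1, hm⟩ := w.eq_one
  have : Nonempty (Fin n) := ⟨⟨0, hn⟩⟩
  have hpos : 0 < ∫ z in Metric.ball (0 : Rn n) δ, w z / ‖z‖ ^ ((n : ℝ) + s - 1) := by
    rw [setIntegral_pos_iff_support_of_nonneg_ae (Eventually.of_forall fun z =>
      div_nonneg (w.nonneg z) (Real.rpow_nonneg (norm_nonneg _) _)) hi]
    have hsub : Metric.ball (0 : Rn n) (m * δ) \ {0} ⊆
        Function.support (fun z : Rn n => w z / ‖z‖ ^ ((n : ℝ) + s - 1)) ∩ Metric.ball 0 δ := by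
      intro z hz
      have hz0 : 0 < ‖z‖ := norm_pos_iff.2 hz.2
      refine ⟨?_, Metric.ball_subset_ball (by nlinarith) hz.1⟩
      simp only [Function.mem_support, hm z hz.1]
      positivity
    refine lt_of_lt_of_le ?_ (measure_mono hsub)
    rw [measure_sdiff_null (measure_singleton _)]
    exact Metric.measure_ball_pos _ _ (by positivity)
  have hn' : (0 : ℝ) < n := by exact_mod_cast hn
  exact ⟨div_pos hn' hpos, div_mul_cancel₀ _ hpos.ne'⟩

lemma measurable_kernel (s : ℝ) (w : Cutoff n δ) : Measurable (kernel s w) := by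
  have hw : Measurable w.toFun := w.smooth.continuous.measurable
  unfold kernel
  fun_prop

lemma integrable_kernel (s : ℝ) (w : Cutoff n δ) : Integrable (kernel s w) := by
  by_cases h : IntegrableOn (fun z : Rn n => w z / ‖z‖ ^ ((n : ℝ) + s - 1)) (Metric.ball 0 δ)
  · have hs : Function.support (fun z : Rn n => w z / ‖z‖ ^ ((n : ℝ) + s - 1)) ⊆
        Metric.ball 0 δ := by
      intro z hz
      refine w.tsupport_subset (subset_tsupport _ ?_)
      intro h0
      exact hz (by simp [h0])
    exact ((integrableOn_iff_integrable_of_support_subset hs).1 h).const_mul _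
  · have h0 : scaling s w = 0 := by
      unfold scaling
      rw [integral_undef h, div_zero]
    have : kernel s w = fun _ => 0 := by
      funext z; simp [kernel, h0]
    rw [this]; exact integrable_zero _ _ _

lemma norm_divIntegrand_le (s : ℝ) (w : Cutoff n δ) {ψ : Rn n → Rn n} {K : ℝ≥0}
    (hψ : LipschitzWith K ψ) (x y : Rn n) :
    ‖inner ℝ (‖x - y‖⁻¹ • (ψ x - ψ y)) (‖x - y‖⁻¹ • (x - y)) * kernel s w (x - y)‖
      ≤ K * ‖kernel s w (x - y)‖ := by
  rw [norm_mul]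
  gcongr
  refine (norm_inner_le_norm _ _).trans ?_
  rw [norm_smul, norm_smul, norm_inv, norm_norm]
  rcases eq_or_ne (‖x - y‖) 0 with h | h
  · simp [h]
  · rw [inv_mul_cancel₀ h, mul_one]
    have hp : 0 < ‖x - y‖ := lt_of_le_of_ne (norm_nonneg _) (Ne.symm h)
    rw [inv_mul_le_iff₀ hp, mul_comm]
    exact hψ.norm_sub_le x y

lemma integrable_divIntegrand (s : ℝ) (w : Cutoff n δ) {ψ : Rn n → Rn n} {K : ℝ≥0}
    (hψ : LipschitzWith K ψ) (x : Rn n) :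
    Integrable (fun y => inner ℝ (‖x - y‖⁻¹ • (ψ x - ψ y)) (‖x - y‖⁻¹ • (x - y)) *
      kernel s w (x - y)) := by
  have hk : Integrable (fun y => (K : ℝ) * kernel s w (x - y)) :=
    ((integrable_kernel s w).comp_sub_left x).const_mul _
  have hm := measurable_kernel s w
  have hψm : Measurable ψ := hψ.continuous.measurable
  refine hk.mono (Measurable.aestronglyMeasurable (by fun_prop)) (Eventually.of_forall fun y => ?_)
  refine (norm_divIntegrand_le s w hψ x y).trans_eq ?_
  rw [norm_mul]; simp

lemma stronglyMeasurable_nonlocalDiv (s : ℝ) (w : Cutoff n δ) {ψ : Rn n → Rn n}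
    (hψ : Continuous ψ) : StronglyMeasurable (nonlocalDiv s w ψ) := by
  have hm := measurable_kernel s w
  have hψm : Measurable ψ := hψ.measurable
  refine StronglyMeasurable.integral_prod_right
    (f := fun x y => inner ℝ (‖x - y‖⁻¹ • (ψ x - ψ y)) (‖x - y‖⁻¹ • (x - y)) *
      kernel s w (x - y)) ?_
  exact Measurable.stronglyMeasurable (by unfold Function.uncurry; fun_prop)

lemma norm_nonlocalDiv_le (s : ℝ) (w : Cutoff n δ) {ψ : Rn n → Rn n} {K : ℝ≥0}
    (hψ : LipschitzWith K ψ) (x : Rn n) :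
    ‖nonlocalDiv s w ψ x‖ ≤ K * ∫ z, ‖kernel s w z‖ := by
  have hk : Integrable (fun y => (K : ℝ) * ‖kernel s w (x - y)‖) :=
    (((integrable_kernel s w).comp_sub_left x).norm).const_mul _
  refine (norm_integral_le_of_norm_le hk
    (Eventually.of_forall fun y => norm_divIntegrand_le s w hψ x y)).trans_eq ?_
  rw [integral_const_mul, integral_sub_left_eq_self (fun z => ‖kernel s w z‖) volume x]

lemma nonlocalDiv_eq_zero (s : ℝ) (w : Cutoff n δ) {ψ : Rn n → Rn n} {x : Rn n}
    (hx : x ∉ tsupport ψ + tsupport w.toFun) : nonlocalDiv s w ψ x = 0 := by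
  unfold nonlocalDiv
  refine integral_eq_zero_of_ae (Eventually.of_forall fun y => ?_)
  simp only [Pi.zero_apply]
  by_cases hw : w (x - y) = 0
  · simp [kernel, hw]
  have hw' : x - y ∈ tsupport w.toFun := subset_tsupport _ hw
  have hy : ψ y = 0 := by
    by_contra h
    exact hx ⟨y, subset_tsupport _ h, x - y, hw', by simp⟩
  have hx' : ψ x = 0 := by
    by_contra h
    refine hx ⟨x, subset_tsupport _ h, 0, subset_tsupport _ ?_, by simp⟩
    have := w.decreasing 0 (x - y) (by simp)
    have h2 := w.nonneg (x - y)
    exact ne_of_gt (lt_of_lt_of_le (lt_of_le_of_ne h2 (Ne.symm hw)) this)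
  simp [hx', hy]

lemma integrableOn_mul_nonlocalDiv (s : ℝ) (w : Cutoff n δ) {Ω : Set (Rn n)} {u : Rn n → ℝ}
    (hu : LocallyIntegrableOn u (Metric.thickening δ Ω)) {ψ : Rn n → Rn n}
    (h1 : ContDiff ℝ ∞ ψ) (h2 : HasCompactSupport ψ) (h3 : tsupport ψ ⊆ Ω) :
    IntegrableOn (fun x => u x * nonlocalDiv s w ψ x) (Metric.thickening δ Ω) := by
  obtain ⟨K, hK⟩ := h1.lipschitzWith_of_hasCompactSupport h2 (by simp)
  set T := tsupport ψ + tsupport w.toFun with hT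
  have hTc : IsCompact T := h2.isCompact.add w.hasCompactSupport.isCompact
  have hTs : T ⊆ Metric.thickening δ Ω := by
    rw [← add_ball_zero]
    exact Set.add_subset_add h3 w.tsupport_subset
  have hTi : IntegrableOn (fun x => u x * nonlocalDiv s w ψ x) T :=
    Integrable.mul_bdd (c := K * ∫ z, ‖kernel s w z‖) (hu.integrableOn_compact_subset hTs hTc)
      (stronglyMeasurable_nonlocalDiv s w h1.continuous).aestronglyMeasurable
      (Eventually.of_forall fun x => norm_nonlocalDiv_le s w hK x)
  have hsupp : Function.support (fun x => u x * nonlocalDiv s w ψ x) ⊆ T := by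
    intro x hx
    by_contra h
    exact hx (by simp [nonlocalDiv_eq_zero s w h])
  exact ((integrableOn_iff_integrable_of_support_subset hsupp).1 hTi).integrableOn

lemma integrableOn_inner {Ω : Set (Rn n)} {v : Rn n → Rn n}
    (hv : LocallyIntegrableOn v Ω) {ψ : Rn n → Rn n}
    (h1 : Continuous ψ) (h2 : HasCompactSupport ψ) (h3 : tsupport ψ ⊆ Ω) :
    IntegrableOn (fun x => inner ℝ (v x) (ψ x)) Ω := by
  obtain ⟨C, hC⟩ := h2.exists_bound_of_continuous h1
  have hv' : IntegrableOn v (tsupport ψ) := hv.integrableOn_compact_subset h3 h2.isCompact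
  have hTi : IntegrableOn (fun x => inner ℝ (v x) (ψ x)) (tsupport ψ) := by
    refine Integrable.mono' (hv'.norm.mul_const C)
      (hv'.aestronglyMeasurable.inner h1.aestronglyMeasurable) (Eventually.of_forall fun x => ?_)
    refine (norm_inner_le_norm _ _).trans ?_
    gcongr
    exact hC x
  have hsupp : Function.support (fun x => inner ℝ (v x) (ψ x)) ⊆ tsupport ψ := by
    intro x hx
    refine subset_tsupport _ ?_
    intro h
    exact hx (by simp [h])
  exact ((integrableOn_iff_integrable_of_support_subset hsupp).1 hTi).integrableOn

lemma IsWeakNonlocalGradient.zero (s : ℝ) (w : Cutoff n δ) (Ω : Set (Rn n)) :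
    IsWeakNonlocalGradient s w Ω 0 0 where
  locallyIntegrableOn_fun := locallyIntegrableOn_zero
  locallyIntegrableOn_grad := locallyIntegrableOn_zero
  integral_by_parts := by intros; simp

lemma IsWeakNonlocalGradient.add {s : ℝ} {w : Cutoff n δ} {Ω : Set (Rn n)}
    {u u' : Rn n → ℝ} {v v' : Rn n → Rn n} (h : IsWeakNonlocalGradient s w Ω u v)
    (h' : IsWeakNonlocalGradient s w Ω u' v') :
    IsWeakNonlocalGradient s w Ω (u + u') (v + v') where
  locallyIntegrableOn_fun := h.locallyIntegrableOn_fun.add h'.locallyIntegrableOn_fun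
  locallyIntegrableOn_grad := h.locallyIntegrableOn_grad.add h'.locallyIntegrableOn_grad
  integral_by_parts := by
    intro ψ h1 h2 h3
    simp only [Pi.add_apply, inner_add_left, add_mul]
    rw [integral_add (integrableOn_inner h.locallyIntegrableOn_grad h1.continuous h2 h3)
      (integrableOn_inner h'.locallyIntegrableOn_grad h1.continuous h2 h3),
      integral_add (integrableOn_mul_nonlocalDiv s w h.locallyIntegrableOn_fun h1 h2 h3)
      (integrableOn_mul_nonlocalDiv s w h'.locallyIntegrableOn_fun h1 h2 h3),
      h.integral_by_parts ψ h1 h2 h3, h'.integral_by_parts ψ h1 h2 h3]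
    ring

lemma IsWeakNonlocalGradient.smul {s : ℝ} {w : Cutoff n δ} {Ω : Set (Rn n)}
    {u : Rn n → ℝ} {v : Rn n → Rn n} (c : ℝ) (h : IsWeakNonlocalGradient s w Ω u v) :
    IsWeakNonlocalGradient s w Ω (c • u) (c • v) where
  locallyIntegrableOn_fun := h.locallyIntegrableOn_fun.smul c
  locallyIntegrableOn_grad := h.locallyIntegrableOn_grad.smul c
  integral_by_parts := by
    intro ψ h1 h2 h3
    simp only [Pi.smul_apply, real_inner_smul_left, smul_eq_mul, mul_assoc]
    rw [integral_const_mul, integral_const_mul, h.integral_by_parts ψ h1 h2 h3]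
    ring

lemma IsWeakNonlocalGradient.congr {s : ℝ} {w : Cutoff n δ} {Ω : Set (Rn n)}
    {u u' : Rn n → ℝ} {v v' : Rn n → Rn n} (h : IsWeakNonlocalGradient s w Ω u v)
    (hu : u =ᵐ[volume.restrict (Metric.thickening δ Ω)] u') (hv : v =ᵐ[volume.restrict Ω] v') :
    IsWeakNonlocalGradient s w Ω u' v' where
  locallyIntegrableOn_fun := by
    intro x hx
    obtain ⟨t, ht, hi⟩ := h.locallyIntegrableOn_fun x hx
    refine ⟨t ∩ Metric.thickening δ Ω, inter_mem ht self_mem_nhdsWithin, ?_⟩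
    exact (hi.mono_set Set.inter_subset_left).congr_fun_ae
      (ae_restrict_of_ae_restrict_of_subset Set.inter_subset_right hu)
  locallyIntegrableOn_grad := by
    intro x hx
    obtain ⟨t, ht, hi⟩ := h.locallyIntegrableOn_grad x hx
    refine ⟨t ∩ Ω, inter_mem ht self_mem_nhdsWithin, ?_⟩
    exact (hi.mono_set Set.inter_subset_left).congr_fun_ae
      (ae_restrict_of_ae_restrict_of_subset Set.inter_subset_right hv)
  integral_by_parts := by
    intro ψ h1 h2 h3
    have e1 : ∫ x in Ω, inner ℝ (v' x) (ψ x) = ∫ x in Ω, inner ℝ (v x) (ψ x) :=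
      integral_congr_ae (by filter_upwards [hv] with x hx; rw [hx])
    have e2 : ∫ x in Metric.thickening δ Ω, u' x * nonlocalDiv s w ψ x =
        ∫ x in Metric.thickening δ Ω, u x * nonlocalDiv s w ψ x :=
      integral_congr_ae (by filter_upwards [hu] with x hx; rw [hx])
    rw [e1, e2, h.integral_by_parts ψ h1 h2 h3]

/-- A function has at most one weak nonlocal gradient. -/
lemma IsWeakNonlocalGradient.unique {s : ℝ} {w : Cutoff n δ} {Ω : Set (Rn n)} (hΩ : IsOpen Ω)
    {u : Rn n → ℝ} {v v' : Rn n → Rn n} (h : IsWeakNonlocalGradient s w Ω u v)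
    (h' : IsWeakNonlocalGradient s w Ω u v') : v =ᵐ[volume.restrict Ω] v' := by
  have key : ∀ᵐ x ∂volume, x ∈ Ω → (v - v') x = 0 := by
    refine hΩ.ae_eq_zero_of_integral_contDiff_smul_eq_zero
      (h.locallyIntegrableOn_grad.sub h'.locallyIntegrableOn_grad) fun g g1 g2 g3 => ?_
    have hs : Function.support (fun x => g x • (v - v') x) ⊆ Ω := fun x hx =>
      g3 (subset_tsupport _ fun h0 => hx (by simp [h0]))
    rw [← setIntegral_eq_integral_of_forall_compl_eq_zero (s := Ω)
      (fun x hx => by by_contra h0; exact hx (hs h0))]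
    by_cases hi : IntegrableOn (fun x => g x • (v - v') x) Ω
    swap
    · exact integral_undef hi
    refine ext_inner_right ℝ fun e => ?_
    rw [inner_zero_left, real_inner_comm, ← integral_inner hi]
    have hψ1 : ContDiff ℝ ∞ (fun x => g x • e) := g1.smul contDiff_const
    have hψ2 : HasCompactSupport (fun x => g x • e) := g2.smul_right
    have hψ3 : tsupport (fun x => g x • e) ⊆ Ω := (tsupport_smul_subset_left g _).trans g3
    have e1 := h.integral_by_parts _ hψ1 hψ2 hψ3
    have e2 := h'.integral_by_parts _ hψ1 hψ2 hψ3
    have e3 := integral_sub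
      (integrableOn_inner h.locallyIntegrableOn_grad hψ1.continuous hψ2 hψ3)
      (integrableOn_inner h'.locallyIntegrableOn_grad hψ1.continuous hψ2 hψ3)
    rw [e1, e2, sub_self] at e3
    rw [← e3]
    refine integral_congr_ae (Eventually.of_forall fun x => ?_)
    simp only [Pi.sub_apply, real_inner_smul_right, inner_sub_right, real_inner_comm e]
    ring
  rw [Filter.EventuallyEq, ae_restrict_iff' hΩ.measurableSet]
  filter_upwards [key] with x hx hxΩ
  exact sub_eq_zero.1 (hx hxΩ)

/-- The Lebesgue space `L^p(Ω_δ)`. -/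
abbrev LpThick (n : ℕ) (δ : ℝ) (p : ℝ≥0∞) (Ω : Set (Rn n)) : Type :=
  Lp ℝ p (volume.restrict (Metric.thickening δ Ω))

/-- The Lebesgue space `L^p(Ω; ℝⁿ)`. -/
abbrev LpVec (n : ℕ) (p : ℝ≥0∞) (Ω : Set (Rn n)) : Type :=
  Lp (Rn n) p (volume.restrict Ω)

/-- The nonlocal Sobolev space `H^{s,p,δ}(Ω)` of all `u ∈ L^p(Ω_δ)` with weak nonlocal gradient
`D_δ^s u ∈ L^p(Ω; ℝⁿ)`. Its elements are recorded together with their (unique) gradient, as pairs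
`(u, D_δ^s u)`; the norm inherited from the `p`-product is
`(‖u‖_{L^p(Ω_δ)}^p + ‖D_δ^s u‖_{L^p(Ω;ℝⁿ)}^p)^{1/p}`. -/
def HSpace (s : ℝ) (w : Cutoff n δ) (p : ℝ≥0∞) [Fact (1 ≤ p)] (Ω : Set (Rn n)) :
    Submodule ℝ (WithLp p (LpThick n δ p Ω × LpVec n p Ω)) where
  carrier := {f | IsWeakNonlocalGradient s w Ω f.fst f.snd}
  zero_mem' := (IsWeakNonlocalGradient.zero s w Ω).congr (Lp.coeFn_zero _ _ _).symm
    (Lp.coeFn_zero _ _ _).symm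
  add_mem' := fun {f g} hf hg => (IsWeakNonlocalGradient.add hf hg).congr
    (Lp.coeFn_add f.fst g.fst).symm (Lp.coeFn_add f.snd g.snd).symm
  smul_mem' := fun c f hf => (IsWeakNonlocalGradient.smul c hf).congr
    (Lp.coeFn_smul c f.fst).symm (Lp.coeFn_smul c f.snd).symm

section HSpace

variable {s : ℝ} {w : Cutoff n δ} {p : ℝ≥0∞} [Fact (1 ≤ p)] {Ω : Set (Rn n)}

/-- The element of `L^p(Ω_δ)` underlying `u ∈ H^{s,p,δ}(Ω)`. -/
def HSpace.fn (u : HSpace s w p Ω) : LpThick n δ p Ω :=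
  (u : WithLp p (LpThick n δ p Ω × LpVec n p Ω)).fst

/-- The nonlocal gradient `D_δ^s u ∈ L^p(Ω; ℝⁿ)` of `u ∈ H^{s,p,δ}(Ω)`. -/
def HSpace.grad (u : HSpace s w p Ω) : LpVec n p Ω :=
  (u : WithLp p (LpThick n δ p Ω × LpVec n p Ω)).snd

lemma HSpace.norm_eq (hp : p ≠ ⊤) (u : HSpace s w p Ω) :
    ‖u‖ = (‖HSpace.fn u‖ ^ p.toReal + ‖HSpace.grad u‖ ^ p.toReal) ^ (1 / p.toReal) :=
  WithLp.prod_norm_eq_add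
    (ENNReal.toReal_pos (one_pos.trans_le (Fact.out : (1 : ℝ≥0∞) ≤ p)).ne' hp) _

lemma HSpace.fn_injective (hΩ : IsOpen Ω) :
    Function.Injective (HSpace.fn : HSpace s w p Ω → LpThick n δ p Ω) := by
  intro u u' h
  have h1 : IsWeakNonlocalGradient s w Ω (HSpace.fn u) (HSpace.grad u) := u.2
  have h2 : IsWeakNonlocalGradient s w Ω (HSpace.fn u') (HSpace.grad u') := u'.2
  rw [← h] at h2
  have hg : HSpace.grad u = HSpace.grad u' := Lp.ext (h1.unique hΩ h2)
  refine Subtype.ext ?_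
  exact WithLp.ofLp_injective p (Prod.ext h hg)

end HSpace

/-- The set `N^{s,p,δ}(Ω)` of functions in `H^{s,p,δ}(Ω)` with zero nonlocal gradient,
as a subset of `L^p(Ω_δ)`. -/
def zeroGrad (s : ℝ) (w : Cutoff n δ) (p : ℝ≥0∞) [Fact (1 ≤ p)] (Ω : Set (Rn n)) :
    Set (LpThick n δ p Ω) :=
  {h | ∃ u : HSpace s w p Ω, HSpace.fn u = h ∧ HSpace.grad u = 0}

/-- `h` is a point of `N` of minimal distance to `v`. -/
def IsNearestPoint {X : Type*} [NormedAddCommGroup X] (N : Set X) (v h : X) : Prop :=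
  h ∈ N ∧ ∀ h' ∈ N, ‖v - h‖ ≤ ‖v - h'‖

open Classical in
/-- The metric projection onto `N`: it sends `v` to a point of `N` of minimal distance to `v`
(with value `0` in case there is no such point). -/
def metricProj {X : Type*} [NormedAddCommGroup X] (N : Set X) (v : X) : X :=
  if h : ∃ x, IsNearestPoint N v x then h.choose else 0

/-- The metric projection `π_δ^s : L^p(Ω_δ) → N^{s,p,δ}(Ω)`. -/
def proj (s : ℝ) (w : Cutoff n δ) (p : ℝ≥0∞) [Fact (1 ≤ p)] (Ω : Set (Rn n)) :
    LpThick n δ p Ω → LpThick n δ p Ω :=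
  metricProj (zeroGrad s w p Ω)

/-- Bounded Lipschitz domain: a bounded, connected open set which near every boundary point is
the set of points above the graph of a Lipschitz function, where "above" refers to some direction
`ν` and the function depends on the component orthogonal to `ν`. -/
structure IsBoundedLipschitzDomain (Ω : Set (Rn n)) : Prop where
  isOpen : IsOpen Ω
  isConnected : IsConnected Ω
  isBounded : Bornology.IsBounded Ω
  lipschitz_boundary : ∀ x₀ ∈ frontier Ω, ∃ ν : Rn n, ‖ν‖ = 1 ∧
    ∃ (K : ℝ≥0) (g : Rn n → ℝ), LipschitzWith K g ∧ ∃ r > 0, ∀ x ∈ Metric.ball x₀ r,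
      (x ∈ Ω ↔ g (x - inner ℝ ν x • ν) < inner ℝ ν x)

end FiniteHorizon

end

/-! The nonlocal gradient is a classical gradient in disguise. Let Q be the radial function
`potential`: it is integrable, supported in the closed ball of radius δ, and at most a multiple of
|x|^(-(n+s-1)). Then div_δ^s ψ = Q * div ψ (`nonlocalDiv_eq`), so D_δ^s u = ∇(Q * u) on Ω. Hence u ↦
(Q * u, D_δ^s u) is a continuous linear map into W^{1,p}(Ω), and it sends u_j - u to a weakly null
sequence z_j. A function k on ℝⁿ with Q * k = 0 on Ω restricts to an element of N
(`restr_mem_zeroGrad`). It therefore suffices to find such k_j with u_j - u - k_j → 0 in L^p.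

The k_j come from a right parametrix: compact operators A : W^{1,p}(Ω) → L^p(ℝⁿ) and K : W^{1,p}(Ω)
→ W^{1,p}(Ω) with Q * A z = z + K z on Ω. By compactness A z_j and K z_j tend to 0 strongly. The
functions u_j - u - A z_j are mapped to -K z_j, and a map T with T A = 1 + K is bounded below modulo
its kernel (`exists_norm_sub_ker_le`). So they lie within C‖K z_j‖ of that kernel; this is
`exists_ker_approx`.

The parametrix exists because of a surplus of s derivatives. On a Lipschitz domain a function f is
locally recovered from its gradient as f = η * f + Σ_i Φ_i * ∂_i f. The kernels Φ_i = `dyPhi η i`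
live in a cone along which Ω is not left (`local_representation`,
`IsBoundedLipschitzDomain.exists_representation`), and they gain one derivative. With a = (1-s)/2,
the potential Q is a constant times (1-Δ)^(-a) up to a better term (`conv_potential_besselB`), so
inverting it costs only 2a = 1-s < 1 derivatives. Therefore Ψ_i = (1-Δ)^a Φ_i, up to a constant, is
still an L¹ kernel `dyPsi` (`summable_besselB_dyField`), and Q * Ψ_i equals a constant times Φ_i
plus an L¹ kernel with L¹ derivatives. Convolution with an L¹ kernel after localization is compact
on L^p (`isCompactOperator_conv_mulOp`), which gives compactness of A and of K. Fractional powers of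
1-Δ appear only as superpositions of heat kernels, so that no Fourier analysis enters.

Finally, L^p is uniformly convex, in the form `PowUniformConvex`. This gives existence and
uniqueness of nearest points in the closed subspace N and continuity of the metric projection π.
Since π(v + h) = π(v) + h for h ∈ N, the difference v - π(v) depends only on v modulo N, and u_j -
k_j → u yields the claim (`tendsto_sub_metricProj`). -/

noncomputable section

namespace FiniteHorizon

/-! ### Compact perturbations of the identity and parametrices in Banach spaces -/

section Abstract

variable {X Y Z : Type*} [NormedAddCommGroup X] [NormedSpace ℝ X]
  [NormedAddCommGroup Y] [NormedSpace ℝ Y] [NormedAddCommGroup Z] [NormedSpace ℝ Z]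

/-- Weakly null sequences are bounded. -/
lemma exists_norm_le_of_weakly_null {z : ℕ → Z}
    (hz : ∀ g : Z →L[ℝ] ℝ, Tendsto (fun j => g (z j)) atTop (𝓝 0)) : ∃ C, ∀ j, ‖z j‖ ≤ C := by
  -- Completeness of `Z` is not needed: uniform boundedness is applied on the dual, which is
  -- complete.
  obtain ⟨C, hC⟩ := banach_steinhaus (g := fun j => NormedSpace.inclusionInDoubleDual ℝ Z (z j))
    (fun g => by
      obtain ⟨C, hC⟩ := (hz g).norm.bddAbove_range
      exact ⟨C, fun j => hC ⟨j, rfl⟩⟩)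
  refine ⟨C, fun j => ?_⟩
  have := hC j
  exact ((NormedSpace.inclusionInDoubleDualLi ℝ (E := Z)).norm_map (z j)).symm.le.trans this

/-- Compact operators map weakly null sequences to norm null sequences. -/
lemma tendsto_zero_of_isCompactOperator {L : Z →L[ℝ] X} (hL : IsCompactOperator L) {z : ℕ → Z}
    (hz : ∀ g : Z →L[ℝ] ℝ, Tendsto (fun j => g (z j)) atTop (𝓝 0)) :
    Tendsto (fun j => L (z j)) atTop (𝓝 0) := by
  obtain ⟨C, hC⟩ := exists_norm_le_of_weakly_null hz
  obtain ⟨K, hK, hKs⟩ := IsCompactOperator.image_closedBall_subset_compact (f := L.toLinearMap) hL C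
  refine tendsto_of_subseq_tendsto fun ns hns => ?_
  have hmem : ∀ j, L (z (ns j)) ∈ K := fun j => hKs ⟨z (ns j), by simpa using hC _, rfl⟩
  obtain ⟨y, -, φ, hφ, hy⟩ := hK.tendsto_subseq hmem
  refine ⟨φ, ?_⟩
  have hy0 : y = 0 := by
    refine SeparatingDual.eq_zero_of_forall_dual_eq_zero (R := ℝ) fun g => ?_
    have h1 : Tendsto (fun j => g (L (z (ns (φ j))))) atTop (𝓝 (g y)) :=
      (g.continuous.tendsto y).comp hy
    have h2 : Tendsto (fun j => g (L (z (ns (φ j))))) atTop (𝓝 0) :=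
      (hz (g.comp L)).comp (hns.comp hφ.tendsto_atTop)
    exact tendsto_nhds_unique h1 h2
  rw [hy0] at hy
  exact hy

/-- A bounded operator which is surjective up to a relative error `1/2` is surjective. -/
lemma surjective_of_approx [CompleteSpace X] {S : X →L[ℝ] Z} {C : ℝ}
    (h : ∀ z, ∃ x, ‖x‖ ≤ C * ‖z‖ ∧ ‖z - S x‖ ≤ ‖z‖ / 2) : Function.Surjective S := by
  choose g hg1 hg2 using h
  intro z
  -- Residuals of successive correction. Each step halves them, so the corrections `g (r k)` decay
  -- geometrically and their sum is an exact preimage.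
  let r : ℕ → Z := fun k => Nat.rec z (fun _ y => y - S (g y)) k
  have hr : ∀ k, r (k + 1) = r k - S (g (r k)) := fun k => rfl
  have hrn : ∀ k, ‖r k‖ ≤ ‖z‖ * (1 / 2) ^ k := by
    intro k
    induction k with
    | zero => simp [r]
    | succ k ih =>
      rw [hr, pow_succ]
      linarith [hg2 (r k)]
  have hC : ∀ k, ‖g (r k)‖ ≤ |C| * ‖z‖ * (1 / 2) ^ k := fun k =>
    calc ‖g (r k)‖ ≤ C * ‖r k‖ := hg1 _
      _ ≤ |C| * ‖r k‖ := by gcongr; exact le_abs_self C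
      _ ≤ |C| * (‖z‖ * (1 / 2) ^ k) := by gcongr; exact hrn k
      _ = _ := by ring
  have hsum : Summable (fun k => g (r k)) :=
    Summable.of_norm_bounded ((summable_geometric_of_lt_one (by norm_num) (by norm_num)).mul_left _)
      hC
  refine ⟨∑' k, g (r k), ?_⟩
  have h1 : Tendsto (fun N => ∑ k ∈ Finset.range N, S (g (r k))) atTop
      (𝓝 (S (∑' k, g (r k)))) := by
    have := (S.continuous.tendsto _).comp hsum.hasSum.tendsto_sum_nat
    simpa [Function.comp_def] using this
  have h2 : ∀ N, ∑ k ∈ Finset.range N, S (g (r k)) = z - r N := by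
    intro N
    induction N with
    | zero => simp [r]
    | succ N ih => rw [Finset.sum_range_succ, ih, hr]; abel
  have h3 : Tendsto r atTop (𝓝 0) := by
    refine squeeze_zero_norm hrn ?_
    simpa using (tendsto_pow_atTop_nhds_zero_of_lt_one (r := (1 / 2 : ℝ)) (by norm_num)
      (by norm_num)).const_mul ‖z‖
  simp only [h2] at h1
  have h4 : Tendsto (fun N => z - r N) atTop (𝓝 (z - 0)) := tendsto_const_nhds.sub h3
  rw [sub_zero] at h4
  exact tendsto_nhds_unique h1 h4

/-- The range of a compact perturbation of the identity has a finite-dimensional complement. -/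
lemma exists_finiteDimensional_add_range [CompleteSpace Z] {K : Z →L[ℝ] Z}
    (hK : IsCompactOperator K) :
    ∃ F : Submodule ℝ Z, FiniteDimensional ℝ F ∧ ∀ z, ∃ w, ∃ f ∈ F, z = w + K w + f := by
  obtain ⟨M, hM, hMs⟩ := IsCompactOperator.image_closedBall_subset_compact (f := K.toLinearMap) hK 1
  -- A finite 1/2-net of the image of the unit ball under `K`; its span serves as the complement.
  obtain ⟨t, htf, ht⟩ := Metric.totallyBounded_iff.1 hM.totallyBounded (1 / 2) (by norm_num)
  let F : Submodule ℝ Z := Submodule.span ℝ t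
  have hF : FiniteDimensional ℝ F := FiniteDimensional.span_of_finite ℝ htf
  have : CompleteSpace F := FiniteDimensional.complete ℝ F
  refine ⟨F, hF, ?_⟩
  let S : Z × F →L[ℝ] Z := (ContinuousLinearMap.id ℝ Z + K).coprod F.subtypeL
  obtain ⟨D, hD⟩ : ∃ D, ∀ y ∈ t, ‖y‖ ≤ D := by
    obtain ⟨D, hD⟩ := (htf.isBounded).exists_norm_le
    exact ⟨D, hD⟩
  have hS : Function.Surjective S := by
    refine surjective_of_approx (C := max 1 D) fun z => ?_
    by_cases hz : z = 0
    · exact ⟨0, by simp [hz]⟩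
    have hzn : 0 < ‖z‖ := norm_pos_iff.2 hz
    obtain ⟨y, hyt, hy⟩ : ∃ y ∈ t, dist (K (‖z‖⁻¹ • z)) y < 1 / 2 := by
      have : K (‖z‖⁻¹ • z) ∈ M := hMs ⟨‖z‖⁻¹ • z, by simp [norm_smul, hz], rfl⟩
      simpa using ht this
    -- With `y` a net point near `K (z/‖z‖)`, the first component reproduces `z` and the second
    -- cancels `K z` up to ‖z‖/2.
    refine ⟨(z, ⟨-(‖z‖ • y), F.neg_mem (F.smul_mem _ (Submodule.subset_span hyt))⟩), ?_, ?_⟩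
    · rw [Prod.norm_def]
      refine max_le ?_ ?_
      · exact le_mul_of_one_le_left hzn.le (le_max_left _ _)
      · change ‖-(‖z‖ • y)‖ ≤ _
        rw [norm_neg, norm_smul, norm_norm, mul_comm]
        gcongr
        exact (hD y hyt).trans (le_max_right _ _)
    · have e : z - S (z, ⟨-(‖z‖ • y), F.neg_mem (F.smul_mem _ (Submodule.subset_span hyt))⟩) =
          -(‖z‖ • (K (‖z‖⁻¹ • z) - y)) := by
        simp only [S, ContinuousLinearMap.coprod_apply, add_apply,
          ContinuousLinearMap.id_apply, Submodule.subtypeL_apply, map_smul, smul_sub, smul_smul,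
          mul_inv_cancel₀ hzn.ne', one_smul]
        abel
      rw [e, norm_neg, norm_smul, norm_norm, ← dist_eq_norm]
      nlinarith
  intro z
  obtain ⟨⟨w, f⟩, h⟩ := hS z
  exact ⟨w, f, f.2, by rw [← h]; simp [S]⟩

/-- If `T A = 1 + K` with `K` compact, then `T` is bounded below modulo its kernel. -/
lemma exists_norm_sub_ker_le [CompleteSpace X] [CompleteSpace Z] {T : X →L[ℝ] Z} {A : Z → X}
    {K : Z →L[ℝ] Z} (hK : IsCompactOperator K) (h : ∀ z, T (A z) = z + K z) :
    ∃ C, ∀ x, ∃ k, T k = 0 ∧ ‖x - k‖ ≤ C * ‖T x‖ := by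
  obtain ⟨F, hF, hFs⟩ := exists_finiteDimensional_add_range hK
  have : CompleteSpace F := FiniteDimensional.complete ℝ F
  let S : X × F →L[ℝ] Z := T.coprod F.subtypeL
  have hS : Function.Surjective S := fun z => by
    obtain ⟨w, f, hf, e⟩ := hFs z
    exact ⟨(A w, ⟨f, hf⟩), by simp [S, h, e]⟩
  obtain ⟨C, hC0, hC⟩ := S.exists_preimage_norm_le hS
  -- In a controlled solution of `T u + f = T x`, the part `f` lies in `F` and in the range of `T`.
  -- On this finite-dimensional space `T` has a linear section, which is automatically bounded.
  let F₁ : Submodule ℝ Z := F ⊓ LinearMap.range T.toLinearMap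
  have hF₁ : FiniteDimensional ℝ F₁ := Submodule.finiteDimensional_inf_left _ _
  obtain ⟨σ, hσ⟩ : ∃ σ : F₁ →ₗ[ℝ] X, ∀ f : F₁, T (σ f) = f := by
    let R : Submodule ℝ Z := LinearMap.range T.toLinearMap
    obtain ⟨g, hg⟩ := T.toLinearMap.rangeRestrict.exists_rightInverse_of_surjective
      T.toLinearMap.range_rangeRestrict
    refine ⟨g ∘ₗ Submodule.inclusion inf_le_right, fun f => ?_⟩
    have := LinearMap.congr_fun hg (Submodule.inclusion inf_le_right f)
    simpa using congrArg Subtype.val this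
  let σ' : F₁ →L[ℝ] X := LinearMap.toContinuousLinearMap σ
  refine ⟨C + ‖σ'‖ * C, fun x => ?_⟩
  obtain ⟨⟨u, f⟩, h1, h2⟩ := hC (T x)
  have h1' : T u + f = T x := by simpa [S] using h1
  have hf : (f : Z) ∈ F₁ := ⟨f.2, x - u, by simp [← h1']⟩
  refine ⟨x - u - σ ⟨f, hf⟩, ?_, ?_⟩
  · rw [map_sub, map_sub, hσ, ← h1']; simp
  · have e : x - (x - u - σ ⟨f, hf⟩) = u + σ' ⟨f, hf⟩ := by
      simp only [σ', LinearMap.coe_toContinuousLinearMap']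
      abel
    rw [e]
    have hu : ‖u‖ ≤ C * ‖T x‖ := (norm_fst_le (u, f)).trans h2
    have hf' : ‖f‖ ≤ C * ‖T x‖ := (norm_snd_le (u, f)).trans h2
    calc ‖u + σ' ⟨f, hf⟩‖ ≤ ‖u‖ + ‖σ'‖ * ‖f‖ :=
          (norm_add_le _ _).trans (by gcongr; exact σ'.le_opNorm ⟨f, hf⟩)
      _ ≤ C * ‖T x‖ + ‖σ'‖ * (C * ‖T x‖) := by gcongr
      _ = _ := by ring

/-- If `Q` has a compact right parametrix relative to `ι`, then sequences whose images under `Q`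
come from a weakly null sequence approach the kernel of `Q`. -/
theorem exists_ker_approx [CompleteSpace X] [CompleteSpace Z] {Q : X →L[ℝ] Y} {ι : Z →L[ℝ] Y}
    {A : Z →L[ℝ] X} {K : Z →L[ℝ] Z} (hA : IsCompactOperator A) (hK : IsCompactOperator K)
    (h : ∀ z, Q (A z) = ι (z + K z)) {u : ℕ → X} {z : ℕ → Z} (huz : ∀ j, Q (u j) = ι (z j))
    (hz : ∀ g : Z →L[ℝ] ℝ, Tendsto (fun j => g (z j)) atTop (𝓝 0)) :
    ∃ k : ℕ → X, (∀ j, Q (k j) = 0) ∧ Tendsto (fun j => u j - k j) atTop (𝓝 0) := by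
  -- The closed subspace `H` of pairs with `Q x = ι z` is a Banach space. On it the second
  -- projection plays the role of `Q` with values in `Z`, and `h` makes `y ↦ (A y, y + K y)` a right
  -- inverse modulo `K`.
  let D : X × Z →L[ℝ] Y := Q.comp (.fst ℝ X Z) - ι.comp (.snd ℝ X Z)
  let H : Submodule ℝ (X × Z) := LinearMap.ker D.toLinearMap
  have hH : IsClosed (H : Set (X × Z)) := D.isClosed_ker
  have : CompleteSpace H := hH.completeSpace_coe
  have hmem : ∀ x y, Q x = ι y → (x, y) ∈ H := fun x y e => by
    simp [H, D, e]
  let T : H →L[ℝ] Z := (ContinuousLinearMap.snd ℝ X Z).comp H.subtypeL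
  obtain ⟨C, hC⟩ := exists_norm_sub_ker_le (T := T)
    (A := fun y => ⟨(A y, y + K y), hmem _ _ (h y)⟩) hK (fun y => rfl)
  have hr : ∀ j, Q (u j - A (z j)) = ι (-K (z j)) := fun j => by
    rw [map_sub, huz, h]; simp
  choose k hk1 hk2 using fun j => hC ⟨(u j - A (z j), -K (z j)), hmem _ _ (hr j)⟩
  refine ⟨fun j => (k j : X × Z).1, fun j => ?_, ?_⟩
  · have h1 : Q (k j : X × Z).1 - ι (k j : X × Z).2 = 0 := (k j).2
    have h2 : (k j : X × Z).2 = 0 := hk1 j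
    rwa [h2, map_zero, sub_zero] at h1
  · have hA0 := tendsto_zero_of_isCompactOperator hA hz
    have hK0 := tendsto_zero_of_isCompactOperator hK hz
    have h1 : Tendsto (fun j => u j - A (z j) - (k j : X × Z).1) atTop (𝓝 0) := by
      refine squeeze_zero_norm (a := fun j => C * ‖K (z j)‖) (fun j => ?_)
        (by simpa using hK0.norm.const_mul C)
      have h2 : ‖u j - A (z j) - (k j : X × Z).1‖ ≤ C * ‖-K (z j)‖ :=
        (norm_fst_le (((⟨(u j - A (z j), -K (z j)), hmem _ _ (hr j)⟩ : H) - k j : H) : X × Z)).trans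
          (hk2 j)
      rwa [norm_neg] at h2
    have := h1.add hA0
    simp only [add_zero] at this
    refine this.congr fun j => by abel

end Abstract

/-! ### Uniform convexity of Lebesgue spaces -/

section UniformConvexity

/-- A quantitative form of uniform convexity, adapted to the `r`-th power of the norm. -/
def PowUniformConvex (X : Type*) [NormedAddCommGroup X] [NormedSpace ℝ X] (r : ℝ) : Prop :=
  ∀ ε > 0, ∃ C, 0 ≤ C ∧ ∀ a b : X, ‖a - b‖ ^ r ≤ ε * (‖a‖ ^ r + ‖b‖ ^ r) +
    C * ((‖a‖ ^ r + ‖b‖ ^ r) / 2 - ‖(2⁻¹ : ℝ) • (a + b)‖ ^ r)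

lemma abs_half_add_rpow_le {r : ℝ} (hr : 1 < r) (a b : ℝ) :
    |2⁻¹ * (a + b)| ^ r ≤ (|a| ^ r + |b| ^ r) / 2 := by
  have h := (convexOn_rpow hr.le).2
  specialize @h |a| (abs_nonneg a) |b| (abs_nonneg b) 2⁻¹ 2⁻¹ (by norm_num) (by norm_num)
    (by norm_num)
  simp only [smul_eq_mul] at h
  have h2 : |2⁻¹ * (a + b)| ≤ 2⁻¹ * |a| + 2⁻¹ * |b| := by
    rw [abs_mul, abs_of_pos (by norm_num : (0 : ℝ) < 2⁻¹), ← mul_add]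
    gcongr
    exact abs_add_le a b
  calc |2⁻¹ * (a + b)| ^ r ≤ (2⁻¹ * |a| + 2⁻¹ * |b|) ^ r := by gcongr
    _ ≤ _ := h
    _ = _ := by ring

/-- Strictness has two sources. If |a| ≠ |b|, the r-th power is strictly convex. If |a| = |b|, then
a = -b ≠ 0 and the midpoint is 0. -/
lemma abs_half_add_rpow_lt {r : ℝ} (hr : 1 < r) {a b : ℝ} (hab : a ≠ b) :
    |2⁻¹ * (a + b)| ^ r < (|a| ^ r + |b| ^ r) / 2 := by
  have h2 : |2⁻¹ * (a + b)| ≤ 2⁻¹ * |a| + 2⁻¹ * |b| := by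
    rw [abs_mul, abs_of_pos (by norm_num : (0 : ℝ) < 2⁻¹), ← mul_add]
    gcongr
    exact abs_add_le a b
  by_cases h : |a| = |b|
  · have hb : a = -b := (abs_eq_abs.1 h).resolve_left hab
    have hb0 : b ≠ 0 := fun h0 => hab (by simp [hb, h0])
    have : 0 < |b| ^ r := Real.rpow_pos_of_pos (abs_pos.2 hb0) r
    rw [h, hb]
    simp only [neg_add_cancel, mul_zero, abs_zero]
    rw [Real.zero_rpow (by linarith)]
    linarith
  · have h3 := (strictConvexOn_rpow hr).2
    specialize @h3 |a| (abs_nonneg a) |b| (abs_nonneg b) h 2⁻¹ 2⁻¹ (by norm_num) (by norm_num)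
      (by norm_num)
    simp only [smul_eq_mul] at h3
    calc |2⁻¹ * (a + b)| ^ r ≤ (2⁻¹ * |a| + 2⁻¹ * |b|) ^ r := by gcongr
      _ < _ := h3
      _ = _ := by ring

/-- Both sides are homogeneous of degree r, so it suffices to treat the compact curve |a|^r + |b|^r
= 1. There, either |a-b|^r < ε, or (a, b) lies in a compact set on which the convexity gap has a
positive minimum m; the constant |M|/m, with M a bound for |a-b|^r, covers the second case. -/
lemma powUniformConvex_real {r : ℝ} (hr : 1 < r) : PowUniformConvex ℝ r := by
  have hr0 : 0 < r := by linarith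
  intro ε hε
  let S : Set (ℝ × ℝ) := {x | |x.1| ^ r + |x.2| ^ r = 1}
  have hc1 : Continuous fun x : ℝ × ℝ => |x.1 - x.2| ^ r :=
    (by fun_prop : Continuous fun x : ℝ × ℝ => |x.1 - x.2|).rpow_const fun _ => Or.inr hr0.le
  have hc2 : Continuous fun x : ℝ × ℝ => |x.1| ^ r + |x.2| ^ r :=
    ((by fun_prop : Continuous fun x : ℝ × ℝ => |x.1|).rpow_const fun _ => Or.inr hr0.le).add
    ((by fun_prop : Continuous fun x : ℝ × ℝ => |x.2|).rpow_const fun _ => Or.inr hr0.le)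
  have hc3 : Continuous fun x : ℝ × ℝ => |2⁻¹ * (x.1 + x.2)| ^ r :=
    (by fun_prop : Continuous fun x : ℝ × ℝ => |2⁻¹ * (x.1 + x.2)|).rpow_const
      fun _ => Or.inr hr0.le
  have hS : IsCompact S := by
    refine Metric.isCompact_of_isClosed_isBounded (isClosed_eq hc2 continuous_const) ?_
    refine (Metric.isBounded_closedBall (x := (0 : ℝ × ℝ)) (r := 1)).subset fun x hx => ?_
    have hx' : |x.1| ^ r + |x.2| ^ r = 1 := hx
    have h1 : 0 ≤ |x.1| ^ r := by positivity
    have h2 : 0 ≤ |x.2| ^ r := by positivity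
    have hle : ∀ y : ℝ, |y| ^ r ≤ 1 → |y| ≤ 1 := fun y hy => by
      by_contra h
      exact absurd hy (not_le.2 (Real.one_lt_rpow (not_le.1 h) hr0))
    rw [mem_closedBall_zero_iff, Prod.norm_def]
    exact max_le (hle _ (by linarith)) (hle _ (by linarith))
  let g : ℝ × ℝ → ℝ := fun x => (|x.1| ^ r + |x.2| ^ r) / 2 - |2⁻¹ * (x.1 + x.2)| ^ r
  have hg : Continuous g := (hc2.div_const 2).sub hc3
  obtain ⟨M, hM⟩ : ∃ M, ∀ x ∈ S, |x.1 - x.2| ^ r ≤ M :=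
    (hS.bddAbove_image hc1.continuousOn).imp fun M hM x hx => hM ⟨x, hx, rfl⟩
  let S' : Set (ℝ × ℝ) := S ∩ {x | ε ≤ |x.1 - x.2| ^ r}
  have hS' : IsCompact S' := hS.inter_right (isClosed_le continuous_const hc1)
  obtain ⟨m, hm0, hm⟩ : ∃ m > 0, ∀ x ∈ S', m ≤ g x := by
    rcases S'.eq_empty_or_nonempty with h | h
    · exact ⟨1, one_pos, by simp [h]⟩
    obtain ⟨x₀, hx₀, hmin⟩ := hS'.exists_isMinOn h hg.continuousOn
    refine ⟨g x₀, sub_pos.2 (abs_half_add_rpow_lt hr fun h0 => ?_), fun x hx => hmin hx⟩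
    have := hx₀.2
    simp only [Set.mem_ofPred_eq, h0, sub_self, abs_zero] at this
    rw [Real.zero_rpow hr0.ne'] at this
    linarith
  refine ⟨|M| / m, by positivity, fun a b => ?_⟩
  simp only [Real.norm_eq_abs, smul_eq_mul]
  set t := |a| ^ r + |b| ^ r with ht
  have ha0 : 0 ≤ |a| ^ r := by positivity
  have hb0 : 0 ≤ |b| ^ r := by positivity
  have ht0 : 0 ≤ t := by positivity
  rcases ht0.eq_or_lt with h | h
  · have ha : |a| ^ r = 0 := by linarith
    have hb : |b| ^ r = 0 := by linarith
    rw [Real.rpow_eq_zero (abs_nonneg _) hr0.ne', abs_eq_zero] at ha hb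
    simp [← h, ha, hb, Real.zero_rpow hr0.ne']
  -- The scaling factor that brings (a, b) onto the curve `S`.
  set l := t ^ r⁻¹ with hl
  have hl0 : 0 < l := Real.rpow_pos_of_pos h _
  have hlr : l ^ r = t := Real.rpow_inv_rpow ht0 hr0.ne'
  have key : ∀ x ∈ S, |x.1 - x.2| ^ r ≤ ε + |M| / m * g x := by
    intro x hx
    have hg0 : 0 ≤ g x := sub_nonneg.2 (abs_half_add_rpow_le hr _ _)
    by_cases hxe : ε ≤ |x.1 - x.2| ^ r
    · have h1 := hm x ⟨hx, hxe⟩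
      have h2 : |M| ≤ |M| / m * g x := by
        rw [div_mul_eq_mul_div, le_div_iff₀ hm0]
        gcongr
      linarith [hM x hx, le_abs_self M]
    · have : 0 ≤ |M| / m * g x := by positivity
      linarith [not_le.1 hxe]
  have hdiv : ∀ y : ℝ, |y / l| ^ r = |y| ^ r / t := fun y => by
    rw [abs_div, abs_of_pos hl0, Real.div_rpow (abs_nonneg _) hl0.le, hlr]
  have h1 := key (a / l, b / l) (by
    change |a / l| ^ r + |b / l| ^ r = 1
    rw [hdiv, hdiv, ← add_div, div_self h.ne'])
  simp only [g] at h1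
  rw [← sub_div, ← add_div, ← mul_div_assoc, hdiv, hdiv, hdiv, hdiv, ← add_div, ← ht,
    div_self h.ne', div_le_iff₀ h] at h1
  calc _ ≤ _ := h1
    _ = ε * t + |M| / m * (1 / 2 * t - |2⁻¹ * (a + b)| ^ r / t * t) := by ring
    _ = _ := by rw [div_mul_cancel₀ _ h.ne']; ring

lemma norm_rpow_eq_integral {α : Type*} {m : MeasurableSpace α} {μ : Measure α} {p : ℝ≥0∞}
    [Fact (1 ≤ p)] (hp : p ≠ ⊤) (f : Lp ℝ p μ) :
    ‖f‖ ^ p.toReal = ∫ x, |f x| ^ p.toReal ∂μ := by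
  have hp0 : p ≠ 0 := (one_pos.trans_le (Fact.out : (1 : ℝ≥0∞) ≤ p)).ne'
  rw [Lp.norm_def, toReal_eLpNorm (Lp.aestronglyMeasurable f),
    lpNorm_eq_integral_norm_rpow_toReal hp0 hp (Lp.aestronglyMeasurable f),
    Real.rpow_inv_rpow (by positivity) (ENNReal.toReal_pos hp0 hp).ne']
  rfl

/-- With r = p every term is the integral of an r-th power, so the scalar inequality integrates with
the same constant. -/
lemma powUniformConvex_Lp {α : Type*} {m : MeasurableSpace α} {μ : Measure α} {p : ℝ≥0∞}
    [Fact (1 ≤ p)] (hp1 : 1 < p) (hp : p ≠ ⊤) : PowUniformConvex (Lp ℝ p μ) p.toReal := by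
  have hp0 : p ≠ 0 := (one_pos.trans hp1).ne'
  have hr : 1 < p.toReal := by
    rw [← ENNReal.toReal_one]; exact ENNReal.toReal_strict_mono hp hp1
  intro ε hε
  obtain ⟨C, hC0, hC⟩ := powUniformConvex_real hr ε hε
  refine ⟨C, hC0, fun f g => ?_⟩
  have hi : ∀ f : Lp ℝ p μ, Integrable (fun x => |f x| ^ p.toReal) μ := fun f =>
    (Lp.memLp f).integrable_norm_rpow hp0 hp
  simp only [norm_rpow_eq_integral hp]
  have hd : ∀ᵐ x ∂μ, (f - g) x = f x - g x := Lp.coeFn_sub f g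
  have hs : ∀ᵐ x ∂μ, ((2⁻¹ : ℝ) • (f + g)) x = 2⁻¹ * (f x + g x) := by
    filter_upwards [Lp.coeFn_smul (2⁻¹ : ℝ) (f + g), Lp.coeFn_add f g] with x h1 h2
    rw [h1, Pi.smul_apply, h2]; rfl
  have h1 : Integrable (fun x => |f x| ^ p.toReal + |g x| ^ p.toReal) μ := (hi f).add (hi g)
  have h2 : Integrable (fun x => (|f x| ^ p.toReal + |g x| ^ p.toReal) / 2) μ := h1.div_const _
  have h3 : Integrable (fun x => (|f x| ^ p.toReal + |g x| ^ p.toReal) / 2 -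
      |((2⁻¹ : ℝ) • (f + g)) x| ^ p.toReal) μ := h2.sub (hi _)
  rw [← integral_add (hi f) (hi g), ← integral_const_mul, ← integral_div,
    ← integral_sub h2 (hi _), ← integral_const_mul,
    ← integral_add (h1.const_mul _) (h3.const_mul _)]
  refine integral_mono_ae (hi _) ((h1.const_mul _).add (h3.const_mul _)) ?_
  filter_upwards [hd, hs] with x h1 h2
  have := hC (f x) (g x)
  simp only [Real.norm_eq_abs, smul_eq_mul] at this
  change |(f - g) x| ^ _ ≤ _
  rw [h1, h2]
  exact this

end UniformConvexity

/-! ### Metric projections onto closed subspaces -/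

section MetricProjection

variable {X : Type*} [NormedAddCommGroup X] [NormedSpace ℝ X] {r : ℝ}

/-- The midpoint of `h` and `h'` again lies in `N`, hence is no closer to `v` than `d`. The
convexity gap of `v - h` and `v - h'` is then at most (d+τ)^r - d^r, which is small. Uniqueness,
existence and continuity of nearest points all rest on this. -/
lemma PowUniformConvex.norm_sub_le (hX : PowUniformConvex X r) (hr : 0 < r) (N : Submodule ℝ X)
    {v : X} {d : ℝ} (hd0 : 0 ≤ d) (hd : ∀ h ∈ N, d ≤ ‖v - h‖) {η : ℝ} (hη : 0 < η) :
    ∃ τ > 0, ∀ h ∈ N, ∀ h' ∈ N, ‖v - h‖ ≤ d + τ → ‖v - h'‖ ≤ d + τ → ‖h - h'‖ ≤ η := by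
  have hηr : 0 < η ^ r := Real.rpow_pos_of_pos hη r
  have hD : 0 < (d + 1) ^ r := Real.rpow_pos_of_pos (by linarith) r
  -- For τ ≤ 1 the first term of the inequality is then at most η^r/2; the other half is left for
  -- the gap and fixes τ.
  obtain ⟨C, hC0, hC⟩ := hX (η ^ r / (4 * (d + 1) ^ r)) (by positivity)
  have hcont : Tendsto (fun τ : ℝ => C * ((d + τ) ^ r - d ^ r)) (𝓝[>] 0) (𝓝 0) := by
    have : Continuous fun τ : ℝ => C * ((d + τ) ^ r - d ^ r) :=
      (((continuous_const.add continuous_id).rpow_const fun _ => Or.inr hr.le).sub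
        continuous_const).const_mul _ |>.congr fun _ => rfl
    have h := this.tendsto 0
    simp only [add_zero, sub_self, mul_zero] at h
    exact h.mono_left nhdsWithin_le_nhds
  obtain ⟨τ, hτ, hτ0, hτ1⟩ := ((hcont.eventually (gt_mem_nhds (half_pos hηr))).and
    (Ioo_mem_nhdsGT (zero_lt_one (α := ℝ)))).exists
  refine ⟨τ, hτ0, fun h hh h' hh' h1 h2 => ?_⟩
  have key := hC (v - h) (v - h')
  have e1 : v - h - (v - h') = h' - h := by abel
  have e2 : (2⁻¹ : ℝ) • (v - h + (v - h')) = v - (2⁻¹ : ℝ) • (h + h') := by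
    have : (2⁻¹ : ℝ) • (v + v) = v := by
      rw [← two_smul ℝ v, smul_smul]; norm_num
    nth_rewrite 3 [← this]
    rw [← smul_sub]; congr 1; abel
  have h3 : d ^ r ≤ ‖v - (2⁻¹ : ℝ) • (h + h')‖ ^ r := by
    gcongr
    exact hd _ (N.smul_mem _ (N.add_mem hh hh'))
  have h4 : ‖v - h‖ ^ r ≤ (d + τ) ^ r := by gcongr
  have h5 : ‖v - h'‖ ^ r ≤ (d + τ) ^ r := by gcongr
  have h6 : (d + τ) ^ r ≤ (d + 1) ^ r := by gcongr
  rw [e1, e2] at key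
  have h7 : η ^ r / (4 * (d + 1) ^ r) * (‖v - h‖ ^ r + ‖v - h'‖ ^ r) ≤ η ^ r / 2 := by
    calc _ ≤ η ^ r / (4 * (d + 1) ^ r) * ((d + 1) ^ r + (d + 1) ^ r) := by gcongr <;> linarith
      _ = η ^ r / 2 := by field_simp; ring
  have h8 : C * ((‖v - h‖ ^ r + ‖v - h'‖ ^ r) / 2 - ‖v - (2⁻¹ : ℝ) • (h + h')‖ ^ r) ≤
      C * ((d + τ) ^ r - d ^ r) := by
    gcongr; linarith
  have h9 : ‖h' - h‖ ^ r ≤ η ^ r := by linarith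
  rw [norm_sub_rev]
  exact (Real.rpow_le_rpow_iff (norm_nonneg _) hη.le hr).1 h9

lemma IsNearestPoint.unique (hX : PowUniformConvex X r) (hr : 0 < r) {N : Submodule ℝ X}
    {v h h' : X} (h1 : IsNearestPoint (N : Set X) v h) (h2 : IsNearestPoint (N : Set X) v h') :
    h = h' := by
  rw [← sub_eq_zero, ← norm_le_zero_iff]
  refine le_of_forall_pos_le_add fun η hη => ?_
  obtain ⟨τ, hτ, H⟩ := hX.norm_sub_le hr N (norm_nonneg (v - h)) h1.2 hη
  rw [zero_add]
  exact H h h1.1 h' h2.1 (by linarith) (by linarith [h2.2 h h1.1])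

/-- Minimizing sequences for the distance to a closed subspace converge to a nearest point. -/
lemma PowUniformConvex.exists_isNearestPoint [CompleteSpace X] (hX : PowUniformConvex X r)
    (hr : 0 < r) {N : Submodule ℝ X} (hN : IsClosed (N : Set X)) (v : X) :
    ∃ h, IsNearestPoint (N : Set X) v h := by
  let d := Metric.infDist v N
  have hne : (N : Set X).Nonempty := ⟨0, N.zero_mem⟩
  have hd : ∀ h ∈ N, d ≤ ‖v - h‖ := fun h hh => by
    rw [← dist_eq_norm]; exact Metric.infDist_le_dist_of_mem hh
  have hex : ∀ k : ℕ, ∃ h ∈ N, ‖v - h‖ < d + 1 / (k + 1 : ℝ) := fun k => by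
    obtain ⟨h, hh, hlt⟩ := (Metric.infDist_lt_iff hne).1
      (lt_add_of_pos_right d (Nat.one_div_pos_of_nat (n := k) (α := ℝ)))
    exact ⟨h, hh, by rwa [← dist_eq_norm]⟩
  choose h hhN hh using hex
  have hcau : CauchySeq h := by
    refine Metric.cauchySeq_iff'.2 fun η hη => ?_
    obtain ⟨τ, hτ, H⟩ := hX.norm_sub_le hr N Metric.infDist_nonneg hd (half_pos hη)
    obtain ⟨k, hk⟩ := exists_nat_one_div_lt hτ
    refine ⟨k, fun j hj => ?_⟩
    have hjk : 1 / (j + 1 : ℝ) ≤ 1 / (k + 1 : ℝ) := by gcongr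
    rw [dist_eq_norm]
    have := H _ (hhN j) _ (hhN k) (by linarith [hh j]) (by linarith [hh k])
    linarith
  obtain ⟨x, hx⟩ := cauchySeq_tendsto_of_complete hcau
  refine ⟨x, hN.mem_of_tendsto hx (Eventually.of_forall hhN), fun h' hh' => ?_⟩
  have h1 : Tendsto (fun k => ‖v - h k‖) atTop (𝓝 ‖v - x‖) := (tendsto_const_nhds.sub hx).norm
  have h2 : Tendsto (fun k : ℕ => d + 1 / (k + 1 : ℝ)) atTop (𝓝 (d + 0)) :=
    tendsto_const_nhds.add tendsto_one_div_add_atTop_nhds_zero_nat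
  have h3 := le_of_tendsto_of_tendsto' h1 h2 fun k => (hh k).le
  linarith [hd h' hh']

variable [CompleteSpace X]

lemma isNearestPoint_metricProj (hX : PowUniformConvex X r) (hr : 0 < r) {N : Submodule ℝ X}
    (hN : IsClosed (N : Set X)) (v : X) :
    IsNearestPoint (N : Set X) v (metricProj (N : Set X) v) := by
  have h := hX.exists_isNearestPoint hr hN v
  unfold metricProj
  rw [dif_pos h]
  exact h.choose_spec

lemma metricProj_eq (hX : PowUniformConvex X r) (hr : 0 < r) {N : Submodule ℝ X}
    (hN : IsClosed (N : Set X)) {v h : X} (h0 : IsNearestPoint (N : Set X) v h) :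
    metricProj (N : Set X) v = h :=
  (isNearestPoint_metricProj hX hr hN v).unique hX hr h0

/-- Translation by an element of the subspace permutes the competitors, so v - π(v) is a function of
the class of v modulo `N`. -/
lemma metricProj_add (hX : PowUniformConvex X r) (hr : 0 < r) {N : Submodule ℝ X}
    (hN : IsClosed (N : Set X)) (v : X) {h : X} (hh : h ∈ N) :
    metricProj (N : Set X) (v + h) = metricProj (N : Set X) v + h := by
  have h1 := isNearestPoint_metricProj hX hr hN v
  refine metricProj_eq hX hr hN ⟨N.add_mem h1.1 hh, fun h' hh' => ?_⟩
  have := h1.2 (h' - h) (N.sub_mem hh' hh)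
  convert this using 2 <;> abel

/-- The point π(v_j) is an almost nearest point to v₀: its distance exceeds the minimum by at most
2‖v_j - v₀‖. Almost nearest points are close to the nearest one. -/
lemma tendsto_metricProj (hX : PowUniformConvex X r) (hr : 0 < r) {N : Submodule ℝ X}
    (hN : IsClosed (N : Set X)) {v : ℕ → X} {v₀ : X} (hv : Tendsto v atTop (𝓝 v₀)) :
    Tendsto (fun j => metricProj (N : Set X) (v j)) atTop (𝓝 (metricProj (N : Set X) v₀)) := by
  have h0 := isNearestPoint_metricProj hX hr hN v₀
  refine Metric.tendsto_atTop.2 fun η hη => ?_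
  obtain ⟨τ, hτ, H⟩ := hX.norm_sub_le hr N (norm_nonneg _) h0.2 (half_pos hη)
  obtain ⟨J, hJ⟩ := Metric.tendsto_atTop.1 hv (τ / 2) (half_pos hτ)
  refine ⟨J, fun j hj => ?_⟩
  have hj' := hJ j hj
  rw [dist_eq_norm] at hj' ⊢
  have h1 := isNearestPoint_metricProj hX hr hN (v j)
  have h2 : ‖v₀ - metricProj (N : Set X) (v j)‖ ≤
      ‖v j - v₀‖ + ‖v j - metricProj (N : Set X) (v j)‖ := by
    rw [norm_sub_rev (v j) v₀]; exact norm_sub_le_norm_sub_add_norm_sub _ _ _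
  have h3 : ‖v j - metricProj (N : Set X) v₀‖ ≤
      ‖v j - v₀‖ + ‖v₀ - metricProj (N : Set X) v₀‖ := norm_sub_le_norm_sub_add_norm_sub _ _ _
  have h4 := h1.2 _ h0.1
  have := H _ h1.1 _ h0.1 (by linarith) (by linarith)
  linarith

/-- If a sequence converges to `v₀` up to elements of the closed subspace `N`, then the
differences to the metric projections converge. -/
theorem tendsto_sub_metricProj (hX : PowUniformConvex X r) (hr : 0 < r) {N : Submodule ℝ X}
    (hN : IsClosed (N : Set X)) {v k : ℕ → X} {v₀ : X} (hk : ∀ j, k j ∈ N)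
    (hv : Tendsto (fun j => v j - v₀ - k j) atTop (𝓝 0)) :
    Tendsto (fun j => v j - metricProj (N : Set X) (v j)) atTop
      (𝓝 (v₀ - metricProj (N : Set X) v₀)) := by
  have h1 : Tendsto (fun j => v j - k j) atTop (𝓝 v₀) := by
    have := hv.add_const v₀
    rw [zero_add] at this
    exact this.congr fun j => by abel
  refine (h1.sub (tendsto_metricProj hX hr hN h1)).congr fun j => ?_
  have := metricProj_add hX hr hN (v j - k j) (hk j)
  rw [sub_add_cancel] at this
  rw [this]; abel

end MetricProjection

/-! ### Convolution of L¹ kernels with L^p functions as a Bochner integral of translates -/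

section Convolution

variable {n : ℕ} {p : ℝ≥0∞} [Fact (1 ≤ p)]

/-- Allows `conv 1`, so that the same operation also convolves kernels with each other. -/
instance fact_one_ne_top : Fact ((1 : ℝ≥0∞) ≠ ⊤) := ⟨ENNReal.one_ne_top⟩

/-- The Lebesgue space on the whole space. -/
abbrev LpFull (n : ℕ) (p : ℝ≥0∞) : Type := Lp ℝ p (volume : Measure (Rn n))

/-- Translation by `y` on `L^p(ℝⁿ)`. -/
def translate (p : ℝ≥0∞) [Fact (1 ≤ p)] (y : Rn n) : LpFull n p →ₗᵢ[ℝ] LpFull n p :=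
  Lp.compMeasurePreservingₗᵢ ℝ (fun x => x - y) (measurePreserving_sub_right volume y)

lemma coeFn_translate (y : Rn n) (f : LpFull n p) :
    translate p y f =ᵐ[volume] fun x => f (x - y) :=
  Lp.coeFn_compMeasurePreserving f (measurePreserving_sub_right volume y)

lemma translate_translate (y z : Rn n) (f : LpFull n p) :
    translate p y (translate p z f) = translate p (y + z) f := by
  refine Lp.ext ?_
  have h := (measurePreserving_sub_right volume y).quasiMeasurePreserving.ae_eq_comp
    (coeFn_translate z f)
  refine (coeFn_translate y _).trans (h.trans ?_)
  refine EventuallyEq.trans (Eventually.of_forall fun x => ?_) (coeFn_translate (y + z) f).symm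
  simp [sub_sub]

lemma continuous_translate [hp : Fact (p ≠ ⊤)] (f : LpFull n p) :
    Continuous fun y : Rn n => translate p y f := by
  let g : Rn n → C(Rn n, Rn n) := fun y => ⟨fun x => x - y, by fun_prop⟩
  have hg : Continuous g := ContinuousMap.continuous_of_continuous_uncurry _ (by
    change Continuous fun q : Rn n × Rn n => q.2 - q.1
    fun_prop)
  exact (continuous_const (y := f)).compMeasurePreservingLp hg
    (fun y => measurePreserving_sub_right volume y) hp.out

lemma integrable_smul_translate [Fact (p ≠ ⊤)] (k : LpFull n 1) (f : LpFull n p) :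
    Integrable fun y => k y • translate p y f := by
  refine ((L1.integrable_coeFn k).norm.mul_const ‖f‖).mono'
    ((Lp.aestronglyMeasurable k).smul (continuous_translate f).aestronglyMeasurable)
    (Eventually.of_forall fun y => ?_)
  rw [norm_smul, LinearIsometry.norm_map]

/-- Convolution of an `L¹` kernel with an `L^p` function. -/
def conv (p : ℝ≥0∞) [Fact (1 ≤ p)] [Fact (p ≠ ⊤)] :
    LpFull n 1 →L[ℝ] LpFull n p →L[ℝ] LpFull n p :=
  LinearMap.mkContinuous₂ (LinearMap.mk₂ ℝ (fun k f => ∫ y, k y • translate p y f)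
    (fun k k' f => by
      rw [← integral_add (integrable_smul_translate k f) (integrable_smul_translate k' f)]
      refine integral_congr_ae ?_
      filter_upwards [Lp.coeFn_add k k'] with y hy
      rw [hy, Pi.add_apply, add_smul])
    (fun c k f => by
      rw [← integral_smul]
      refine integral_congr_ae ?_
      filter_upwards [Lp.coeFn_smul c k] with y hy
      rw [hy, Pi.smul_apply, smul_assoc])
    (fun k f f' => by
      rw [← integral_add (integrable_smul_translate k f) (integrable_smul_translate k f')]
      simp only [map_add, smul_add])
    (fun c k f => by
      rw [← integral_smul]
      simp only [map_smul, smul_comm c]))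
    1 (fun k f => by
      rw [one_mul, L1.norm_eq_integral_norm, ← integral_mul_const]
      refine norm_integral_le_of_norm_le ((L1.integrable_coeFn k).norm.mul_const ‖f‖)
        (Eventually.of_forall fun y => ?_)
      rw [norm_smul, LinearIsometry.norm_map])

variable [Fact (p ≠ ⊤)]

lemma conv_apply (k : LpFull n 1) (f : LpFull n p) :
    conv p k f = ∫ y, k y • translate p y f := rfl

lemma norm_conv_apply_le (k : LpFull n 1) (f : LpFull n p) : ‖conv p k f‖ ≤ ‖k‖ * ‖f‖ := by
  have h := (conv p k).le_opNorm f
  have h2 : ‖conv (n := n) p‖ ≤ 1 := LinearMap.mkContinuous₂_norm_le _ zero_le_one _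
  have h3 := (conv p).le_opNorm k
  calc _ ≤ ‖conv p k‖ * ‖f‖ := h
    _ ≤ (1 * ‖k‖) * ‖f‖ := by gcongr; exact h3.trans (by gcongr)
    _ = _ := by rw [one_mul]

lemma translate_conv (z : Rn n) (k : LpFull n 1) (f : LpFull n p) :
    translate p z (conv p k f) = conv p k (translate p z f) := by
  rw [conv_apply, conv_apply]
  have := (translate p z).toContinuousLinearMap.integral_comp_comm (integrable_smul_translate k f)
  refine this.symm.trans (integral_congr_ae (Eventually.of_forall fun y => ?_))
  simp only [LinearIsometry.coe_toContinuousLinearMap, map_smul, translate_translate, add_comm z]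

/-- Convolution with `k'` is bounded and commutes with translations, so it passes under the integral
that defines convolution with `k`. -/
lemma conv_comm (k k' : LpFull n 1) (f : LpFull n p) :
    conv p k (conv p k' f) = conv p k' (conv p k f) := by
  rw [conv_apply k, conv_apply k f]
  rw [← (conv p k').integral_comp_comm (integrable_smul_translate k f)]
  simp only [map_smul, translate_conv]

lemma conv_translate (z : Rn n) (k : LpFull n 1) (f : LpFull n p) :
    conv p (translate 1 z k) f = translate p z (conv p k f) := by
  rw [translate_conv, conv_apply, conv_apply]
  have h : ∫ y, translate 1 z k y • translate p y f = ∫ y, k (y - z) • translate p y f :=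
    integral_congr_ae (by filter_upwards [coeFn_translate z k] with y hy; rw [hy])
  rw [h, ← integral_sub_right_eq_self (fun y => k y • translate p y (translate p z f)) z]
  simp [translate_translate]

/-- For fixed `f` the map `k ↦ conv p k f` is bounded and turns translations of the kernel into
translations of the result. It is applied under the integral that defines `conv 1 k k'`. -/
lemma conv_conv (k k' : LpFull n 1) (f : LpFull n p) :
    conv p (conv 1 k k') f = conv p k (conv p k' f) := by
  have := ((conv p).flip f).integral_comp_comm (integrable_smul_translate k k')
  rw [conv_apply k k', conv_apply k (conv p k' f)]
  refine this.symm.trans (integral_congr_ae (Eventually.of_forall fun y => ?_))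
  simp only [map_smul, ContinuousLinearMap.flip_apply, conv_translate]

/-- Functions which belong to every Lebesgue space. -/
def AllMemLp (h : Rn n → ℝ) : Prop := ∀ q : ℝ≥0∞, MemLp h q volume

lemma allMemLp_of_continuous {h : Rn n → ℝ} (h1 : Continuous h) (h2 : HasCompactSupport h) :
    AllMemLp h := fun _ => h1.memLp_of_hasCompactSupport h2

lemma AllMemLp.abs {h : Rn n → ℝ} (hh : AllMemLp h) : AllMemLp fun x => |h x| :=
  fun q => (hh q).norm

omit [Fact (p ≠ ⊤)] in
lemma AllMemLp.integrable_mul {h : Rn n → ℝ} (hh : AllMemLp h) (f : LpFull n p) :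
    Integrable fun x => f x * h x :=
  MemLp.integrable_mul (q := ENNReal.conjExponent p) (Lp.memLp f) (hh _)

instance fact_one_le_conjExponent (p : ℝ≥0∞) [Fact (1 ≤ p)] : Fact (1 ≤ ENNReal.conjExponent p) :=
  ⟨ENNReal.HolderConjugate.one_le (ENNReal.conjExponent p) p⟩

/-- The functional `f ↦ ∫ f h` on `L^p`. -/
def pairing (p : ℝ≥0∞) [Fact (1 ≤ p)] {h : Rn n → ℝ} (hh : AllMemLp h) : LpFull n p →L[ℝ] ℝ :=
  ((ContinuousLinearMap.mul ℝ ℝ).lpPairing volume p (ENNReal.conjExponent p)).flip (hh _).toLp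

omit [Fact (p ≠ ⊤)] in
lemma pairing_apply {h : Rn n → ℝ} (hh : AllMemLp h) (f : LpFull n p) :
    pairing p hh f = ∫ x, f x * h x := by
  unfold pairing
  rw [ContinuousLinearMap.flip_apply, ContinuousLinearMap.lpPairing_eq_integral]
  refine integral_congr_ae ?_
  filter_upwards [(hh (ENNReal.conjExponent p)).coeFn_toLp] with x hx
  rw [hx]; rfl

omit [Fact (p ≠ ⊤)] in
lemma integral_translate_mul {h : Rn n → ℝ} (y : Rn n) (f : LpFull n p) :
    ∫ x, translate p y f x * h x = ∫ x, f (x - y) * h x :=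
  integral_congr_ae (by filter_upwards [coeFn_translate y f] with x hx; rw [hx])

lemma integral_conv_mul {h : Rn n → ℝ} (hh : AllMemLp h) (k : LpFull n 1) (f : LpFull n p) :
    ∫ x, conv p k f x * h x = ∫ y, k y * ∫ x, f (x - y) * h x := by
  rw [← pairing_apply hh, conv_apply,
    ← (pairing p hh).integral_comp_comm (integrable_smul_translate k f)]
  refine integral_congr_ae (Eventually.of_forall fun y => ?_)
  simp only [map_smul, smul_eq_mul]
  rw [pairing_apply hh, integral_translate_mul]

omit [Fact (p ≠ ⊤)] in
-- Justifies Fubini. Translations are isometries of L^p, so the inner integral is bounded uniformly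
-- in the translation and the integrability of `k` suffices.
lemma integrable_conv_integrand {h : Rn n → ℝ} (hh : AllMemLp h) (k : LpFull n 1)
    (f : LpFull n p) :
    Integrable (fun q : Rn n × Rn n => k q.1 * (f (q.2 - q.1) * h q.2))
      (volume.prod volume) := by
  have hf : AEStronglyMeasurable (fun q : Rn n × Rn n => f (q.2 - q.1))
      (volume.prod volume) := by
    refine (Lp.aestronglyMeasurable f).comp_quasiMeasurePreserving
      (f := fun q : Rn n × Rn n => q.2 - q.1) ?_
    exact (Measure.quasiMeasurePreserving_snd).comp
      (measurePreserving_prod_sub volume volume).quasiMeasurePreserving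
  have hm : AEStronglyMeasurable (fun q : Rn n × Rn n => k q.1 * (f (q.2 - q.1) * h q.2))
      (volume.prod volume) :=
    ((Lp.aestronglyMeasurable k).comp_quasiMeasurePreserving
      Measure.quasiMeasurePreserving_fst).mul
      (hf.mul ((hh 1).1.comp_quasiMeasurePreserving Measure.quasiMeasurePreserving_snd))
  have hi : ∀ y, Integrable fun x => f (x - y) * h x := fun y =>
    (hh.integrable_mul (translate p y f)).congr
      (by filter_upwards [coeFn_translate y f] with x hx; rw [hx])
  refine (integrable_prod_iff hm).2 ⟨Eventually.of_forall fun y => (hi y).const_mul (k y), ?_⟩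
  refine ((L1.integrable_coeFn k).norm.mul_const (‖pairing p hh.abs‖ * ‖f‖)).mono'
    hm.norm.integral_prod_right' (Eventually.of_forall fun y => ?_)
  have e : ∀ x, ‖k y * (f (x - y) * h x)‖ = ‖k y‖ * (|f (x - y)| * |h x|) := fun x => by
    rw [norm_mul, norm_mul]; rfl
  simp only [e]
  rw [integral_const_mul, norm_mul, norm_norm]
  refine mul_le_mul_of_nonneg_left ?_ (norm_nonneg _)
  have e2 : ∫ x, |f (x - y)| * |h x| = pairing p hh.abs |translate p y f| := by
    rw [pairing_apply]
    refine integral_congr_ae ?_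
    filter_upwards [coeFn_translate y f, Lp.coeFn_abs (translate p y f)] with x h1 h2
    rw [h2, h1]
  rw [e2]
  refine ((pairing p hh.abs).le_opNorm _).trans_eq ?_
  rw [norm_abs_eq_norm, LinearIsometry.norm_map]

lemma allMemLp_indicator {s : Set (Rn n)} (hs : MeasurableSet s) (hμ : volume s ≠ ⊤) :
    AllMemLp (s.indicator fun _ => (1 : ℝ)) := fun q =>
  memLp_indicator_const q hs 1 (Or.inr hμ)

/-- The pointwise formula for the convolution. -/
lemma conv_ae_eq (k : LpFull n 1) (f : LpFull n p) :
    conv p k f =ᵐ[volume] fun x => ∫ y, k y * f (x - y) := by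
  have hint : ∀ s, MeasurableSet s → volume s < ⊤ →
      Integrable (fun q : Rn n × Rn n => s.indicator (fun _ => (1 : ℝ)) q.1 *
        (k q.2 * f (q.1 - q.2))) (volume.prod volume) := fun s hs hμ => by
    refine (integrable_conv_integrand (allMemLp_indicator hs hμ.ne) k f).swap.congr
      (Eventually.of_forall fun q => ?_)
    simp only [Function.comp_apply, Prod.fst_swap, Prod.snd_swap]
    ring
  have hind : ∀ (s : Set (Rn n)) (g : Rn n → ℝ),
      (fun x => s.indicator (fun _ => (1 : ℝ)) x * g x) = s.indicator g := fun s g => by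
    funext x; by_cases hx : x ∈ s <;> simp [hx]
  -- The two sides are compared through their integrals over sets of finite measure, whose
  -- indicators are admissible in `integral_conv_mul`.
  refine ae_eq_of_forall_setIntegral_eq_of_sigmaFinite (fun s hs hμ => ?_)
    (fun s hs hμ => ?_) fun s hs hμ => ?_
  · exact integrableOn_Lp_of_measure_ne_top _ (Fact.out : 1 ≤ p) hμ.ne
  · have h := (hint s hs hμ).integral_prod_left
    simp only [integral_const_mul] at h
    rw [hind] at h
    exact (integrable_indicator_iff hs).1 h
  · have hh := allMemLp_indicator hs hμ.ne
    rw [← integral_indicator hs, ← integral_indicator hs, ← hind s (conv p k f),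
      ← hind s (fun x => ∫ y, k y * f (x - y))]
    have e : ∫ x, s.indicator (fun _ => (1 : ℝ)) x * conv p k f x =
        ∫ x, conv p k f x * s.indicator (fun _ => (1 : ℝ)) x := by simp only [mul_comm]
    rw [e, integral_conv_mul hh]
    simp only [← integral_const_mul]
    rw [integral_integral_swap (integrable_conv_integrand hh k f)]
    refine integral_congr_ae (Eventually.of_forall fun x => ?_)
    refine integral_congr_ae (Eventually.of_forall fun y => ?_)
    ring

/-- The adjoint of the convolution. -/
lemma integral_conv_mul_eq {h : Rn n → ℝ} (hh : AllMemLp h) (k : LpFull n 1) (f : LpFull n p) :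
    ∫ x, conv p k f x * h x = ∫ x, f x * ∫ y, k y * h (x + y) := by
  rw [integral_conv_mul hh]
  have e : ∀ y, ∫ x, f (x - y) * h x = ∫ x, f x * h (x + y) := fun y => by
    rw [← integral_add_right_eq_self _ y]; simp
  simp only [e, ← integral_const_mul]
  have hsh : MeasurePreserving (fun q : Rn n × Rn n => (q.1, q.2 + q.1))
      (volume.prod volume) (volume.prod volume) := by
    have := measurePreserving_prod_add_right (volume : Measure (Rn n)) (volume : Measure (Rn n))
    exact this
  have hi := hsh.integrable_comp_of_integrable (integrable_conv_integrand hh k f)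
  rw [integral_integral_swap (hi.congr (Eventually.of_forall fun q => by
    simp only [Function.comp_apply, add_sub_cancel_right]; rfl))]
  refine integral_congr_ae (Eventually.of_forall fun x => ?_)
  refine integral_congr_ae (Eventually.of_forall fun y => ?_)
  ring

end Convolution

/-! ### Test functions and their derivatives -/

section TestFunctions

variable {n : ℕ}

/-- The `i`-th partial derivative. -/
def pd (i : Fin n) (f : Rn n → ℝ) (x : Rn n) : ℝ := fderiv ℝ f x (EuclideanSpace.single i 1)

/-- The Laplacian. -/
def lap (f : Rn n → ℝ) (x : Rn n) : ℝ := ∑ i, pd i (pd i f) x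

/-- Smooth functions with compact support. -/
structure IsTest (φ : Rn n → ℝ) : Prop where
  smooth : ContDiff ℝ ∞ φ
  compact : HasCompactSupport φ

lemma contDiff_pd {f : Rn n → ℝ} (hf : ContDiff ℝ ∞ f) (i : Fin n) : ContDiff ℝ ∞ (pd i f) :=
  (hf.fderiv_right (m := ∞) (by simp)).clm_apply contDiff_const

lemma IsTest.differentiable {φ : Rn n → ℝ} (h : IsTest φ) : Differentiable ℝ φ :=
  h.smooth.differentiable (by simp)

lemma IsTest.continuous {φ : Rn n → ℝ} (h : IsTest φ) : Continuous φ := h.smooth.continuous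

lemma IsTest.allMemLp {φ : Rn n → ℝ} (h : IsTest φ) : AllMemLp φ :=
  allMemLp_of_continuous h.continuous h.compact

lemma IsTest.integrable {φ : Rn n → ℝ} (h : IsTest φ) : Integrable φ :=
  h.continuous.integrable_of_hasCompactSupport h.compact

lemma tsupport_pd_subset (f : Rn n → ℝ) (i : Fin n) : tsupport (pd i f) ⊆ tsupport f :=
  tsupport_fderiv_apply_subset ℝ _

lemma IsTest.pd {φ : Rn n → ℝ} (h : IsTest φ) (i : Fin n) : IsTest (pd i φ) :=
  ⟨contDiff_pd h.smooth i, h.compact.fderiv_apply ℝ _⟩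

lemma IsTest.add {φ ψ : Rn n → ℝ} (h : IsTest φ) (h' : IsTest ψ) : IsTest (fun x => φ x + ψ x) :=
  ⟨h.smooth.add h'.smooth, h.compact.add h'.compact⟩

lemma IsTest.neg {φ : Rn n → ℝ} (h : IsTest φ) : IsTest (fun x => -φ x) :=
  ⟨h.smooth.neg, h.compact.comp_left (g := fun y => -y) neg_zero⟩

lemma IsTest.sub {φ ψ : Rn n → ℝ} (h : IsTest φ) (h' : IsTest ψ) : IsTest (fun x => φ x - ψ x) := by
  simpa [sub_eq_add_neg] using h.add h'.neg

lemma IsTest.mul_left {χ φ : Rn n → ℝ} (hχ : ContDiff ℝ ∞ χ) (h : IsTest φ) :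
    IsTest (fun x => χ x * φ x) :=
  ⟨hχ.mul h.smooth, h.compact.mul_left⟩

lemma IsTest.zero : IsTest (fun _ : Rn n => (0 : ℝ)) :=
  ⟨contDiff_const, HasCompactSupport.zero⟩

lemma IsTest.sum {ι : Type*} (s : Finset ι) {φ : ι → Rn n → ℝ} (h : ∀ i, IsTest (φ i)) :
    IsTest (fun x => ∑ i ∈ s, φ i x) := by
  classical
  induction s using Finset.induction_on with
  | empty => simpa using IsTest.zero
  | insert a s ha ih => simpa [Finset.sum_insert ha] using (h a).add ih

lemma IsTest.lap {φ : Rn n → ℝ} (h : IsTest φ) : IsTest (lap φ) :=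
  IsTest.sum _ fun i => (h.pd i).pd i

lemma IsTest.comp_sub_left {φ : Rn n → ℝ} (h : IsTest φ) (x : Rn n) :
    IsTest (fun y => φ (x - y)) :=
  ⟨h.smooth.comp (contDiff_const.sub contDiff_id),
    h.compact.comp_homeomorph (Homeomorph.subLeft x)⟩

lemma IsTest.comp_add_right {φ : Rn n → ℝ} (h : IsTest φ) (y : Rn n) :
    IsTest (fun x => φ (x + y)) :=
  ⟨h.smooth.comp (contDiff_id.add contDiff_const),
    h.compact.comp_homeomorph (Homeomorph.addRight y)⟩

lemma pd_comp_sub_left {f : Rn n → ℝ} (hf : Differentiable ℝ f) (i : Fin n) (x y : Rn n) :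
    pd i (fun y => f (x - y)) y = -pd i f (x - y) := by
  have h : HasFDerivAt (fun y => f (x - y))
      ((fderiv ℝ f (x - y)).comp (-ContinuousLinearMap.id ℝ (Rn n))) y :=
    (hf (x - y)).hasFDerivAt.comp y ((hasFDerivAt_id y).const_sub x)
  simp [pd, h.fderiv]

lemma lap_comp_sub_left {φ : Rn n → ℝ} (h : IsTest φ) (x y : Rn n) :
    lap (fun y => φ (x - y)) y = lap φ (x - y) := by
  unfold lap
  refine Finset.sum_congr rfl fun i _ => ?_
  have e : pd i (fun y => φ (x - y)) = fun y => -pd i φ (x - y) :=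
    funext fun y => pd_comp_sub_left h.differentiable i x y
  rw [e]
  have e2 : pd i (fun y => -pd i φ (x - y)) y = -pd i (fun y => pd i φ (x - y)) y := by
    unfold FiniteHorizon.pd
    rw [fderiv_fun_neg]; rfl
  rw [e2, pd_comp_sub_left (h.pd i).differentiable, neg_neg]

/-- Integration by parts against a test function. -/
lemma integral_mul_pd {f φ : Rn n → ℝ} (hf : ContDiff ℝ 1 f) (hφ : IsTest φ) (i : Fin n) :
    ∫ x, f x * pd i φ x = -∫ x, pd i f x * φ x := by
  have hc : Continuous fun x => fderiv ℝ f x (EuclideanSpace.single i 1) :=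
    (hf.continuous_fderiv one_ne_zero).clm_apply continuous_const
  refine integral_mul_fderiv_eq_neg_fderiv_mul_of_integrable ?_ ?_ ?_
    (fun x _ => hf.differentiable one_ne_zero x) fun x _ => hφ.differentiable x
  · exact (hc.mul hφ.continuous).integrable_of_hasCompactSupport hφ.compact.mul_left
  · exact (hf.continuous.mul (hφ.pd i).continuous).integrable_of_hasCompactSupport
      (hφ.pd i).compact.mul_left
  · exact (hf.continuous.mul hφ.continuous).integrable_of_hasCompactSupport hφ.compact.mul_left

lemma IsTest.exists_bound {φ : Rn n → ℝ} (h : IsTest φ) : ∃ M, 0 ≤ M ∧ ∀ x, |φ x| ≤ M := by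
  obtain ⟨M, hM⟩ := h.compact.exists_bound_of_continuous h.continuous
  exact ⟨M, (norm_nonneg _).trans (hM 0), hM⟩

end TestFunctions

/-! ### Integrable functions as elements of L¹ -/

section IntegrableToLp

variable {n : ℕ}

open Classical in
/-- The class in `L¹` of an integrable function (and `0` for other functions). -/
def toLOne (f : Rn n → ℝ) : LpFull n 1 := if h : Integrable f then h.toL1 f else 0

lemma coeFn_toLOne {f : Rn n → ℝ} (hf : Integrable f) : toLOne f =ᵐ[volume] f := by
  unfold toLOne
  rw [dif_pos hf]
  exact hf.coeFn_toL1

lemma norm_toLOne {f : Rn n → ℝ} (hf : Integrable f) : ‖toLOne f‖ = ∫ x, |f x| := by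
  rw [L1.norm_eq_integral_norm]
  exact integral_congr_ae (by filter_upwards [coeFn_toLOne hf] with x hx; rw [hx]; rfl)

lemma toLOne_sub {f g : Rn n → ℝ} (hf : Integrable f) (hg : Integrable g) :
    toLOne (fun x => f x - g x) = toLOne f - toLOne g := by
  refine Lp.ext ?_
  filter_upwards [coeFn_toLOne hf, coeFn_toLOne hg, coeFn_toLOne (hf.sub hg),
    Lp.coeFn_sub (toLOne f) (toLOne g)] with x h1 h2 h3 h4
  rw [h4, Pi.sub_apply, h1, h2, ← Pi.sub_apply, ← h3]; rfl

lemma integral_toLOne_mul {f h : Rn n → ℝ} (hf : Integrable f) :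
    ∫ x, toLOne f x * h x = ∫ x, f x * h x :=
  integral_congr_ae (by filter_upwards [coeFn_toLOne hf] with x hx; rw [hx])

lemma conv_toLOne_ae_eq (k : LpFull n 1) {ψ : Rn n → ℝ} (hψ : Integrable ψ) :
    conv 1 k (toLOne ψ) =ᵐ[volume] fun x => ∫ y, k y * ψ (x - y) := by
  refine (conv_ae_eq k (toLOne ψ)).trans (Eventually.of_forall fun x => ?_)
  refine integral_congr_ae ?_
  have h := (Measure.measurePreserving_sub_left volume x).quasiMeasurePreserving.ae_eq_comp
    (coeFn_toLOne hψ)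
  filter_upwards [h] with y hy
  simp only [Function.comp_apply] at hy
  rw [hy]

/-- Dominated convergence applied to ∫ |k_r - k_t|. Continuity in L¹ gives the measurability needed
for Bochner integrals over time. -/
lemma continuousOn_toLOne {k : ℝ → Rn n → ℝ} {s : Set ℝ} (hs : IsOpen s)
    (hk : ∀ t ∈ s, ∃ b : Rn n → ℝ, Integrable b ∧ ∀ᶠ r in 𝓝 t, ∀ x, ‖k r x‖ ≤ b x)
    (hc : ∀ x, ContinuousOn (fun t => k t x) s) (hm : ∀ t ∈ s, AEStronglyMeasurable (k t)) :
    ContinuousOn (fun t => toLOne (k t)) s := by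
  have hi : ∀ t ∈ s, Integrable (k t) := fun t ht => by
    obtain ⟨b, hb, h⟩ := hk t ht
    exact hb.mono' (hm t ht) (Eventually.of_forall h.self_of_nhds)
  intro t ht
  refine ContinuousAt.continuousWithinAt ?_
  obtain ⟨b, hb, h⟩ := hk t ht
  refine tendsto_iff_norm_sub_tendsto_zero.2 ?_
  have h0 : Tendsto (fun r => ∫ x, |k r x - k t x|) (𝓝 t) (𝓝 (∫ x : Rn n, (0 : ℝ))) := by
    refine tendsto_integral_filter_of_dominated_convergence (fun x => b x + ‖k t x‖) ?_ ?_
      (hb.add (hi t ht).norm) (Eventually.of_forall fun x => ?_)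
    · filter_upwards [hs.mem_nhds ht] with r hr
      exact ((hm r hr).sub (hm t ht)).norm
    · filter_upwards [h] with r hr
      refine Eventually.of_forall fun x => ?_
      rw [norm_abs_eq_norm]
      exact (norm_sub_le _ _).trans (by gcongr; exact hr x)
    · have := ((hc x).continuousAt (hs.mem_nhds ht)).sub (continuousAt_const (y := k t x))
      have h2 : Tendsto (fun r => |k r x - k t x|) (𝓝 t) (𝓝 |k t x - k t x|) := this.abs
      rwa [sub_self, abs_zero] at h2
  rw [integral_zero] at h0
  refine h0.congr' ?_
  filter_upwards [hs.mem_nhds ht] with r hr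
  rw [← toLOne_sub (hi r hr) (hi t ht)]
  exact (norm_toLOne ((hi r hr).sub (hi t ht))).symm

end IntegrableToLp

/-! ### The heat kernel and its derivatives -/

section Gaussian

variable {n : ℕ}

/-- The heat kernel. -/
def gauss (n : ℕ) (t : ℝ) (x : Rn n) : ℝ :=
  (4 * Real.pi * t) ^ (-(n / 2 : ℝ)) * Real.exp (-(‖x‖ ^ 2 / (4 * t)))

/-- The `i`-th derivative of the heat kernel. -/
def gaussDeriv (i : Fin n) (t : ℝ) (x : Rn n) : ℝ := -(x i / (2 * t)) * gauss n t x

/-- The time derivative, and the Laplacian, of the heat kernel. -/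
def gaussLap (n : ℕ) (t : ℝ) (x : Rn n) : ℝ :=
  (‖x‖ ^ 2 / (4 * t ^ 2) - n / (2 * t)) * gauss n t x

lemma gauss_pos {t : ℝ} (ht : 0 < t) (x : Rn n) : 0 < gauss n t x := by
  unfold gauss; positivity

lemma integrable_exp_norm_sq {b : ℝ} (hb : 0 < b) :
    Integrable fun x : Rn n => Real.exp (-b * ‖x‖ ^ 2) := by
  have := (GaussianFourier.integrable_cexp_neg_mul_sq_norm_add (V := Rn n) (b := b)
    (by simpa using hb) 0 0).re
  refine this.congr (Eventually.of_forall fun x => ?_)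
  have e : -(b : ℂ) * ‖x‖ ^ 2 + 0 * (inner ℝ (0 : Rn n) x : ℝ) =
      ((-b * ‖x‖ ^ 2 : ℝ) : ℂ) := by push_cast; ring
  simp only [e]
  rw [← Complex.ofReal_exp]
  rfl

lemma gauss_eq (t : ℝ) (x : Rn n) : gauss n t x =
    (4 * Real.pi * t) ^ (-(n / 2 : ℝ)) * Real.exp (-(1 / (4 * t)) * ‖x‖ ^ 2) := by
  unfold gauss; congr 2; ring

lemma integrable_gauss {t : ℝ} (ht : 0 < t) : Integrable (gauss n t) := by
  have h := (integrable_exp_norm_sq (n := n) (b := 1 / (4 * t)) (by positivity)).const_mul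
    ((4 * Real.pi * t) ^ (-(n / 2 : ℝ)))
  exact h.congr (Eventually.of_forall fun x => (gauss_eq t x).symm)

lemma integral_gauss {t : ℝ} (ht : 0 < t) : ∫ x, gauss n t x = 1 := by
  simp only [gauss_eq]
  rw [integral_const_mul, GaussianFourier.integral_rexp_neg_mul_sq_norm (by positivity),
    finrank_euclideanSpace_fin, Real.rpow_neg (by positivity)]
  rw [show Real.pi / (1 / (4 * t)) = 4 * Real.pi * t by field_simp]
  exact inv_mul_cancel₀ (by positivity)

/-- Half of the exponent is set aside to absorb polynomial factors in |x|/√t; the price is the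
doubled time in all later bounds. -/
lemma gauss_two_mul {t : ℝ} (ht : 0 < t) (x : Rn n) :
    gauss n t x = 2 ^ (n / 2 : ℝ) * gauss n (2 * t) x * Real.exp (-(‖x‖ ^ 2 / (8 * t))) := by
  unfold gauss
  have h1 : (4 * Real.pi * (2 * t)) ^ (-(n / 2 : ℝ)) =
      2 ^ (-(n / 2 : ℝ)) * (4 * Real.pi * t) ^ (-(n / 2 : ℝ)) := by
    rw [← Real.mul_rpow (by norm_num) (by positivity)]; congr 1; ring
  have h2 : (2 : ℝ) ^ (n / 2 : ℝ) * 2 ^ (-(n / 2 : ℝ)) = 1 := by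
    rw [← Real.rpow_add (by norm_num)]; simp
  have h3 : Real.exp (-(‖x‖ ^ 2 / (4 * t))) =
      Real.exp (-(‖x‖ ^ 2 / (4 * (2 * t)))) * Real.exp (-(‖x‖ ^ 2 / (8 * t))) := by
    rw [← Real.exp_add]; congr 1; field_simp; ring
  rw [h1, h3]
  linear_combination (-(4 * Real.pi * t) ^ (-(n / 2 : ℝ)) *
    Real.exp (-(‖x‖ ^ 2 / (4 * (2 * t)))) * Real.exp (-(‖x‖ ^ 2 / (8 * t)))) * h2

lemma norm_mul_gauss_le {t : ℝ} (ht : 0 < t) (x : Rn n) :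
    ‖x‖ * gauss n t x ≤ 2 * √t * 2 ^ (n / 2 : ℝ) * gauss n (2 * t) x := by
  rw [gauss_two_mul ht]
  have hs : 0 < √t := Real.sqrt_pos.2 ht
  have hs2 : √t ^ 2 = t := Real.sq_sqrt ht.le
  -- In the parabolic variable the bound reduces to w exp(-w²/8) ≤ 2.
  set w := ‖x‖ / √t with hw
  have hx : ‖x‖ = w * √t := by rw [hw]; field_simp
  have h1 : ‖x‖ ^ 2 / (8 * t) = w ^ 2 / 8 := by rw [hx, mul_pow, hs2]; field_simp
  have h2 : w / 2 ≤ Real.exp (w ^ 2 / 8) := by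
    nlinarith [Real.add_one_le_exp (w ^ 2 / 8), sq_nonneg (w / 4 - 1), sq_nonneg w]
  have h3 : w * Real.exp (-(w ^ 2 / 8)) ≤ 2 := by
    rw [Real.exp_neg, ← div_eq_mul_inv, div_le_iff₀ (Real.exp_pos _)]; linarith
  rw [h1, hx]
  have hg := (gauss_pos (by positivity : 0 < 2 * t) x).le
  calc w * √t * (2 ^ (n / 2 : ℝ) * gauss n (2 * t) x * Real.exp (-(w ^ 2 / 8)))
      = (w * Real.exp (-(w ^ 2 / 8))) * (√t * 2 ^ (n / 2 : ℝ) * gauss n (2 * t) x) := by ring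
    _ ≤ 2 * (√t * 2 ^ (n / 2 : ℝ) * gauss n (2 * t) x) := by gcongr
    _ = _ := by ring

lemma gauss_le_two_mul {t : ℝ} (ht : 0 < t) (x : Rn n) :
    gauss n t x ≤ 2 ^ (n / 2 : ℝ) * gauss n (2 * t) x := by
  rw [gauss_two_mul ht]
  have hg := (gauss_pos (by positivity : 0 < 2 * t) x).le
  refine mul_le_of_le_one_right (by positivity) (Real.exp_le_one_iff.2 ?_)
  have : 0 ≤ ‖x‖ ^ 2 / (8 * t) := by positivity
  linarith

lemma abs_gaussDeriv_le {t : ℝ} (ht : 0 < t) (i : Fin n) (x : Rn n) :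
    |gaussDeriv i t x| ≤ 2 ^ (n / 2 : ℝ) * t ^ (-(1 / 2) : ℝ) * gauss n (2 * t) x := by
  have h := norm_mul_gauss_le ht x
  have hxi : |x i| ≤ ‖x‖ := by
    have := EuclideanSpace.norm_sq_eq x
    rw [← Real.norm_eq_abs]
    exact PiLp.norm_apply_le x i
  have hg := (gauss_pos ht x).le
  have hs : 0 < √t := Real.sqrt_pos.2 ht
  have e : t ^ (-(1 / 2) : ℝ) = √t / t := by
    rw [Real.rpow_neg ht.le, ← Real.sqrt_eq_rpow, eq_div_iff ht.ne', inv_mul_eq_div,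
      div_eq_iff hs.ne', Real.mul_self_sqrt ht.le]
  unfold gaussDeriv
  rw [abs_mul, abs_neg, abs_div, abs_of_pos (by positivity : 0 < 2 * t), abs_of_nonneg hg, e]
  calc |x i| / (2 * t) * gauss n t x ≤ ‖x‖ / (2 * t) * gauss n t x := by gcongr
    _ = (‖x‖ * gauss n t x) / (2 * t) := by ring
    _ ≤ (2 * √t * 2 ^ (n / 2 : ℝ) * gauss n (2 * t) x) / (2 * t) := by gcongr
    _ = _ := by field_simp

lemma abs_gaussLap_le {t : ℝ} (ht : 0 < t) (x : Rn n) :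
    |gaussLap n t x| ≤ 2 ^ (n / 2 : ℝ) * (2 + n) / t * gauss n (2 * t) x := by
  have hg := (gauss_pos ht x).le
  have hg2 := (gauss_pos (by positivity : 0 < 2 * t) x).le
  unfold gaussLap
  rw [abs_mul, abs_of_nonneg hg]
  have h1 : |‖x‖ ^ 2 / (4 * t ^ 2) - n / (2 * t)| ≤ ‖x‖ ^ 2 / (4 * t ^ 2) + n / (2 * t) := by
    refine (abs_sub _ _).trans_eq ?_
    rw [abs_of_nonneg (by positivity), abs_of_nonneg (by positivity)]
  set e := Real.exp (-(‖x‖ ^ 2 / (8 * t))) with he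
  have he0 : 0 < e := Real.exp_pos _
  have h2 : (‖x‖ ^ 2 / (8 * t)) * e ≤ 1 := by
    rw [he, Real.exp_neg, ← div_eq_mul_inv, div_le_one (Real.exp_pos _)]
    linarith [Real.add_one_le_exp (‖x‖ ^ 2 / (8 * t))]
  have h3 : e ≤ 1 := Real.exp_le_one_iff.2 (by
    have : 0 ≤ ‖x‖ ^ 2 / (8 * t) := by positivity
    linarith)
  have h4 : (‖x‖ ^ 2 / (4 * t ^ 2) + n / (2 * t)) * e ≤ (2 + n) / t := by
    have : (‖x‖ ^ 2 / (4 * t ^ 2) + n / (2 * t)) * e =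
        (2 * ((‖x‖ ^ 2 / (8 * t)) * e) + n / 2 * e) / t := by field_simp; ring
    rw [this]
    have hn : (0 : ℝ) ≤ n := n.cast_nonneg
    have : (n / 2 : ℝ) * e ≤ n / 2 * 1 := by gcongr
    exact div_le_div_of_nonneg_right (by linarith) ht.le
  calc _ ≤ (‖x‖ ^ 2 / (4 * t ^ 2) + n / (2 * t)) * gauss n t x := by gcongr
    _ = (‖x‖ ^ 2 / (4 * t ^ 2) + n / (2 * t)) * e * (2 ^ (n / 2 : ℝ) * gauss n (2 * t) x) := by
      rw [gauss_two_mul ht]; ring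
    _ ≤ (2 + n) / t * (2 ^ (n / 2 : ℝ) * gauss n (2 * t) x) := by gcongr
    _ = _ := by ring

lemma contDiff_gauss (t : ℝ) : ContDiff ℝ ∞ (gauss n t) := by
  unfold gauss
  exact contDiff_const.mul ((((contDiff_id.norm_sq ℝ).div_const _).neg).exp)

lemma contDiff_gaussDeriv (i : Fin n) (t : ℝ) : ContDiff ℝ ∞ (gaussDeriv i t) := by
  unfold gaussDeriv
  refine ContDiff.mul ?_ (contDiff_gauss t)
  have : ContDiff ℝ ∞ fun x : Rn n => x i := by fun_prop
  exact (this.div_const _).neg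

lemma continuous_gaussLap (t : ℝ) : Continuous (gaussLap n t) := by
  unfold gaussLap
  have := (contDiff_gauss (n := n) t).continuous
  fun_prop

lemma pd_gauss {t : ℝ} (i : Fin n) (x : Rn n) : pd i (gauss n t) x = gaussDeriv i t x := by
  have h1 : HasFDerivAt (fun x : Rn n => -(‖x‖ ^ 2 / (4 * t)))
      (-((4 * t)⁻¹ • (2 • (innerSL ℝ x)))) x := by
    have := ((hasStrictFDerivAt_norm_sq x).hasFDerivAt.mul_const (4 * t)⁻¹).neg
    simp only [div_eq_mul_inv]
    exact this
  have h2 := h1.exp.const_mul ((4 * Real.pi * t) ^ (-(n / 2 : ℝ)))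
  unfold pd gaussDeriv
  have h3 : fderiv ℝ (gauss n t) x = _ := h2.fderiv
  rw [h3]
  simp [gauss, EuclideanSpace.inner_single_right]
  field_simp
  ring

lemma sum_pd_gaussDeriv {t : ℝ} (ht : 0 < t) (x : Rn n) :
    ∑ i, pd i (gaussDeriv i t) x = gaussLap n t x := by
  have h : ∀ i : Fin n, pd i (gaussDeriv i t) x =
      (x i ^ 2 / (4 * t ^ 2) - 1 / (2 * t)) * gauss n t x := fun i => by
    have h1 : HasFDerivAt (fun x : Rn n => -(x i / (2 * t)))
        (-((2 * t)⁻¹ • (EuclideanSpace.proj i : Rn n →L[ℝ] ℝ))) x := by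
      have := ((EuclideanSpace.proj i : Rn n →L[ℝ] ℝ).hasFDerivAt (x := x)).mul_const (2 * t)⁻¹
      simpa only [div_eq_mul_inv] using! this.neg
    have h2 : HasFDerivAt (gauss n t) (fderiv ℝ (gauss n t) x) x :=
      ((contDiff_gauss t).differentiable (by simp) x).hasFDerivAt
    have h3 : fderiv ℝ (gaussDeriv i t) x = _ := (h1.mul h2).fderiv
    have h4 := pd_gauss (t := t) i x
    unfold pd at h4 ⊢
    rw [h3]
    simp [h4, gaussDeriv]
    field_simp
    ring
  simp only [h]
  rw [← Finset.sum_mul, Finset.sum_sub_distrib, ← Finset.sum_div,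
    ← EuclideanSpace.real_norm_sq_eq]
  simp [gaussLap]
  left; ring

/-- Together with `pd_gauss` and `sum_pd_gaussDeriv` this is the heat equation: time derivative and
Laplacian are the same function `gaussLap`. -/
lemma hasDerivAt_gauss {t : ℝ} (ht : 0 < t) (x : Rn n) :
    HasDerivAt (fun t => gauss n t x) (gaussLap n t x) t := by
  have h1 : HasDerivAt (fun t : ℝ => (4 * Real.pi * t) ^ (-(n / 2 : ℝ)))
      (4 * Real.pi * 1 * (-(n / 2 : ℝ)) * (4 * Real.pi * t) ^ (-(n / 2 : ℝ) - 1)) t :=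
    ((hasDerivAt_id t).const_mul (4 * Real.pi)).rpow_const (Or.inl (by simp; positivity))
  have h2 : HasDerivAt (fun t : ℝ => -(‖x‖ ^ 2 / (4 * t))) (‖x‖ ^ 2 / (4 * t ^ 2)) t := by
    have := (((hasDerivAt_id t).const_mul 4).inv (by simp; positivity)).const_mul (‖x‖ ^ 2)
    have := this.neg
    refine (this.congr_deriv ?_).congr_of_eventuallyEq ?_
    · simp only [id]
      field_simp
    · exact Eventually.of_forall fun r => by simp [div_eq_mul_inv]
  refine (h1.mul h2.exp).congr_deriv ?_
  rw [Real.rpow_sub_one (by positivity)]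
  unfold gaussLap gauss
  field_simp
  ring

end Gaussian

/-! ### Superpositions of heat kernels in L¹ -/

section Subordination

variable {n : ℕ}

/-- Kernels depending on time and dominated by the heat kernel. -/
structure HeatFamily (k : ℝ → Rn n → ℝ) (c β : ℝ) : Prop where
  c_nonneg : 0 ≤ c
  β_nonneg : 0 ≤ β
  bound : ∀ t, 0 < t → ∀ x, |k t x| ≤ c * t ^ (-β) * gauss n (2 * t) x
  cont_time : ∀ x, ContinuousOn (fun t => k t x) (Set.Ioi 0)
  cont_space : ∀ t, Continuous (k t)

lemma continuousOn_gauss_time (x : Rn n) : ContinuousOn (fun t => gauss n t x) (Set.Ioi 0) :=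
  fun _ ht => (hasDerivAt_gauss ht x).continuousAt.continuousWithinAt

lemma heatFamily_gauss : HeatFamily (gauss n) (2 ^ (n / 2 : ℝ)) 0 where
  c_nonneg := by positivity
  β_nonneg := le_rfl
  bound t ht x := by
    rw [abs_of_pos (gauss_pos ht x), neg_zero, Real.rpow_zero, mul_one]
    exact gauss_le_two_mul ht x
  cont_time := continuousOn_gauss_time
  cont_space t := (contDiff_gauss t).continuous

lemma heatFamily_gaussDeriv (i : Fin n) :
    HeatFamily (gaussDeriv i) (2 ^ (n / 2 : ℝ)) (1 / 2) where
  c_nonneg := by positivity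
  β_nonneg := by norm_num
  bound t ht x := abs_gaussDeriv_le ht i x
  cont_time x := by
    unfold gaussDeriv
    refine ContinuousOn.mul ?_ (continuousOn_gauss_time x)
    exact (continuousOn_const.div (by fun_prop) fun t ht => by
      have : (0 : ℝ) < t := ht
      positivity).neg
  cont_space t := (contDiff_gaussDeriv i t).continuous

lemma heatFamily_gaussLap : HeatFamily (gaussLap n) (2 ^ (n / 2 : ℝ) * (2 + n)) 1 where
  c_nonneg := by positivity
  β_nonneg := zero_le_one
  bound t ht x := by
    rw [Real.rpow_neg_one, ← div_eq_mul_inv]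
    exact abs_gaussLap_le ht x
  cont_time x := by
    unfold gaussLap
    refine ContinuousOn.mul ?_ (continuousOn_gauss_time x)
    refine (continuousOn_const.div (by fun_prop) fun t ht => ?_).sub
      (continuousOn_const.div (by fun_prop) fun t ht => ?_) <;>
    · have : (0 : ℝ) < t := ht
      positivity
  cont_space t := continuous_gaussLap t

/-- A single integrable majorant for all times near `t`, for use in dominated convergence and in
differentiation under the integral. -/
lemma gauss_le_of_mem {t r : ℝ} (ht : 0 < t) (h1 : t / 2 ≤ r) (h2 : r ≤ 2 * t) (x : Rn n) :
    gauss n r x ≤ 4 ^ (n / 2 : ℝ) * gauss n (2 * t) x := by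
  have hr : 0 < r := by linarith
  unfold gauss
  rw [← mul_assoc]
  have e : (4 : ℝ) ^ (n / 2 : ℝ) * (4 * Real.pi * (2 * t)) ^ (-(n / 2 : ℝ)) =
      (4 * Real.pi * (t / 2)) ^ (-(n / 2 : ℝ)) := by
    rw [show 4 * Real.pi * (2 * t) = 4 * (4 * Real.pi * (t / 2)) by ring,
      Real.mul_rpow (by norm_num) (by positivity), ← mul_assoc, ← Real.rpow_add (by norm_num)]
    simp
  rw [e]
  have hp := Real.pi_pos
  refine mul_le_mul (Real.rpow_le_rpow_of_nonpos (by positivity) (by gcongr) ?_)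
    (Real.exp_le_exp.2 ?_) (by positivity) (by positivity)
  · have : (0 : ℝ) ≤ n / 2 := by positivity
    linarith
  · gcongr

variable {k : ℝ → Rn n → ℝ} {c β : ℝ}

lemma HeatFamily.integrable (hk : HeatFamily k c β) {t : ℝ} (ht : 0 < t) : Integrable (k t) :=
  ((integrable_gauss (by positivity : 0 < 2 * t)).const_mul (c * t ^ (-β))).mono'
    (hk.cont_space t).aestronglyMeasurable (Eventually.of_forall (hk.bound t ht))

/-- The Gaussian majorant has mass 1, so only the factor t^(-β) remains to be compensated by the
weight of a superposition. -/
lemma HeatFamily.norm_le (hk : HeatFamily k c β) {t : ℝ} (ht : 0 < t) :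
    ‖toLOne (k t)‖ ≤ c * t ^ (-β) := by
  rw [norm_toLOne (hk.integrable ht)]
  have h := integral_mono (hk.integrable ht).abs
    ((integrable_gauss (n := n) (by positivity : 0 < 2 * t)).const_mul (c * t ^ (-β)))
    (hk.bound t ht)
  rwa [integral_const_mul, integral_gauss (by positivity), mul_one] at h

lemma HeatFamily.continuousOn (hk : HeatFamily k c β) :
    ContinuousOn (fun t => toLOne (k t)) (Set.Ioi 0) := by
  refine continuousOn_toLOne isOpen_Ioi (fun t ht => ?_) hk.cont_time
    fun t _ => (hk.cont_space t).aestronglyMeasurable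
  have ht0 : (0 : ℝ) < t := ht
  refine ⟨fun x => c * (t / 2) ^ (-β) * (4 ^ (n / 2 : ℝ) * gauss n (2 * (2 * t)) x),
    ((integrable_gauss (by positivity)).const_mul _).const_mul _, ?_⟩
  filter_upwards [Ioo_mem_nhds (by linarith : t / 2 < t) (by linarith : t < 2 * t)] with r hr x
  have hr0 : 0 < r := by linarith [hr.1]
  refine (hk.bound r hr0 x).trans ?_
  have hc := hk.c_nonneg
  have h1 : r ^ (-β) ≤ (t / 2) ^ (-β) :=
    Real.rpow_le_rpow_of_nonpos (by positivity) hr.1.le (by linarith [hk.β_nonneg])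
  have h2 := gauss_le_of_mem (t := 2 * t) (r := 2 * r) (by positivity) (by linarith [hr.1])
    (by linarith [hr.2]) x
  have h3 := (gauss_pos (by positivity : 0 < 2 * r) x).le
  gcongr

/-- Superposition of the kernels of a heat family. -/
def subord (m : ℝ → ℝ) (k : ℝ → Rn n → ℝ) : LpFull n 1 :=
  ∫ t in Set.Ioi 0, m t • toLOne (k t)

lemma HeatFamily.integrableOn (hk : HeatFamily k c β) {m : ℝ → ℝ}
    (hm : ContinuousOn m (Set.Ioi 0))
    (hi : IntegrableOn (fun t => m t * t ^ (-β)) (Set.Ioi 0)) :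
    IntegrableOn (fun t => m t • toLOne (k t)) (Set.Ioi 0) := by
  refine (hi.norm.const_mul c).mono'
    ((hm.smul hk.continuousOn).aestronglyMeasurable measurableSet_Ioi) ?_
  filter_upwards [ae_restrict_mem measurableSet_Ioi] with t ht
  have ht0 : (0 : ℝ) < t := ht
  rw [norm_smul, norm_mul, Real.norm_of_nonneg (Real.rpow_nonneg ht0.le (-β))]
  calc ‖m t‖ * ‖toLOne (k t)‖ ≤ ‖m t‖ * (c * t ^ (-β)) := by gcongr; exact hk.norm_le ht0
    _ = _ := by ring

/-- Pairing with a function is bounded on L¹ and passes under the Bochner integral. Identities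
between kernels thereby reduce to scalar integrals over time. -/
lemma HeatFamily.integral_subord_mul (hk : HeatFamily k c β) {m : ℝ → ℝ}
    (hm : ContinuousOn m (Set.Ioi 0))
    (hi : IntegrableOn (fun t => m t * t ^ (-β)) (Set.Ioi 0)) {h : Rn n → ℝ} (hh : AllMemLp h) :
    ∫ x, subord m k x * h x = ∫ t in Set.Ioi 0, m t * ∫ x, k t x * h x := by
  rw [← pairing_apply hh, subord,
    ← (pairing 1 hh).integral_comp_comm (hk.integrableOn hm hi)]
  refine setIntegral_congr_fun measurableSet_Ioi fun t ht => ?_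
  simp only [map_smul, smul_eq_mul]
  rw [pairing_apply, integral_toLOne_mul (hk.integrable ht)]

lemma HeatFamily.continuousOn_integral_mul (hk : HeatFamily k c β) {h : Rn n → ℝ}
    (hh : AllMemLp h) : ContinuousOn (fun t => ∫ x, k t x * h x) (Set.Ioi 0) := by
  refine ((pairing 1 hh).continuous.comp_continuousOn hk.continuousOn).congr fun t ht => ?_
  simp only [Function.comp_apply]
  rw [pairing_apply, integral_toLOne_mul (hk.integrable ht)]

end Subordination

/-! ### The heat flow of test functions, the resolvent and the semigroup law -/

section HeatFlow

variable {n : ℕ}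

lemma abs_integral_gauss_mul_le {t : ℝ} (ht : 0 < t) {h : Rn n → ℝ} {M : ℝ} (hM : ∀ x, |h x| ≤ M) :
    |∫ x, gauss n t x * h x| ≤ M := by
  have h1 := norm_integral_le_of_norm_le ((integrable_gauss (n := n) ht).mul_const M)
    (f := fun x => gauss n t x * h x) (Eventually.of_forall fun x => by
      rw [norm_mul, Real.norm_of_nonneg (gauss_pos ht x).le]
      exact mul_le_mul_of_nonneg_left (hM x) (gauss_pos ht x).le)
  rwa [integral_mul_const, integral_gauss ht, one_mul] at h1

lemma integral_gauss_mul_pd {Θ : Rn n → ℝ} (hΘ : IsTest Θ) (i : Fin n) (t : ℝ) :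
    ∫ x, gauss n t x * pd i Θ x = -∫ x, gaussDeriv i t x * Θ x := by
  rw [integral_mul_pd ((contDiff_gauss t).of_le (by simp)) hΘ]
  simp only [pd_gauss]

lemma integral_gauss_mul_lap {Θ : Rn n → ℝ} (hΘ : IsTest Θ) {t : ℝ} (ht : 0 < t) :
    ∫ x, gauss n t x * lap Θ x = ∫ x, gaussLap n t x * Θ x := by
  have hi : ∀ i : Fin n, Integrable fun x => gauss n t x * pd i (pd i Θ) x := fun i =>
    ((contDiff_gauss t).continuous.mul ((hΘ.pd i).pd i).continuous).integrable_of_hasCompactSupport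
      ((hΘ.pd i).pd i).compact.mul_left
  have hi2 : ∀ i : Fin n, Integrable fun x => pd i (gaussDeriv i t) x * Θ x := fun i =>
    ((contDiff_pd (contDiff_gaussDeriv i t) i).continuous.mul
      hΘ.continuous).integrable_of_hasCompactSupport hΘ.compact.mul_left
  simp only [lap, Finset.mul_sum, ← sum_pd_gaussDeriv ht, Finset.sum_mul]
  rw [integral_finsetSum _ fun i _ => hi i, integral_finsetSum _ fun i _ => hi2 i]
  refine Finset.sum_congr rfl fun i _ => ?_
  rw [integral_gauss_mul_pd (hΘ.pd i), integral_mul_pd ((contDiff_gaussDeriv i t).of_le (by simp)) hΘ,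
    neg_neg]

lemma hasDerivAt_integral_gauss_mul {Θ : Rn n → ℝ} (hΘ : IsTest Θ) {t : ℝ} (ht : 0 < t) :
    HasDerivAt (fun t => ∫ x, gauss n t x * Θ x) (∫ x, gaussLap n t x * Θ x) t := by
  obtain ⟨M, hM0, hM⟩ := hΘ.exists_bound
  have hk := heatFamily_gaussLap (n := n)
  have hc := hk.c_nonneg
  refine (hasDerivAt_integral_of_dominated_loc_of_deriv_le
    (F := fun t x => gauss n t x * Θ x) (F' := fun t x => gaussLap n t x * Θ x)
    (s := Set.Ioo (t / 2) (2 * t))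
    (bound := fun x => 2 ^ (n / 2 : ℝ) * (2 + n) * (t / 2) ^ (-1 : ℝ) *
      (4 ^ (n / 2 : ℝ) * gauss n (2 * (2 * t)) x) * M)
    (Ioo_mem_nhds (by linarith) (by linarith))
    (Eventually.of_forall fun r => ((contDiff_gauss r).continuous.mul
      hΘ.continuous).aestronglyMeasurable)
    (((contDiff_gauss t).continuous.mul hΘ.continuous).integrable_of_hasCompactSupport
      hΘ.compact.mul_left)
    ((continuous_gaussLap t).mul hΘ.continuous).aestronglyMeasurable
    (Eventually.of_forall fun x r hr => ?_)
    ((((integrable_gauss (by positivity)).const_mul _).const_mul _).mul_const _)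
    (Eventually.of_forall fun x r hr => ?_)).2
  · have hr0 : 0 < r := by linarith [hr.1]
    rw [norm_mul]
    have h1 : r ^ (-1 : ℝ) ≤ (t / 2) ^ (-1 : ℝ) :=
      Real.rpow_le_rpow_of_nonpos (by positivity) hr.1.le (by norm_num)
    have h2 := gauss_le_of_mem (t := 2 * t) (r := 2 * r) (by positivity) (by linarith [hr.1])
      (by linarith [hr.2]) x
    have h3 := (gauss_pos (by positivity : 0 < 2 * r) x).le
    have h4 := hk.bound r hr0 x
    have h5 : ‖gaussLap n r x‖ ≤ 2 ^ (n / 2 : ℝ) * (2 + n) * (t / 2) ^ (-1 : ℝ) *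
        (4 ^ (n / 2 : ℝ) * gauss n (2 * (2 * t)) x) := h4.trans (by gcongr)
    exact mul_le_mul h5 (hM x) (norm_nonneg _) ((norm_nonneg _).trans h5)
  · exact (hasDerivAt_gauss (by linarith [hr.1]) x).mul_const _

/-- A test function is Lipschitz, so the error is at most a constant times ∫ |x| gauss, which is of
order √t. -/
lemma tendsto_integral_gauss_mul {Θ : Rn n → ℝ} (hΘ : IsTest Θ) :
    Tendsto (fun t => ∫ x, gauss n t x * Θ x) (𝓝[>] 0) (𝓝 (Θ 0)) := by
  obtain ⟨K, hK⟩ := hΘ.smooth.lipschitzWith_of_hasCompactSupport hΘ.compact (by simp)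
  have hlim : Tendsto (fun t : ℝ => K * (2 * √t * 2 ^ (n / 2 : ℝ))) (𝓝[>] 0) (𝓝 0) := by
    have : Continuous fun t : ℝ => (K : ℝ) * (2 * √t * 2 ^ (n / 2 : ℝ)) := by fun_prop
    have h := this.tendsto 0
    simp only [Real.sqrt_zero, mul_zero, zero_mul] at h
    exact h.mono_left nhdsWithin_le_nhds
  rw [tendsto_iff_norm_sub_tendsto_zero]
  refine squeeze_zero' (Eventually.of_forall fun _ => norm_nonneg _) ?_ hlim
  filter_upwards [self_mem_nhdsWithin] with t ht
  have ht0 : (0 : ℝ) < t := ht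
  have hi1 : Integrable fun x => gauss n t x * Θ x :=
    ((contDiff_gauss t).continuous.mul hΘ.continuous).integrable_of_hasCompactSupport
      hΘ.compact.mul_left
  have e : (∫ x, gauss n t x * Θ x) - Θ 0 = ∫ x, gauss n t x * (Θ x - Θ 0) := by
    simp only [mul_sub]
    rw [integral_sub hi1 ((integrable_gauss ht0).mul_const _), integral_mul_const,
      integral_gauss ht0, one_mul]
  rw [e]
  have h2t : 0 < 2 * t := by positivity
  have h := norm_integral_le_of_norm_le
    (((integrable_gauss (n := n) h2t).const_mul (2 * √t * 2 ^ (n / 2 : ℝ))).const_mul (K : ℝ))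
    (f := fun x => gauss n t x * (Θ x - Θ 0)) (Eventually.of_forall fun x => by
      rw [norm_mul, Real.norm_of_nonneg (gauss_pos ht0 x).le]
      have h1 : ‖Θ x - Θ 0‖ ≤ K * ‖x‖ := by
        simpa using hK.norm_sub_le x 0
      calc gauss n t x * ‖Θ x - Θ 0‖ ≤ gauss n t x * (K * ‖x‖) :=
            mul_le_mul_of_nonneg_left h1 (gauss_pos ht0 x).le
        _ = K * (‖x‖ * gauss n t x) := by ring
        _ ≤ _ := mul_le_mul_of_nonneg_left (norm_mul_gauss_le ht0 x) K.2)
  rwa [integral_const_mul, integral_const_mul, integral_gauss h2t, mul_one] at h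

lemma continuousOn_exp_neg : ContinuousOn (fun t : ℝ => Real.exp (-t)) (Set.Ioi 0) := by fun_prop

lemma integrableOn_rpow_mul_exp_neg {γ : ℝ} (hγ : -1 < γ) :
    IntegrableOn (fun t : ℝ => t ^ γ * Real.exp (-t)) (Set.Ioi 0) := by
  have := Real.GammaIntegral_convergent (s := γ + 1) (by linarith)
  simpa [mul_comm] using this

lemma integrableOn_exp_neg : IntegrableOn (fun t : ℝ => Real.exp (-t)) (Set.Ioi 0) := by
  simpa using integrableOn_rpow_mul_exp_neg (γ := 0) (by norm_num)

/-- With F(t) = ∫ gauss Θ, the heat equation makes the integrand the derivative of -e^(-t) F(t),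
which tends to -Θ(0) at time 0 and to 0 at infinity. This is the resolvent formula for (1-Δ)⁻¹,
evaluated at the origin. -/
lemma integral_exp_neg_mul_heat {Θ : Rn n → ℝ} (hΘ : IsTest Θ) :
    ∫ t in Set.Ioi (0 : ℝ), Real.exp (-t) * ∫ x, gauss n t x * (Θ x - lap Θ x) = Θ 0 := by
  obtain ⟨M, hM0, hM⟩ := hΘ.exists_bound
  obtain ⟨M', hM0', hM'⟩ := (hΘ.sub hΘ.lap).exists_bound
  let F : ℝ → ℝ := fun t => ∫ x, gauss n t x * Θ x
  -- The limit at time 0 is inserted by hand, since `gauss` approximates the identity only for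
  -- positive times.
  let f : ℝ → ℝ := fun t => if t ≤ 0 then -Θ 0 else -(Real.exp (-t) * F t)
  have hf0 : f 0 = -Θ 0 := by simp [f]
  have hfp : ∀ t, 0 < t → f t = -(Real.exp (-t) * F t) := fun t ht => by
    simp [f, not_le.2 ht]
  have hev : ∀ t, 0 < t → f =ᶠ[𝓝 t] fun t => -(Real.exp (-t) * F t) := fun t ht => by
    filter_upwards [Ioi_mem_nhds ht] with r hr using hfp r hr
  have key := integral_Ioi_of_hasDerivAt_of_tendsto (f := f) (a := 0) (m := 0)
    (f' := fun t => Real.exp (-t) * ∫ x, gauss n t x * (Θ x - lap Θ x)) ?_ ?_ ?_ ?_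
  · rw [key, hf0]; simp
  · rw [← continuousWithinAt_Ioi_iff_Ici, ContinuousWithinAt, hf0]
    have h1 : Tendsto (fun t : ℝ => -(Real.exp (-t) * F t)) (𝓝[>] 0)
        (𝓝 (-(Real.exp (-0) * Θ 0))) := by
      refine (Tendsto.mul ?_ (tendsto_integral_gauss_mul hΘ)).neg
      exact ((by fun_prop : Continuous fun t : ℝ => Real.exp (-t)).tendsto 0).mono_left
        nhdsWithin_le_nhds
    simp only [neg_zero, Real.exp_zero, one_mul] at h1
    refine h1.congr' ?_
    filter_upwards [self_mem_nhdsWithin] with t ht using (hfp t ht).symm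
  · intro t ht
    have ht0 : (0 : ℝ) < t := ht
    have h1 : HasDerivAt (fun t : ℝ => Real.exp (-t)) (Real.exp (-t) * -1) t :=
      (hasDerivAt_id t).neg.exp
    refine (((h1.mul (hasDerivAt_integral_gauss_mul hΘ ht0)).neg).congr_of_eventuallyEq
      (hev t ht0)).congr_deriv ?_
    rw [← integral_gauss_mul_lap hΘ ht0]
    simp only [mul_sub]
    rw [integral_sub (hΘ.allMemLp.integrable_mul (p := 1) (toLOne (gauss n t)) |>.congr ?_)
      (hΘ.lap.allMemLp.integrable_mul (p := 1) (toLOne (gauss n t)) |>.congr ?_)]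
    · ring
    all_goals
      filter_upwards [coeFn_toLOne (integrable_gauss (n := n) ht0)] with x hx
      rw [hx]
  · refine (integrableOn_exp_neg.mul_const M').mono'
      ((continuousOn_exp_neg.mul (heatFamily_gauss.continuousOn_integral_mul
        (hΘ.sub hΘ.lap).allMemLp)).aestronglyMeasurable measurableSet_Ioi) ?_
    filter_upwards [ae_restrict_mem measurableSet_Ioi] with t ht
    rw [norm_mul, Real.norm_of_nonneg (Real.exp_pos _).le]
    exact mul_le_mul_of_nonneg_left (abs_integral_gauss_mul_le ht hM') (Real.exp_pos _).le
  · have h0 : Tendsto (fun t : ℝ => Real.exp (-t) * M) atTop (𝓝 0) := by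
      simpa using (Real.tendsto_exp_neg_atTop_nhds_zero).mul_const M
    refine squeeze_zero_norm' ?_ h0
    filter_upwards [eventually_gt_atTop 0] with t ht
    rw [hfp t ht, norm_neg, norm_mul, Real.norm_of_nonneg (Real.exp_pos _).le]
    exact mul_le_mul_of_nonneg_left (abs_integral_gauss_mul_le ht hM) (Real.exp_pos _).le

/-- Completing the square in `y`: the centre is (s/(s+t)) x and the remaining Gaussian has time
st/(s+t), hence mass 1 in `conv_gauss`. -/
lemma gauss_mul_gauss {s t : ℝ} (hs : 0 < s) (ht : 0 < t) (x y : Rn n) :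
    gauss n s y * gauss n t (x - y) =
      gauss n (s + t) x * ((4 * Real.pi * (s * t / (s + t))) ^ (-(n / 2 : ℝ)) *
        Real.exp (-(1 / (4 * (s * t / (s + t)))) * ‖y - (s / (s + t)) • x‖ ^ 2)) := by
  unfold gauss
  have hst : 0 < s + t := by positivity
  have e1 : (4 * Real.pi * s) ^ (-(n / 2 : ℝ)) * (4 * Real.pi * t) ^ (-(n / 2 : ℝ)) =
      (4 * Real.pi * (s + t)) ^ (-(n / 2 : ℝ)) *
        (4 * Real.pi * (s * t / (s + t))) ^ (-(n / 2 : ℝ)) := by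
    rw [← Real.mul_rpow (by positivity) (by positivity),
      ← Real.mul_rpow (by positivity) (by positivity)]
    congr 1; field_simp
  have e2 : -(‖y‖ ^ 2 / (4 * s)) + -(‖x - y‖ ^ 2 / (4 * t)) = -(‖x‖ ^ 2 / (4 * (s + t))) +
      -(1 / (4 * (s * t / (s + t)))) * ‖y - (s / (s + t)) • x‖ ^ 2 := by
    rw [norm_sub_sq_real, norm_sub_sq_real, norm_smul, mul_pow, real_inner_smul_right,
      Real.norm_of_nonneg (by positivity), real_inner_comm]
    field_simp
    ring
  have e3 := congrArg Real.exp e2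
  rw [Real.exp_add, Real.exp_add] at e3
  linear_combination Real.exp (-(‖y‖ ^ 2 / (4 * s))) * Real.exp (-(‖x - y‖ ^ 2 / (4 * t))) * e1 +
    (4 * Real.pi * (s + t)) ^ (-(n / 2 : ℝ)) *
        (4 * Real.pi * (s * t / (s + t))) ^ (-(n / 2 : ℝ)) * e3

lemma conv_gauss {s t : ℝ} (hs : 0 < s) (ht : 0 < t) :
    conv 1 (toLOne (gauss n s)) (toLOne (gauss n t)) = toLOne (gauss n (s + t)) := by
  refine Lp.ext ((conv_toLOne_ae_eq _ (integrable_gauss ht)).trans ?_)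
  refine EventuallyEq.trans (Eventually.of_forall fun x => ?_)
    (coeFn_toLOne (integrable_gauss (by positivity))).symm
  simp only
  rw [integral_toLOne_mul (h := fun y => gauss n t (x - y)) (integrable_gauss hs)]
  simp only [gauss_mul_gauss hs ht]
  rw [integral_const_mul, integral_const_mul,
    integral_sub_right_eq_self (fun y : Rn n => Real.exp (-(1 / (4 * (s * t / (s + t)))) * ‖y‖ ^ 2)),
    ← integral_const_mul]
  simp only [← gauss_eq]
  rw [integral_gauss (by positivity), mul_one]

end HeatFlow

/-! ### Fractional powers of 1 - Δ -/

section Bessel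

variable {n : ℕ}

/-- Kernel of `(1 - Δ)^(a-1)`, up to a constant. -/
def besselB (n : ℕ) (a : ℝ) : LpFull n 1 :=
  subord (fun t => t ^ (-a) * Real.exp (-t)) (gauss n)

/-- Kernel of `(1 - Δ)^(-a)`, up to a constant. -/
def besselJ (n : ℕ) (a : ℝ) : LpFull n 1 :=
  subord (fun t => t ^ (a - 1) * Real.exp (-t)) (gauss n)

/-- Kernel of `(1 - Δ)⁻¹`. -/
def besselE (n : ℕ) : LpFull n 1 := subord (fun t => Real.exp (-t)) (gauss n)

/-- The derivatives of `besselB`. -/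
def besselBDeriv (a : ℝ) (i : Fin n) : LpFull n 1 :=
  subord (fun t => t ^ (-a) * Real.exp (-t)) (gaussDeriv i)

/-- The Beta integral B(a, 1-a), the constant that arises when the weights of `besselJ` and
`besselB` are convolved on the half-line. -/
def betaConst (a : ℝ) : ℝ := ∫ x in (0 : ℝ)..1, x ^ (a - 1) * (1 - x) ^ (-a)

lemma continuousOn_rpow_mul_exp_neg (γ : ℝ) :
    ContinuousOn (fun t : ℝ => t ^ γ * Real.exp (-t)) (Set.Ioi 0) :=
  ContinuousOn.mul (fun t ht => (Real.continuousAt_rpow_const t γ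
    (Or.inl (ne_of_gt ht))).continuousWithinAt) (by fun_prop)

lemma integrableOn_rpow_mul_exp_neg_mul {γ β : ℝ} (h : -1 < γ - β) :
    IntegrableOn (fun t : ℝ => t ^ γ * Real.exp (-t) * t ^ (-β)) (Set.Ioi 0) := by
  refine (integrableOn_rpow_mul_exp_neg h).congr_fun (fun t ht => ?_) measurableSet_Ioi
  have ht0 : (0 : ℝ) < t := ht
  simp only [sub_eq_add_neg, Real.rpow_add ht0]; ring

/-- The resolvent formula `integral_exp_neg_mul_heat` for the reflected translate φ(x - ·), at every
x. -/
lemma conv_besselE {φ : Rn n → ℝ} (hφ : IsTest φ) :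
    conv 1 (besselE n) (toLOne fun x => φ x - lap φ x) = toLOne φ := by
  refine Lp.ext ((conv_toLOne_ae_eq _ (hφ.sub hφ.lap).integrable).trans ?_)
  refine EventuallyEq.trans (Eventually.of_forall fun x => ?_) (coeFn_toLOne hφ.integrable).symm
  have h1 := hφ.comp_sub_left x
  have h2 := integral_exp_neg_mul_heat h1
  simp only [lap_comp_sub_left hφ, sub_zero] at h2
  simp only
  rw [← h2]
  unfold besselE
  refine heatFamily_gauss.integral_subord_mul continuousOn_exp_neg ?_
    ((hφ.sub hφ.lap).comp_sub_left x).allMemLp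
  simpa using integrableOn_exp_neg

/-- The exponents a-1 and -a add up to -1, so the integral is invariant under scaling. -/
lemma betaConst_scaled {a τ : ℝ} (hτ : 0 < τ) :
    ∫ t in (0 : ℝ)..τ, t ^ (a - 1) * (τ - t) ^ (-a) = betaConst a := by
  have h := intervalIntegral.smul_integral_comp_mul_left (a := 0) (b := 1)
    (fun t => t ^ (a - 1) * (τ - t) ^ (-a)) τ
  rw [mul_zero, mul_one] at h
  rw [← h, smul_eq_mul, ← intervalIntegral.integral_const_mul]
  refine intervalIntegral.integral_congr fun x hx => ?_
  rw [Set.uIcc_of_le zero_le_one] at hx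
  have e : τ - τ * x = τ * (1 - x) := by ring
  simp only [e]
  rw [Real.mul_rpow hτ.le hx.1, Real.mul_rpow hτ.le (by linarith [hx.2])]
  have : τ * (τ ^ (a - 1) * τ ^ (-a)) = 1 := by
    rw [← Real.rpow_add hτ, show a - 1 + -a = -1 by ring, Real.rpow_neg_one,
      mul_inv_cancel₀ hτ.ne']
  linear_combination (x ^ (a - 1) * (1 - x) ^ (-a)) * this

/-- If it vanished, so would the half-line convolution of t^(a-1) e^(-t) and t^(-a) e^(-t), whose
total integral is Γ(a) Γ(1-a) > 0. -/
lemma betaConst_ne_zero {a : ℝ} (ha0 : 0 < a) (ha1 : a < 1) : betaConst a ≠ 0 := by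
  have h := integral_posConvolution (μ := volume) (ν := volume)
    (integrableOn_rpow_mul_exp_neg (γ := a - 1) (by linarith))
    (integrableOn_rpow_mul_exp_neg (γ := -a) (by linarith)) (ContinuousLinearMap.mul ℝ ℝ)
  have h1 : ∫ x in Set.Ioi (0 : ℝ), x ^ (a - 1) * Real.exp (-x) = Real.Gamma a := by
    rw [Real.Gamma_eq_integral ha0]; simp [mul_comm]
  have h2 : ∫ x in Set.Ioi (0 : ℝ), x ^ (-a) * Real.exp (-x) = Real.Gamma (1 - a) := by
    rw [Real.Gamma_eq_integral (by linarith)]; simp [mul_comm]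
  simp only [h1, h2, ContinuousLinearMap.mul_apply'] at h
  have h3 := mul_pos (Real.Gamma_pos_of_pos ha0) (Real.Gamma_pos_of_pos (sub_pos.2 ha1))
  intro h0
  rw [← h] at h3
  refine h3.ne' (setIntegral_eq_zero_of_forall_eq_zero fun τ hτ => ?_)
  have e : ∀ t, t ^ (a - 1) * Real.exp (-t) * ((τ - t) ^ (-a) * Real.exp (-(τ - t))) =
      Real.exp (-τ) * (t ^ (a - 1) * (τ - t) ^ (-a)) := fun t => by
    have : Real.exp (-t) * Real.exp (-(τ - t)) = Real.exp (-τ) := by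
      rw [← Real.exp_add]; ring_nf
    linear_combination (t ^ (a - 1) * (τ - t) ^ (-a)) * this
  simp only [e]
  rw [intervalIntegral.integral_const_mul, betaConst_scaled hτ, h0, mul_zero]

/-- By the semigroup law the composition of two superpositions is the superposition whose weight is
the half-line convolution of the weights, here a multiple of e^(-τ). It expresses (1-Δ)^(-a)
(1-Δ)^(a-1) = (1-Δ)⁻¹. -/
lemma conv_besselJ_besselB {a : ℝ} (ha0 : 0 < a) (ha1 : a < 1) :
    conv 1 (besselJ n a) (besselB n a) = betaConst a • besselE n := by
  have hg := heatFamily_gauss (n := n)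
  have hJ := hg.integrableOn (continuousOn_rpow_mul_exp_neg (a - 1))
    (integrableOn_rpow_mul_exp_neg_mul (by linarith))
  have hB := hg.integrableOn (continuousOn_rpow_mul_exp_neg (-a))
    (integrableOn_rpow_mul_exp_neg_mul (by linarith))
  have h := integral_posConvolution (μ := volume) (ν := volume) hJ hB (conv 1)
  unfold besselJ besselB besselE subord
  rw [← h, ← integral_smul]
  refine setIntegral_congr_fun measurableSet_Ioi fun τ hτ => ?_
  have hτ0 : (0 : ℝ) < τ := hτ
  simp only
  rw [smul_smul, ← betaConst_scaled hτ0, mul_comm, ← intervalIntegral.integral_const_mul,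
    ← intervalIntegral.integral_smul_const]
  refine intervalIntegral.integral_congr_ae ?_
  have hne : ∀ᵐ t : ℝ, t ≠ τ := by simp [ae_iff, measure_singleton]
  filter_upwards [hne] with t htτ ht
  rw [Set.uIoc_of_le hτ0.le] at ht
  have h1 : 0 < τ - t := sub_pos.2 (lt_of_le_of_ne ht.2 htτ)
  simp only [map_smul, _root_.smul_apply]
  rw [conv_gauss ht.1 h1, smul_smul, add_sub_cancel]
  congr 1
  have : Real.exp (-t) * Real.exp (-(τ - t)) = Real.exp (-τ) := by
    rw [← Real.exp_add]; ring_nf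
  linear_combination (t ^ (a - 1) * (τ - t) ^ (-a)) * this

/-- The gradient of the heat kernel costs t^(-1/2), and t^(-a-1/2) is integrable at 0 precisely
because a < 1/2. So the derivative is a genuine L¹ kernel. -/
lemma integral_besselB_mul_pd {a : ℝ} (ha0 : 0 < a) (ha1 : a < 1 / 2) {Θ : Rn n → ℝ}
    (hΘ : IsTest Θ) (i : Fin n) :
    ∫ x, besselB n a x * pd i Θ x = -∫ x, besselBDeriv a i x * Θ x := by
  unfold besselB besselBDeriv
  rw [heatFamily_gauss.integral_subord_mul (continuousOn_rpow_mul_exp_neg _)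
      (integrableOn_rpow_mul_exp_neg_mul (by linarith)) (hΘ.pd i).allMemLp,
    (heatFamily_gaussDeriv i).integral_subord_mul (continuousOn_rpow_mul_exp_neg _)
      (integrableOn_rpow_mul_exp_neg_mul (by linarith)) hΘ.allMemLp, ← integral_neg]
  simp only [integral_gauss_mul_pd hΘ, mul_neg]

lemma conv_gauss_lap {φ : Rn n → ℝ} (hφ : IsTest φ) {t : ℝ} (ht : 0 < t) :
    conv 1 (toLOne (gauss n t)) (toLOne (lap φ)) =
      conv 1 (toLOne (gaussLap n t)) (toLOne φ) := by
  refine Lp.ext ((conv_toLOne_ae_eq _ hφ.lap.integrable).trans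
    (EventuallyEq.trans (Eventually.of_forall fun x => ?_)
      (conv_toLOne_ae_eq _ hφ.integrable).symm))
  simp only
  rw [integral_toLOne_mul (h := fun y => lap φ (x - y)) (integrable_gauss ht),
    integral_toLOne_mul (h := fun y => φ (x - y)) (heatFamily_gaussLap.integrable ht),
    ← integral_gauss_mul_lap (hφ.comp_sub_left x) ht]
  simp only [lap_comp_sub_left hφ]

/-- Interpolation estimate for the fractional operator `(1 - Δ)^a`. -/
lemma exists_norm_conv_besselB_le (n : ℕ) {a θ : ℝ} (ha : 0 < a) (h1 : a < θ) (h2 : θ < 1) :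
    ∃ C, 0 ≤ C ∧ ∀ φ : Rn n → ℝ, IsTest φ →
      ‖conv 1 (besselB n a) (toLOne fun x => φ x - lap φ x)‖ ≤
        C * (‖toLOne fun x => φ x - lap φ x‖ ^ θ * ‖toLOne φ‖ ^ (1 - θ)) := by
  set c : ℝ := 2 ^ (n / 2 : ℝ) with hc
  have hc0 : 0 < c := by positivity
  set D : ℝ := c * (2 + n) with hD
  have hD0 : 0 ≤ D := by positivity
  let w : ℝ → ℝ := fun t => t ^ (θ - a - 1) * Real.exp (-t) * (1 + D) +
    t ^ (θ - a) * Real.exp (-t) * c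
  have hwi : IntegrableOn w (Set.Ioi 0) :=
    ((integrableOn_rpow_mul_exp_neg (by linarith)).mul_const _).add
      ((integrableOn_rpow_mul_exp_neg (by linarith)).mul_const _)
  have hw0 : ∀ t ∈ Set.Ioi (0 : ℝ), 0 ≤ w t := fun t ht => by
    have : (0 : ℝ) < t := ht
    positivity
  refine ⟨c ^ θ * ∫ t in Set.Ioi 0, w t,
    mul_nonneg (by positivity) (setIntegral_nonneg measurableSet_Ioi hw0), fun φ hφ => ?_⟩
  set g := toLOne fun x => φ x - lap φ x with hg
  set X := ‖g‖ with hX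
  set Y := ‖toLOne φ‖ with hY
  have hX0 : 0 ≤ X := norm_nonneg _
  have hY0 : 0 ≤ Y := norm_nonneg _
  have hF := heatFamily_gauss (n := n)
  have hint := hF.integrableOn (continuousOn_rpow_mul_exp_neg (-a))
    (integrableOn_rpow_mul_exp_neg_mul (by linarith))
  have e1 : conv 1 (besselB n a) g = ∫ t in Set.Ioi 0, (t ^ (-a) * Real.exp (-t)) •
      conv 1 (toLOne (gauss n t)) g := by
    have := ((conv 1).flip g).integral_comp_comm hint
    unfold besselB subord
    refine this.symm.trans (integral_congr_ae (Eventually.of_forall fun t => ?_))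
    simp only [map_smul, ContinuousLinearMap.flip_apply]
  rw [e1]
  have hb : ∀ t ∈ Set.Ioi (0 : ℝ), ‖(t ^ (-a) * Real.exp (-t)) •
      conv 1 (toLOne (gauss n t)) g‖ ≤ c ^ θ * w t * (X ^ θ * Y ^ (1 - θ)) := by
    intro t ht
    have ht0 : (0 : ℝ) < t := ht
    have b1 : ‖conv 1 (toLOne (gauss n t)) g‖ ≤ c * X := by
      refine (norm_conv_apply_le _ _).trans ?_
      gcongr
      simpa using hF.norm_le ht0
    have b2 : ‖conv 1 (toLOne (gauss n t)) g‖ ≤ (c + D / t) * Y := by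
      rw [hg, toLOne_sub hφ.integrable hφ.lap.integrable, map_sub, conv_gauss_lap hφ ht0]
      refine (norm_sub_le _ _).trans ?_
      rw [add_mul]
      refine add_le_add ((norm_conv_apply_le _ _).trans ?_) ((norm_conv_apply_le _ _).trans ?_)
      · gcongr
        simpa using hF.norm_le ht0
      · gcongr
        have := (heatFamily_gaussLap (n := n)).norm_le ht0
        rwa [Real.rpow_neg_one, ← div_eq_mul_inv] at this
    set q := ‖conv 1 (toLOne (gauss n t)) g‖ with hq
    have hq0 : 0 ≤ q := norm_nonneg _
    -- Geometric mean of two bounds: `b1` leaves φ - Δφ untouched, `b2` moves the Laplacian onto the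
    -- heat kernel at the cost of 1/t. The resulting t^(θ-1) times t^(-a) is integrable at 0 since θ
    -- > a.
    have b3 : q ≤ (c * X) ^ θ * ((c + D / t) * Y) ^ (1 - θ) := by
      calc q = q ^ θ * q ^ (1 - θ) := by
            rw [← Real.rpow_add_of_nonneg hq0 (by linarith) (by linarith)]; simp
        _ ≤ _ := by
          gcongr
          linarith
    have b4 : (c + D / t) ^ (1 - θ) ≤ t ^ (θ - 1) * (1 + D + c * t) := by
      have : c + D / t = t⁻¹ * (D + c * t) := by field_simp; ring
      rw [this, Real.mul_rpow (by positivity) (by positivity), Real.inv_rpow ht0.le,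
        ← Real.rpow_neg ht0.le, neg_sub]
      gcongr
      have hz : 0 ≤ D + c * t := by positivity
      calc (D + c * t) ^ (1 - θ) ≤ (1 + D + c * t) ^ (1 - θ) := by
            gcongr <;> linarith
        _ ≤ (1 + D + c * t) ^ (1 : ℝ) :=
            Real.rpow_le_rpow_of_exponent_le (by linarith) (by linarith)
        _ = _ := Real.rpow_one _
    rw [norm_smul, Real.norm_of_nonneg (by positivity), ← hq]
    calc t ^ (-a) * Real.exp (-t) * q
        ≤ t ^ (-a) * Real.exp (-t) * ((c * X) ^ θ * ((c + D / t) * Y) ^ (1 - θ)) := by gcongr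
      _ = t ^ (-a) * Real.exp (-t) * (c ^ θ * X ^ θ * ((c + D / t) ^ (1 - θ) * Y ^ (1 - θ))) := by
          rw [Real.mul_rpow hc0.le hX0, Real.mul_rpow (by positivity) hY0]
      _ ≤ t ^ (-a) * Real.exp (-t) * (c ^ θ * X ^ θ *
          ((t ^ (θ - 1) * (1 + D + c * t)) * Y ^ (1 - θ))) := by gcongr
      _ = c ^ θ * ((t ^ (-a) * t ^ (θ - 1)) * Real.exp (-t) * (1 + D) +
          (t ^ (-a) * t ^ (θ - 1) * t ^ (1 : ℝ)) * Real.exp (-t) * c) * (X ^ θ * Y ^ (1 - θ)) := by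
          rw [Real.rpow_one]; ring
      _ = _ := by
          rw [← Real.rpow_add ht0, ← Real.rpow_add ht0]
          simp only [w]
          ring_nf
  have hwi2 : IntegrableOn (fun t => c ^ θ * w t * (X ^ θ * Y ^ (1 - θ))) (Set.Ioi 0) :=
    (hwi.const_mul _).mul_const _
  refine (norm_integral_le_of_norm_le hwi2 ?_).trans_eq ?_
  · filter_upwards [ae_restrict_mem measurableSet_Ioi] with t ht using hb t ht
  · rw [integral_mul_const, integral_const_mul]

end Bessel

/-! ### The potential of the nonlocal gradient -/

section Profile

variable {n : ℕ} [NeZero n] {δ : ℝ}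

/-- The radial profile of a cut-off function. -/
def Cutoff.prof (w : Cutoff n δ) (r : ℝ) : ℝ := w (r • EuclideanSpace.single (0 : Fin n) 1)

lemma Cutoff.eq_prof (w : Cutoff n δ) (z : Rn n) : w z = w.prof ‖z‖ := by
  obtain ⟨wb, -, h⟩ := w.radial
  unfold Cutoff.prof
  rw [h, h, norm_smul]; simp

lemma Cutoff.contDiff_prof (w : Cutoff n δ) : ContDiff ℝ ∞ w.prof :=
  w.smooth.comp (contDiff_id.smul contDiff_const)

lemma Cutoff.prof_nonneg (w : Cutoff n δ) (r : ℝ) : 0 ≤ w.prof r := w.nonneg _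

omit [NeZero n] in
lemma Cutoff.apply_zero (hδ : 0 < δ) (w : Cutoff n δ) : w 0 = 1 := by
  obtain ⟨m, hm0, -, hm⟩ := w.eq_one
  exact hm 0 (Metric.mem_ball_self (by positivity))

lemma Cutoff.prof_le_one (hδ : 0 < δ) (w : Cutoff n δ) (r : ℝ) : w.prof r ≤ 1 := by
  rw [← w.apply_zero hδ]
  exact w.decreasing _ _ (by simp)

lemma Cutoff.prof_eq_zero (w : Cutoff n δ) {r : ℝ} (hr : δ ≤ |r|) : w.prof r = 0 := by
  by_contra h
  have := w.tsupport_subset (subset_tsupport _ h)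
  simp [norm_smul] at this
  linarith

lemma Cutoff.exists_prof_eq_one (hδ : 0 < δ) (w : Cutoff n δ) :
    ∃ m, 0 < m ∧ ∀ r, |r| < m → w.prof r = 1 := by
  obtain ⟨m, hm0, -, hm⟩ := w.eq_one
  exact ⟨m * δ, by positivity, fun r hr => hm _ (by simpa [norm_smul] using hr)⟩

/-- The profile of the vector field `z ↦ kernel(z) z / |z|²`. -/
def fieldProf (s : ℝ) (w : Cutoff n δ) (r : ℝ) : ℝ :=
  scaling s w * w.prof r * |r| ^ (-((n : ℝ) + s + 1))

/-- Truncations of `fieldProf` near the origin. -/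
def fieldProfCut (s : ℝ) (w : Cutoff n δ) (j : ℕ) (r : ℝ) : ℝ :=
  fieldProf s w r * (1 - w.prof ((j + 1) * r))

/-- The potential of the nonlocal gradient. -/
def potential (s : ℝ) (w : Cutoff n δ) (x : Rn n) : ℝ :=
  ∫ r in ‖x‖..δ, fieldProf s w r * r

/-- Its profile vanishes near the origin, so it is continuously differentiable and classical
integration by parts applies before the limit in j. -/
def potentialCut (s : ℝ) (w : Cutoff n δ) (j : ℕ) (x : Rn n) : ℝ :=
  ∫ r in ‖x‖..δ, fieldProfCut s w j r * r

variable {s : ℝ} {w : Cutoff n δ}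

lemma kernel_eq (hs : 0 < s) (z : Rn n) : kernel s w z = fieldProf s w ‖z‖ * ‖z‖ ^ 2 := by
  have hn : (1 : ℝ) ≤ n := by exact_mod_cast NeZero.one_le
  unfold kernel fieldProf
  rw [← w.eq_prof, abs_norm]
  rcases eq_or_ne z 0 with rfl | hz
  · simp [Real.zero_rpow (by linarith : (n : ℝ) + s - 1 ≠ 0)]
  · have hz0 : 0 < ‖z‖ := norm_pos_iff.2 hz
    have : ‖z‖ ^ (-((n : ℝ) + s + 1)) * ‖z‖ ^ 2 = (‖z‖ ^ ((n : ℝ) + s - 1))⁻¹ := by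
      rw [← Real.rpow_natCast, ← Real.rpow_add hz0, ← Real.rpow_neg hz0.le]
      congr 1; push_cast; ring
    rw [div_eq_mul_inv, ← this]; ring

lemma fieldProf_nonneg (hδ : 0 < δ) (hs1 : s < 1) (r : ℝ) : 0 ≤ fieldProf s w r := by
  have h1 := (scaling_spec hs1 hδ (NeZero.pos n) w).1
  have h2 := w.prof_nonneg r
  unfold fieldProf
  positivity

lemma fieldProf_eq_zero {r : ℝ} (hr : δ ≤ |r|) : fieldProf s w r = 0 := by
  simp [fieldProf, w.prof_eq_zero hr]

lemma fieldProf_le (hδ : 0 < δ) (hs1 : s < 1) (r : ℝ) :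
    fieldProf s w r ≤ scaling s w * |r| ^ (-((n : ℝ) + s + 1)) := by
  have h1 := (scaling_spec hs1 hδ (NeZero.pos n) w).1
  unfold fieldProf
  gcongr
  exact mul_le_of_le_one_right h1.le (w.prof_le_one hδ r)

lemma continuousAt_fieldProf {r : ℝ} (hr : r ≠ 0) : ContinuousAt (fieldProf s w) r := by
  unfold fieldProf
  have := w.contDiff_prof.continuous
  refine ContinuousAt.mul (by fun_prop) ?_
  exact (continuous_abs.continuousAt).rpow_const (Or.inl (abs_ne_zero.2 hr))

lemma measurable_fieldProf : Measurable (fieldProf s w) := by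
  have := w.contDiff_prof.continuous.measurable
  unfold fieldProf
  fun_prop

lemma fieldProfCut_nonneg (hδ : 0 < δ) (hs1 : s < 1) (j : ℕ) (r : ℝ) :
    0 ≤ fieldProfCut s w j r :=
  mul_nonneg (fieldProf_nonneg hδ hs1 r) (sub_nonneg.2 (w.prof_le_one hδ _))

lemma fieldProfCut_le (hδ : 0 < δ) (hs1 : s < 1) (j : ℕ) (r : ℝ) :
    fieldProfCut s w j r ≤ fieldProf s w r :=
  mul_le_of_le_one_right (fieldProf_nonneg hδ hs1 r) (by linarith [w.prof_nonneg ((j + 1) * r)])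

lemma fieldProfCut_eventually_zero (hδ : 0 < δ) (j : ℕ) :
    ∀ᶠ r in 𝓝 0, fieldProfCut s w j r = 0 := by
  obtain ⟨m, hm0, hm⟩ := w.exists_prof_eq_one hδ
  have hc : Continuous fun r : ℝ => |(j + 1) * r| := by fun_prop
  have := (hc.tendsto 0).eventually (gt_mem_nhds (by simpa using hm0))
  filter_upwards [this] with r hr
  simp [fieldProfCut, hm _ hr]

lemma continuous_fieldProfCut (hδ : 0 < δ) (j : ℕ) : Continuous (fieldProfCut s w j) := by
  refine continuous_iff_continuousAt.2 fun r => ?_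
  rcases eq_or_ne r 0 with rfl | hr
  · exact (continuousAt_const (y := (0 : ℝ))).congr
      ((fieldProfCut_eventually_zero hδ j).mono fun r hr => hr.symm)
  · have := w.contDiff_prof.continuous
    unfold fieldProfCut
    exact (continuousAt_fieldProf hr).mul (by fun_prop)

lemma tendsto_fieldProfCut {r : ℝ} (hr : r ≠ 0) :
    Tendsto (fun j => fieldProfCut s w j r) atTop (𝓝 (fieldProf s w r)) := by
  refine tendsto_const_nhds.congr' ?_
  -- Once (j+1)|r| ≥ δ the truncation factor equals 1, so the sequence is eventually constant.
  obtain ⟨N, hN⟩ := exists_nat_ge (δ / |r|)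
  filter_upwards [eventually_ge_atTop N] with j hj
  have h1 : δ ≤ |((j : ℝ) + 1) * r| := by
    rw [abs_mul, abs_of_pos (by positivity)]
    rw [div_le_iff₀ (abs_pos.2 hr)] at hN
    have : (N : ℝ) ≤ j := by exact_mod_cast hj
    nlinarith [abs_nonneg r]
  simp [fieldProfCut, w.prof_eq_zero h1]

lemma potential_eq_zero {x : Rn n} (hx : δ ≤ ‖x‖) : potential s w x = 0 := by
  unfold potential
  rw [intervalIntegral.integral_symm, neg_eq_zero]
  refine intervalIntegral.integral_zero_ae (Eventually.of_forall fun r hr => ?_)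
  rw [Set.uIoc_of_le hx] at hr
  rw [fieldProf_eq_zero (hr.1.le.trans (le_abs_self r)), zero_mul]

lemma potentialCut_eq_zero {j : ℕ} {x : Rn n} (hx : δ ≤ ‖x‖) : potentialCut s w j x = 0 := by
  unfold potentialCut
  rw [intervalIntegral.integral_symm, neg_eq_zero]
  refine intervalIntegral.integral_zero_ae (Eventually.of_forall fun r hr => ?_)
  rw [Set.uIoc_of_le hx] at hr
  rw [fieldProfCut, fieldProf_eq_zero (hr.1.le.trans (le_abs_self r)), zero_mul, zero_mul]

lemma intervalIntegrable_fieldProf {x : Rn n} (hx : x ≠ 0) (hδ : 0 < δ) :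
    IntervalIntegrable (fun r => fieldProf s w r * r) volume ‖x‖ δ := by
  refine ContinuousOn.intervalIntegrable fun r hr => ?_
  have h0 : 0 < ‖x‖ := norm_pos_iff.2 hx
  have : 0 < r := lt_of_lt_of_le (lt_min h0 hδ) hr.1
  exact ((continuousAt_fieldProf this.ne').mul continuousAt_id).continuousWithinAt

/-- Since 0 ≤ w ≤ 1, the profile is dominated by a pure power, which is integrated from ‖x‖ to
infinity. As s < 1, the resulting singularity has order below n, which gives `integrable_potential`.
-/
lemma potential_bounds (hs : 0 < s) (hδ : 0 < δ) (hs1 : s < 1) {x : Rn n} (hx : x ≠ 0) :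
    0 ≤ potential s w x ∧ (∀ j, |potentialCut s w j x| ≤ potential s w x) ∧
      potential s w x ≤
        scaling s w / ((n : ℝ) + s - 1) * ‖x‖ ^ (-((n : ℝ) + s - 1)) := by
  have hn : (1 : ℝ) ≤ n := by exact_mod_cast NeZero.one_le
  have hc := (scaling_spec hs1 hδ (NeZero.pos n) w).1
  have h0 : 0 < ‖x‖ := norm_pos_iff.2 hx
  have hR : 0 ≤ scaling s w / ((n : ℝ) + s - 1) * ‖x‖ ^ (-((n : ℝ) + s - 1)) :=
    mul_nonneg (div_nonneg hc.le (by linarith)) (by positivity)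
  rcases le_or_gt δ ‖x‖ with h | h
  · rw [potential_eq_zero h]
    exact ⟨le_rfl, fun j => by rw [potentialCut_eq_zero h, abs_zero], hR⟩
  have hi := intervalIntegrable_fieldProf (s := s) (w := w) hx hδ
  refine ⟨intervalIntegral.integral_nonneg h.le fun r hr =>
    mul_nonneg (fieldProf_nonneg hδ hs1 r) (h0.le.trans hr.1), fun j => ?_, ?_⟩
  · refine intervalIntegral.norm_integral_le_of_norm_le (f := fun r => fieldProfCut s w j r * r)
      h.le (Eventually.of_forall fun r hr => ?_) hi
    have hr0 : 0 < r := h0.trans hr.1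
    rw [norm_mul, Real.norm_of_nonneg (fieldProfCut_nonneg hδ hs1 j r),
      Real.norm_of_nonneg hr0.le]
    exact mul_le_mul_of_nonneg_right (fieldProfCut_le hδ hs1 j r) hr0.le
  · have hlt : -((n : ℝ) + s) < -1 := by linarith
    have hI := integrableOn_Ioi_rpow_of_lt hlt h0
    have e := integral_Ioi_rpow_of_lt hlt h0
    have e2 : scaling s w / ((n : ℝ) + s - 1) * ‖x‖ ^ (-((n : ℝ) + s - 1)) =
        scaling s w * ∫ r in Set.Ioi ‖x‖, r ^ (-((n : ℝ) + s)) := by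
      rw [e, show -((n : ℝ) + s) + 1 = -((n : ℝ) + s - 1) by ring, neg_div_neg_eq]
      ring
    rw [e2, ← integral_const_mul]
    unfold potential
    rw [intervalIntegral.integral_of_le h.le]
    have hI2 : IntegrableOn (fun r => scaling s w * r ^ (-((n : ℝ) + s))) (Set.Ioi ‖x‖) :=
      hI.const_mul _
    refine (setIntegral_mono_on ((intervalIntegrable_iff_integrableOn_Ioc_of_le h.le).1 hi)
      (hI2.mono_set Set.Ioc_subset_Ioi_self) measurableSet_Ioc fun r hr => ?_).trans
      (setIntegral_mono_set hI2 ?_ (Eventually.of_forall Set.Ioc_subset_Ioi_self))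
    · have hr0 : 0 < r := h0.trans hr.1
      have e3 : r ^ (-((n : ℝ) + s)) = |r| ^ (-((n : ℝ) + s + 1)) * r := by
        rw [abs_of_pos hr0]
        nth_rewrite 3 [← Real.rpow_one r]
        rw [← Real.rpow_add hr0]; congr 1; ring
      rw [e3, ← mul_assoc]
      exact mul_le_mul_of_nonneg_right (fieldProf_le hδ hs1 r) hr0.le
    · filter_upwards [ae_restrict_mem measurableSet_Ioi] with r hr
      have hr0 : 0 < r := h0.trans hr
      simp only [Pi.zero_apply]
      positivity

lemma tendsto_potentialCut (hδ : 0 < δ) (hs1 : s < 1) {x : Rn n} (hx : x ≠ 0) :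
    Tendsto (fun j => potentialCut s w j x) atTop (𝓝 (potential s w x)) := by
  have h0 : 0 < ‖x‖ := norm_pos_iff.2 hx
  refine intervalIntegral.tendsto_integral_filter_of_dominated_convergence
    (fun r => |fieldProf s w r * r|) (Eventually.of_forall fun j =>
      ((continuous_fieldProfCut hδ j).mul continuous_id).aestronglyMeasurable)
    (Eventually.of_forall fun j => Eventually.of_forall fun r _ => ?_)
    (intervalIntegrable_fieldProf hx hδ).abs
    (Eventually.of_forall fun r hr => ?_)
  · rw [norm_mul, abs_mul, Real.norm_of_nonneg (fieldProfCut_nonneg hδ hs1 j r),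
      Real.norm_eq_abs]
    gcongr
    exact (fieldProfCut_le hδ hs1 j r).trans (le_abs_self _)
  · have : 0 < r := lt_of_lt_of_le' hr.1 (lt_min h0 hδ).le
    exact (tendsto_fieldProfCut this.ne').mul_const r

/-- Away from 0 this is the chain rule for the norm; near 0 the truncated profile vanishes and the
function is locally constant. -/
lemma hasFDerivAt_potentialCut (hδ : 0 < δ) (j : ℕ) (x : Rn n) :
    HasFDerivAt (potentialCut s w j) (-fieldProfCut s w j ‖x‖ • innerSL ℝ x) x := by
  have hc : Continuous fun r => fieldProfCut s w j r * r :=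
    (continuous_fieldProfCut hδ j).mul continuous_id
  have hg : ∀ r, HasDerivAt (fun r => ∫ r in r..δ, fieldProfCut s w j r * r)
      (-(fieldProfCut s w j r * r)) r := fun r =>
    intervalIntegral.integral_hasDerivAt_left (hc.intervalIntegrable _ _)
      (hc.stronglyMeasurableAtFilter _ _) hc.continuousAt
  rcases eq_or_ne x 0 with rfl | hx
  · have h1 : HasFDerivAt (fun _ : Rn n => potentialCut s w j 0) (0 : Rn n →L[ℝ] ℝ) 0 :=
      hasFDerivAt_const _ _
    have h2 := h1.congr_of_eventuallyEq (f₁ := potentialCut s w j) ?_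
    · simpa using h2
    obtain ⟨ε, hε, hz⟩ := Metric.eventually_nhds_iff.1
      (fieldProfCut_eventually_zero (s := s) (w := w) hδ j)
    filter_upwards [Metric.ball_mem_nhds 0 hε] with y hy
    have hy' : ‖y‖ < ε := by simpa using hy
    unfold potentialCut
    rw [← intervalIntegral.integral_add_adjacent_intervals (b := ‖(0 : Rn n)‖)
      (hc.intervalIntegrable _ _) (hc.intervalIntegrable _ _), norm_zero, add_eq_right]
    refine intervalIntegral.integral_zero_ae (Eventually.of_forall fun r hr => ?_)
    rw [Set.uIoc_of_ge (norm_nonneg y)] at hr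
    rw [hz (by simpa [abs_of_pos hr.1] using hr.2.trans_lt hy'), zero_mul]
  · have h0 : ‖x‖ ≠ 0 := norm_ne_zero_iff.2 hx
    have hnorm := (hasStrictFDerivAt_norm_sq x).hasFDerivAt.sqrt (pow_ne_zero 2 h0)
    simp only [Real.sqrt_sq (norm_nonneg _)] at hnorm
    have h1 := (hg ‖x‖).comp_hasFDerivAt x hnorm
    refine h1.congr_fderiv ?_
    ext y
    simp
    field_simp

lemma pd_potentialCut (hδ : 0 < δ) (j : ℕ) (i : Fin n) (x : Rn n) :
    pd i (potentialCut s w j) x = -(fieldProfCut s w j ‖x‖ * x i) := by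
  unfold pd
  rw [(hasFDerivAt_potentialCut hδ j x).fderiv]
  simp [EuclideanSpace.inner_single_right]

lemma ae_ne_zero : ∀ᵐ x : Rn n, x ≠ 0 := by simp [ae_iff, measure_singleton]

omit [NeZero n] in
lemma integral_odd {f : Rn n → ℝ} (hf : ∀ x, f (-x) = -f x) : ∫ x, f x = 0 := by
  have h := integral_neg_eq_self f volume
  simp only [hf, integral_neg] at h
  linarith

lemma integrable_potential (hs : 0 < s) (hδ : 0 < δ) (hs1 : s < 1) :
    Integrable (potential s w) := by
  have hn : (1 : ℝ) ≤ n := by exact_mod_cast NeZero.one_le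
  have hm : AEStronglyMeasurable (potential s w) volume :=
    aestronglyMeasurable_of_tendsto_ae (u := atTop) (f := fun j => potentialCut s w j)
      (fun j => Continuous.aestronglyMeasurable
        (continuous_iff_continuousAt.2 fun x => (hasFDerivAt_potentialCut hδ j x).continuousAt))
      (ae_ne_zero.mono fun x hx => tendsto_potentialCut hδ hs1 hx)
  have hs' : Function.support (potential s w) ⊆ Metric.ball 0 δ := by
    intro x hx
    by_contra h
    exact hx (potential_eq_zero (by simpa using h))
  refine (integrableOn_iff_integrable_of_support_subset hs').1 ?_
  refine integrableOn_ball_of_norm_le_rpow (C := scaling s w / ((n : ℝ) + s - 1))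
    (α := (n : ℝ) + s - 1) (by simpa [Nat.one_le_iff_ne_zero] using NeZero.ne n)
    (by simpa using by linarith)
    (ae_restrict_of_ae (ae_ne_zero.mono fun x hx => ?_)) hm
  have h := potential_bounds (w := w) hs hδ hs1 hx
  rw [Real.norm_of_nonneg h.1]
  exact h.2.2

/-- The field is odd, so subtracting φ(0) is free. This increment makes the integrand dominated by a
multiple of the kernel and allows the truncation to be removed. -/
lemma integral_potentialCut_mul_pd (hδ : 0 < δ) (j : ℕ) {φ : Rn n → ℝ} (hφ : IsTest φ)
    (i : Fin n) : ∫ x, potentialCut s w j x * pd i φ x =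
      ∫ x, fieldProfCut s w j ‖x‖ * x i * (φ x - φ 0) := by
  have hc : Continuous (fieldProfCut s w j) := continuous_fieldProfCut hδ j
  have hc1 : Continuous fun x : Rn n => fieldProfCut s w j ‖x‖ * x i := by fun_prop
  have hC1 : ContDiff ℝ 1 (potentialCut s w j) := by
    rw [contDiff_one_iff_fderiv]
    refine ⟨fun x => (hasFDerivAt_potentialCut hδ j x).differentiableAt, ?_⟩
    have : fderiv ℝ (potentialCut s w j) = fun x => -fieldProfCut s w j ‖x‖ • innerSL ℝ x :=
      funext fun x => (hasFDerivAt_potentialCut hδ j x).fderiv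
    rw [this]
    fun_prop
  have hcs : HasCompactSupport fun x : Rn n => fieldProfCut s w j ‖x‖ * x i := by
    refine HasCompactSupport.intro (isCompact_closedBall 0 δ) fun x hx => ?_
    have : δ ≤ |‖x‖| := by simpa using (not_le.1 (by simpa using hx)).le
    simp [fieldProfCut, fieldProf_eq_zero this]
  rw [integral_mul_pd hC1 hφ i]
  simp only [pd_potentialCut hδ, neg_mul, integral_neg, neg_neg, mul_sub]
  rw [integral_sub, integral_mul_const, integral_odd (f := fun x => fieldProfCut s w j ‖x‖ * x i),
    zero_mul, sub_zero]
  · intro x; simp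
  · exact (hc1.mul hφ.continuous).integrable_of_hasCompactSupport hφ.compact.mul_left
  · exact (hc1.integrable_of_hasCompactSupport hcs).mul_const _

lemma norm_fieldProf_mul_le (hs : 0 < s) (hδ : 0 < δ) (hs1 : s < 1) {φ : Rn n → ℝ} {K : ℝ≥0}
    (hK : LipschitzWith K φ) (i : Fin n) (x : Rn n) :
    ‖fieldProf s w ‖x‖ * x i * (φ x - φ 0)‖ ≤ K * kernel s w x := by
  rw [norm_mul, norm_mul, Real.norm_of_nonneg (fieldProf_nonneg hδ hs1 _), kernel_eq hs]
  have h1 : ‖x i‖ ≤ ‖x‖ := PiLp.norm_apply_le x i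
  have h2 : ‖φ x - φ 0‖ ≤ K * ‖x‖ := by simpa using hK.norm_sub_le x 0
  have h3 := fieldProf_nonneg (w := w) hδ hs1 ‖x‖
  calc _ ≤ fieldProf s w ‖x‖ * ‖x‖ * (K * ‖x‖) := by gcongr
    _ = _ := by ring

/-- The (negative) gradient of the potential is the field `z ↦ kernel(z) z / |z|²`. -/
lemma integral_potential_mul_pd (hs : 0 < s) (hδ : 0 < δ) (hs1 : s < 1) {φ : Rn n → ℝ}
    (hφ : IsTest φ) (i : Fin n) : ∫ x, potential s w x * pd i φ x =
      ∫ x, fieldProf s w ‖x‖ * x i * (φ x - φ 0) := by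
  obtain ⟨K, hK⟩ := hφ.smooth.lipschitzWith_of_hasCompactSupport hφ.compact (by simp)
  obtain ⟨M, hM0, hM⟩ := (hφ.pd i).exists_bound
  have hcut : ∀ j, Continuous (potentialCut s w j) := fun j =>
    continuous_iff_continuousAt.2 fun x => (hasFDerivAt_potentialCut hδ j x).continuousAt
  have h1 : Tendsto (fun j => ∫ x, potentialCut s w j x * pd i φ x) atTop
      (𝓝 (∫ x, potential s w x * pd i φ x)) := by
    refine tendsto_integral_of_dominated_convergence (fun x => potential s w x * M)
      (fun j => ((hcut j).mul (hφ.pd i).continuous).aestronglyMeasurable)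
      ((integrable_potential hs hδ hs1).mul_const M) (fun j => ae_ne_zero.mono fun x hx => ?_)
      (ae_ne_zero.mono fun x hx => (tendsto_potentialCut hδ hs1 hx).mul_const _)
    have h := potential_bounds (w := w) hs hδ hs1 hx
    rw [norm_mul]
    exact mul_le_mul (h.2.1 j) (hM x) (norm_nonneg _) h.1
  have h2 : Tendsto (fun j => ∫ x, fieldProfCut s w j ‖x‖ * x i * (φ x - φ 0)) atTop
      (𝓝 (∫ x, fieldProf s w ‖x‖ * x i * (φ x - φ 0))) := by
    have hφc := hφ.continuous
    refine tendsto_integral_of_dominated_convergence (fun x => K * kernel s w x)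
      (fun j => ?_) ((integrable_kernel s w).const_mul _)
      (fun j => Eventually.of_forall fun x => ?_) (ae_ne_zero.mono fun x hx => ?_)
    · have := continuous_fieldProfCut (s := s) (w := w) hδ j
      exact Continuous.aestronglyMeasurable (by fun_prop)
    · refine le_trans ?_ (norm_fieldProf_mul_le hs hδ hs1 hK i x)
      rw [norm_mul, norm_mul, norm_mul, norm_mul,
        Real.norm_of_nonneg (fieldProf_nonneg hδ hs1 _),
        Real.norm_of_nonneg (fieldProfCut_nonneg hδ hs1 _ _)]
      gcongr
      exact fieldProfCut_le hδ hs1 j _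
    · exact ((tendsto_fieldProfCut (norm_ne_zero_iff.2 hx)).mul_const _).mul_const _
  simp only [integral_potentialCut_mul_pd hδ _ hφ] at h1
  exact tendsto_nhds_unique h1 h2

lemma integrable_fieldProf_mul (hs : 0 < s) (hδ : 0 < δ) (hs1 : s < 1) {φ : Rn n → ℝ}
    (hφ : IsTest φ) (i : Fin n) :
    Integrable fun x => fieldProf s w ‖x‖ * x i * (φ x - φ 0) := by
  obtain ⟨K, hK⟩ := hφ.smooth.lipschitzWith_of_hasCompactSupport hφ.compact (by simp)
  have hm := measurable_fieldProf (s := s) (w := w)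
  have hφc := hφ.continuous.measurable
  exact ((integrable_kernel s w).const_mul (K : ℝ)).mono'
    (Measurable.aestronglyMeasurable (by fun_prop))
    (Eventually.of_forall fun x => norm_fieldProf_mul_le hs hδ hs1 hK i x)

/-- The nonlocal divergence as a convolution of the classical divergence. -/
lemma nonlocalDiv_eq (hs : 0 < s) (hδ : 0 < δ) (hs1 : s < 1) {ψ : Rn n → Rn n}
    (hψ : ∀ i, IsTest fun x => ψ x i) (x : Rn n) :
    nonlocalDiv s w ψ x = ∑ i, ∫ z, potential s w z * pd i (fun x => ψ x i) (x - z) := by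
  have h1 : nonlocalDiv s w ψ x = ∫ z, ∑ i, fieldProf s w ‖z‖ * z i * (ψ x i - ψ (x - z) i) := by
    unfold nonlocalDiv
    rw [← integral_sub_left_eq_self _ volume x]
    refine integral_congr_ae (ae_ne_zero.mono fun z hz => ?_)
    have h0 : ‖z‖ ≠ 0 := norm_ne_zero_iff.2 hz
    simp only [sub_sub_cancel, real_inner_smul_left, real_inner_smul_right, kernel_eq hs]
    rw [PiLp.inner_apply]
    simp only [PiLp.sub_apply, RCLike.inner_apply, conj_trivial, Finset.mul_sum, Finset.sum_mul]
    refine Finset.sum_congr rfl fun i _ => ?_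
    field_simp
  have hφ : ∀ i, IsTest fun z => -ψ (x - z) i := fun i => ((hψ i).comp_sub_left x).neg
  have h2 : ∀ i, ∫ z, fieldProf s w ‖z‖ * z i * (ψ x i - ψ (x - z) i) =
      ∫ z, potential s w z * pd i (fun x => ψ x i) (x - z) := fun i => by
    have e := integral_potential_mul_pd (w := w) hs hδ hs1 (hφ i) i
    simp only [sub_zero, sub_neg_eq_add, neg_add_eq_sub] at e
    rw [← e]
    refine integral_congr_ae (Eventually.of_forall fun z => ?_)
    have e2 := pd_comp_sub_left (hψ i).neg.differentiable i x z
    have e3 : pd i (fun x => -ψ x i) (x - z) = -pd i (fun x => ψ x i) (x - z) := by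
      simp [pd, fderiv_fun_neg]
    simp only
    rw [e2, e3, neg_neg]
  rw [h1, integral_finsetSum]
  · exact Finset.sum_congr rfl fun i _ => h2 i
  · intro i _
    have e := integrable_fieldProf_mul (w := w) hs hδ hs1 (hφ i) i
    simpa only [sub_zero, sub_neg_eq_add, neg_add_eq_sub] using e

end Profile

/-! ### Comparison of the potential with the kernel of (1 - Δ)^(-a), where a = (1-s)/2 -/

section FarField

variable {n : ℕ}

lemma integrable_of_decay {f : Rn n → ℝ} (hf : Continuous f) {C r δ : ℝ} (hr : n < r) (hδ : 0 < δ)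
    (h : ∀ z, δ < ‖z‖ → |f z| ≤ C * ‖z‖ ^ (-r)) : Integrable f := by
  have h1 : IntegrableOn f (Metric.closedBall 0 δ) :=
    hf.continuousOn.integrableOn_compact (isCompact_closedBall 0 δ)
  have hi : Integrable fun z : Rn n => (1 + ‖z‖) ^ (-r) :=
    integrable_one_add_norm (by simpa using hr)
  have hr0 : 0 < r := lt_of_le_of_lt (Nat.cast_nonneg n) hr
  have h2 : IntegrableOn f (Metric.closedBall 0 δ)ᶜ := by
    refine ((hi.const_mul (|C| * (δ / (1 + δ)) ^ (-r))).integrableOn).mono'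
      hf.aestronglyMeasurable ?_
    filter_upwards [ae_restrict_mem Metric.isClosed_closedBall.measurableSet.compl] with z hz
    have hz' : δ < ‖z‖ := by simpa using hz
    have h3 : δ / (1 + δ) * (1 + ‖z‖) ≤ ‖z‖ := by
      rw [div_mul_eq_mul_div, div_le_iff₀ (by positivity)]
      nlinarith
    calc ‖f z‖ ≤ C * ‖z‖ ^ (-r) := h z hz'
      _ ≤ |C| * ‖z‖ ^ (-r) := by gcongr; exact le_abs_self C
      _ ≤ |C| * (δ / (1 + δ) * (1 + ‖z‖)) ^ (-r) := by
          exact mul_le_mul_of_nonneg_left (Real.rpow_le_rpow_of_nonpos (by positivity) h3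
            (neg_nonpos.2 hr0.le)) (abs_nonneg C)
      _ = _ := by rw [Real.mul_rpow (by positivity) (by positivity)]; ring
  simpa using h1.union h2

variable {δ s : ℝ} {w : Cutoff n δ}

/-- The part of the field `z ↦ kernel(z) z / |z|²` away from the origin which is cut off. -/
def farField (s : ℝ) (w : Cutoff n δ) (i : Fin n) (z : Rn n) : ℝ :=
  scaling s w * (1 - w z) * ‖z‖ ^ (-((n : ℝ) + s + 1)) * z i

lemma contDiff_farField (hδ : 0 < δ) (i : Fin n) : ContDiff ℝ ∞ (farField s w i) := by
  refine contDiff_iff_contDiffAt.2 fun z => ?_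
  rcases eq_or_ne z 0 with rfl | hz
  · refine (contDiffAt_const (c := (0 : ℝ))).congr_of_eventuallyEq ?_
    obtain ⟨m, hm0, -, hm⟩ := w.eq_one
    filter_upwards [Metric.ball_mem_nhds (0 : Rn n) (by positivity : 0 < m * δ)] with x hx
    simp [farField, hm x hx]
  · have h1 : ContDiffAt ℝ ∞ w.toFun z := w.smooth.contDiffAt
    have h2 : ContDiffAt ℝ ∞ (fun z : Rn n => ‖z‖) z := contDiffAt_norm ℝ hz
    have h3 : ContDiffAt ℝ ∞ (fun z : Rn n => ‖z‖ ^ (-((n : ℝ) + s + 1))) z :=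
      h2.rpow_const_of_ne (norm_ne_zero_iff.2 hz)
    have h4 : ContDiffAt ℝ ∞ (fun z : Rn n => z i) z := by fun_prop
    exact ((contDiffAt_const.mul (contDiffAt_const.sub h1)).mul h3).mul h4

lemma farField_eq_of_lt {z : Rn n} (hz : δ < ‖z‖) (i : Fin n) :
    farField s w i z = scaling s w * ‖z‖ ^ (-((n : ℝ) + s + 1)) * z i := by
  have : w z = 0 := by
    by_contra h
    have := w.tsupport_subset (subset_tsupport _ h)
    simp at this
    linarith
  simp [farField, this]

lemma integrable_farField (hδ : 0 < δ) (hs : 0 < s) (i : Fin n) :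
    Integrable (farField s w i) := by
  refine integrable_of_decay (contDiff_farField hδ i).continuous (C := |scaling s w|)
    (r := n + s) (by linarith) hδ fun z hz => ?_
  have hz0 : 0 < ‖z‖ := hδ.trans hz
  rw [farField_eq_of_lt hz, abs_mul, abs_mul, abs_of_nonneg (Real.rpow_nonneg hz0.le _)]
  have h1 : |z i| ≤ ‖z‖ := PiLp.norm_apply_le z i
  calc _ ≤ |scaling s w| * ‖z‖ ^ (-((n : ℝ) + s + 1)) * ‖z‖ := by gcongr
    _ = |scaling s w| * (‖z‖ ^ (-((n : ℝ) + s + 1)) * ‖z‖ ^ (1 : ℝ)) := by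
        rw [Real.rpow_one]; ring
    _ = _ := by rw [← Real.rpow_add hz0]; congr 2; ring

/-- One derivative improves the decay from |z|^(-(n+s)) to |z|^(-(n+s+1)). -/
lemma integrable_pd_farField (hδ : 0 < δ) (hs : 0 < s) (i : Fin n) :
    Integrable (pd i (farField s w i)) := by
  set q : ℝ := (n : ℝ) + s + 1 with hq
  have hq0 : 0 < q := by positivity
  refine integrable_of_decay (contDiff_pd (contDiff_farField hδ i) i).continuous
    (C := |scaling s w| * (1 + q)) (r := q) (by linarith) hδ fun z hz => ?_
  have hz0 : 0 < ‖z‖ := hδ.trans hz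
  have hnorm := (hasStrictFDerivAt_norm_sq z).hasFDerivAt.sqrt (pow_ne_zero 2 hz0.ne')
  simp only [Real.sqrt_sq (norm_nonneg _)] at hnorm
  have h1 := ((hnorm.rpow_const (p := -q) (Or.inl hz0.ne')).const_mul (scaling s w)).mul
    ((EuclideanSpace.proj i : Rn n →L[ℝ] ℝ).hasFDerivAt (x := z))
  have h2 : HasFDerivAt (farField s w i) _ z := h1.congr_of_eventuallyEq (by
    filter_upwards [(isOpen_lt continuous_const continuous_norm).mem_nhds hz] with y hy
    rw [farField_eq_of_lt hy]; rfl)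
  have h3 : pd i (farField s w i) z =
      scaling s w * (‖z‖ ^ (-q) - q * ‖z‖ ^ (-q - 1) * ‖z‖⁻¹ * (z i * z i)) := by
    unfold pd
    rw [h2.fderiv]
    simp [EuclideanSpace.inner_single_right]
    field_simp
    ring
  have hzi : |z i| ≤ ‖z‖ := PiLp.norm_apply_le z i
  have h4 : z i * z i ≤ ‖z‖ * ‖z‖ := by
    rw [← abs_mul_abs_self]; gcongr
  have h5 : ‖z‖ ^ (-q - 1) * ‖z‖ = ‖z‖ ^ (-q) := by
    rw [Real.rpow_sub_one hz0.ne']; field_simp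
  rw [h3, abs_mul, mul_assoc |scaling s w|]
  refine mul_le_mul_of_nonneg_left ?_ (abs_nonneg _)
  refine le_trans (norm_sub_le (‖z‖ ^ (-q)) (q * ‖z‖ ^ (-q - 1) * ‖z‖⁻¹ * (z i * z i))) ?_
  rw [Real.norm_of_nonneg (by positivity),
    Real.norm_of_nonneg (mul_nonneg (by positivity) (mul_self_nonneg _)), add_mul 1 q, one_mul]
  refine add_le_add le_rfl ?_
  calc q * ‖z‖ ^ (-q - 1) * ‖z‖⁻¹ * (z i * z i) ≤ q * ‖z‖ ^ (-q - 1) * ‖z‖⁻¹ * (‖z‖ * ‖z‖) := by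
        gcongr
    _ = q * (‖z‖ ^ (-q - 1) * ‖z‖) := by field_simp
    _ = _ := by rw [h5]

lemma integral_farField_mul (hδ : 0 < δ) (hs : 0 < s) {Θ : Rn n → ℝ} (hΘ : IsTest Θ) (i : Fin n) :
    ∫ x, farField s w i x * (pd i Θ x - pd i Θ 0) = -∫ x, pd i (farField s w i) x * Θ x := by
  simp only [mul_sub]
  rw [integral_sub, integral_mul_const, integral_odd (f := farField s w i), zero_mul, sub_zero,
    integral_mul_pd ((contDiff_farField hδ i).of_le (by simp)) hΘ]
  · intro x
    obtain ⟨wb, -, h⟩ := w.radial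
    simp [farField, h]
  · exact ((contDiff_farField hδ i).continuous.mul
      (hΘ.pd i).continuous).integrable_of_hasCompactSupport (hΘ.pd i).compact.mul_left
  · exact (integrable_farField hδ hs i).mul_const _

/-- The normalization constant of the subordination formula `integral_gaussDeriv_time`. -/
def subordConst (n : ℕ) (s : ℝ) : ℝ :=
  1 / 2 * (4 * Real.pi) ^ (-(n / 2 : ℝ)) *
    (4 ^ (((n : ℝ) + s + 1) / 2) * Real.Gamma (((n : ℝ) + s + 1) / 2))

lemma subordConst_pos (hs : 0 < s) : 0 < subordConst n s := by
  have := Real.Gamma_pos_of_pos (by positivity : 0 < ((n : ℝ) + s + 1) / 2)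
  unfold subordConst
  positivity

/-- The substitution t ↦ 1/t leads to a Gamma integral. -/
lemma integral_rpow_mul_exp_neg_div {β r : ℝ} (hβ : 0 < β) (hr : 0 < r) :
    IntegrableOn (fun t : ℝ => t ^ (-β - 1) * Real.exp (-(r / t))) (Set.Ioi 0) ∧
    ∫ t in Set.Ioi (0 : ℝ), t ^ (-β - 1) * Real.exp (-(r / t)) = (1 / r) ^ β * Real.Gamma β := by
  have h := integral_comp_rpow_Ioi (fun y => y ^ (β - 1) * Real.exp (-(r * y)))
    (p := -1) (by norm_num)
  rw [Real.integral_rpow_mul_exp_neg_mul_Ioi hβ hr] at h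
  have e : ∫ t in Set.Ioi (0 : ℝ), t ^ (-β - 1) * Real.exp (-(r / t)) =
      (1 / r) ^ β * Real.Gamma β := by
    rw [← h]
    refine setIntegral_congr_fun measurableSet_Ioi fun t ht => ?_
    have ht0 : (0 : ℝ) < t := ht
    simp only [smul_eq_mul]
    rw [Real.rpow_neg_one, Real.inv_rpow ht0.le, ← Real.rpow_neg ht0.le, abs_neg, abs_one,
      one_mul, ← mul_assoc, ← Real.rpow_add ht0, div_eq_mul_inv]
    ring_nf
  refine ⟨?_, e⟩
  -- Integrability is read off from the value: the integral of a non-integrable function is 0 by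
  -- convention, while the value found is positive.
  by_contra hn
  rw [integral_undef hn] at e
  have := Real.Gamma_pos_of_pos hβ
  have : 0 < (1 / r) ^ β * Real.Gamma β := by positivity
  linarith

/-- The weight t^((1-s)/2-1) is that of the Riesz potential of order 1-s. Its gradient is
homogeneous of degree -(n+s), as is the untruncated field z |z|^(-(n+s+1)). -/
lemma integral_gaussDeriv_time (hs : 0 < s) {z : Rn n} (hz : z ≠ 0) (i : Fin n) :
    IntegrableOn (fun t => t ^ ((1 - s) / 2 - 1) * gaussDeriv i t z) (Set.Ioi 0) ∧
    ∫ t in Set.Ioi (0 : ℝ), t ^ ((1 - s) / 2 - 1) * gaussDeriv i t z =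
      -(subordConst n s * ‖z‖ ^ (-((n : ℝ) + s + 1)) * z i) := by
  have hz0 : 0 < ‖z‖ := norm_pos_iff.2 hz
  obtain ⟨h1, h2⟩ := integral_rpow_mul_exp_neg_div (β := ((n : ℝ) + s + 1) / 2)
    (r := ‖z‖ ^ 2 / 4) (by positivity) (by positivity)
  have e : ∀ t ∈ Set.Ioi (0 : ℝ), t ^ ((1 - s) / 2 - 1) * gaussDeriv i t z =
      -(z i * (1 / 2 * (4 * Real.pi) ^ (-(n / 2 : ℝ)))) *
        (t ^ (-(((n : ℝ) + s + 1) / 2) - 1) * Real.exp (-(‖z‖ ^ 2 / 4 / t))) := by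
    intro t ht
    have ht0 : (0 : ℝ) < t := ht
    unfold gaussDeriv gauss
    have e1 : t ^ (-(((n : ℝ) + s + 1) / 2) - 1) =
        t ^ ((1 - s) / 2 - 1) * (t⁻¹ * t ^ (-(n / 2 : ℝ))) := by
      rw [← Real.rpow_neg_one, ← Real.rpow_add ht0, ← Real.rpow_add ht0]
      congr 1; ring
    rw [e1, Real.mul_rpow (by positivity) ht0.le, div_div]
    field_simp
  refine ⟨IntegrableOn.congr_fun (h1.const_mul _) (fun t ht => (e t ht).symm) measurableSet_Ioi, ?_⟩
  rw [setIntegral_congr_fun measurableSet_Ioi e, integral_const_mul, h2]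
  have e2 : (1 / (‖z‖ ^ 2 / 4)) ^ (((n : ℝ) + s + 1) / 2) =
      4 ^ (((n : ℝ) + s + 1) / 2) * ‖z‖ ^ (-((n : ℝ) + s + 1)) := by
    rw [one_div_div, Real.div_rpow (by norm_num) (by positivity), ← Real.rpow_natCast,
      ← Real.rpow_mul hz0.le, Real.rpow_neg hz0.le, div_eq_mul_inv]
    congr 3; push_cast; ring
  rw [e2, subordConst]
  ring

variable [NeZero n]

lemma fieldProf_mul_eq (x : Rn n) (i : Fin n) : fieldProf s w ‖x‖ * x i =
    scaling s w * ‖x‖ ^ (-((n : ℝ) + s + 1)) * x i - farField s w i x := by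
  unfold fieldProf farField
  rw [← w.eq_prof, abs_norm]; ring

/-- The singular part of the field, tested against the increments of a test function. -/
lemma integral_rieszField_mul (hs : 0 < s) (hδ : 0 < δ) (hs1 : s < 1) {θ : Rn n → ℝ}
    (hθ : IsTest θ) (i : Fin n) :
    IntegrableOn (fun t => t ^ ((1 - s) / 2 - 1) * ∫ x, gauss n t x * pd i θ x) (Set.Ioi 0) ∧
    Integrable (fun x : Rn n =>
      scaling s w * ‖x‖ ^ (-((n : ℝ) + s + 1)) * x i * (θ x - θ 0)) ∧
    ∫ x : Rn n, scaling s w * ‖x‖ ^ (-((n : ℝ) + s + 1)) * x i * (θ x - θ 0) =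
      scaling s w / subordConst n s *
        ∫ t in Set.Ioi (0 : ℝ), t ^ ((1 - s) / 2 - 1) * ∫ x, gauss n t x * pd i θ x := by
  set a := (1 - s) / 2 with ha
  have hc := (scaling_spec hs1 hδ (NeZero.pos n) w).1
  have hS := subordConst_pos (n := n) hs
  have hI : Integrable (fun x : Rn n =>
      scaling s w * ‖x‖ ^ (-((n : ℝ) + s + 1)) * x i * (θ x - θ 0)) := by
    obtain ⟨M, hM0, hM⟩ := hθ.exists_bound
    have h1 := integrable_fieldProf_mul (w := w) hs hδ hs1 hθ i
    have h2 : Integrable fun x => farField s w i x * (θ x - θ 0) :=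
      (integrable_farField hδ hs i).mul_bdd (c := M + M)
        (hθ.continuous.sub continuous_const).aestronglyMeasurable
        (Eventually.of_forall fun x => (norm_sub_le _ _).trans (add_le_add (hM x) (hM 0)))
    refine (h1.add h2).congr (Eventually.of_forall fun x => ?_)
    simp only [Pi.add_apply, fieldProf_mul_eq]
    ring
  let f : Rn n → ℝ → ℝ := fun x t => t ^ (a - 1) * gaussDeriv i t x * (θ x - θ 0)
  have hθm := hθ.continuous.measurable
  have hfm : Measurable (Function.uncurry f) := by
    unfold f gaussDeriv gauss Function.uncurry
    fun_prop
  have hsign : ∀ x : Rn n, ∀ t ∈ Set.Ioi (0 : ℝ),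
      ‖f x t‖ = ‖x i‖ * (t ^ (a - 1) * (1 / (2 * t) * gauss n t x)) * ‖θ x - θ 0‖ := by
    intro x t ht
    have ht0 : (0 : ℝ) < t := ht
    have hg := gauss_pos ht0 x
    simp only [f, gaussDeriv, norm_mul, norm_neg, norm_div]
    rw [Real.norm_of_nonneg hg.le, Real.norm_of_nonneg (by positivity : 0 ≤ t ^ (a - 1)),
      Real.norm_of_nonneg ht0.le, Real.norm_two]
    ring
  have hnorm : ∀ x : Rn n, x ≠ 0 → ∫ t in Set.Ioi (0 : ℝ), ‖f x t‖ =
      subordConst n s * ‖x‖ ^ (-((n : ℝ) + s + 1)) * ‖x i‖ * ‖θ x - θ 0‖ := by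
    intro x hx
    have e := (integral_gaussDeriv_time (s := s) hs hx i).2
    rcases eq_or_ne (x i) 0 with h0 | h0
    · rw [setIntegral_congr_fun measurableSet_Ioi (hsign x)]
      simp [h0]
    -- For fixed x the sign of `gaussDeriv` does not depend on t, so the absolute integral follows
    -- from the signed one after division by `x i`.
    · have e2 : ∀ t ∈ Set.Ioi (0 : ℝ), t ^ (a - 1) * gaussDeriv i t x =
          -x i * (t ^ (a - 1) * (1 / (2 * t) * gauss n t x)) := fun t _ => by
        unfold gaussDeriv; ring
      rw [setIntegral_congr_fun measurableSet_Ioi e2, integral_const_mul] at e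
      rw [setIntegral_congr_fun measurableSet_Ioi (hsign x), integral_mul_const,
        integral_const_mul]
      have e3 : ∫ t in Set.Ioi (0 : ℝ), t ^ (a - 1) * (1 / (2 * t) * gauss n t x) =
          subordConst n s * ‖x‖ ^ (-((n : ℝ) + s + 1)) := by
        have : x i * (∫ t in Set.Ioi (0 : ℝ), t ^ (a - 1) * (1 / (2 * t) * gauss n t x)) =
          x i * (subordConst n s * ‖x‖ ^ (-((n : ℝ) + s + 1))) := by linarith
        exact mul_left_cancel₀ h0 this
      rw [e3]; ring
  have hF : Integrable (Function.uncurry f) (volume.prod (volume.restrict (Set.Ioi 0))) := by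
    refine (integrable_prod_iff hfm.aestronglyMeasurable).2 ⟨?_, ?_⟩
    · filter_upwards [ae_ne_zero] with x hx
      have := (integral_gaussDeriv_time (s := s) hs hx i).1.mul_const (θ x - θ 0)
      exact this
    · refine (hI.norm.const_mul (subordConst n s / scaling s w)).congr ?_
      filter_upwards [ae_ne_zero] with x hx
      simp only [Function.uncurry_apply_pair]
      rw [hnorm x hx, norm_mul, norm_mul, norm_mul, Real.norm_of_nonneg hc.le,
        Real.norm_of_nonneg (Real.rpow_nonneg (norm_nonneg x) _)]
      field_simp
  have hgint : ∀ t ∈ Set.Ioi (0 : ℝ), ∫ x, f x t =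
      -(t ^ (a - 1) * ∫ x, gauss n t x * pd i θ x) := by
    intro t ht
    simp only [f, mul_assoc]
    rw [integral_const_mul, integral_gauss_mul_pd hθ]
    simp only [mul_sub]
    rw [integral_sub, integral_mul_const, integral_odd (f := gaussDeriv i t)]
    · ring
    · intro x; simp [gaussDeriv, gauss, neg_div]
    · exact ((contDiff_gaussDeriv i t).continuous.mul
        hθ.continuous).integrable_of_hasCompactSupport hθ.compact.mul_left
    · exact ((heatFamily_gaussDeriv i).integrable ht).mul_const _
  have hT := hF.integral_prod_right
  simp only [Function.uncurry_apply_pair] at hT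
  refine ⟨?_, hI, ?_⟩
  · refine IntegrableOn.congr_fun (f := fun t => -∫ x, f x t) hT.neg (fun t ht => ?_)
      measurableSet_Ioi
    simp only
    rw [hgint t ht, neg_neg]
  · have e1 : ∫ x, ∫ t in Set.Ioi (0 : ℝ), f x t = ∫ t in Set.Ioi (0 : ℝ), ∫ x, f x t :=
      integral_integral_swap hF
    rw [setIntegral_congr_fun measurableSet_Ioi hgint, integral_neg] at e1
    have e2 : ∀ᵐ x : Rn n, ∫ t in Set.Ioi (0 : ℝ), f x t = -(subordConst n s / scaling s w) *
        (scaling s w * ‖x‖ ^ (-((n : ℝ) + s + 1)) * x i * (θ x - θ 0)) := by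
      filter_upwards [ae_ne_zero] with x hx
      simp only [f]
      rw [integral_mul_const, (integral_gaussDeriv_time (s := s) hs hx i).2]
      field_simp
    rw [integral_congr_ae e2, integral_const_mul] at e1
    rw [div_mul_eq_mul_div, eq_div_iff hS.ne']
    field_simp at e1
    linarith

/-- The factor t^(-1) is the cost of the Laplacian of the heat kernel. Near 0 it is absorbed by 1 -
e^(-t) ≤ t; at infinity t^(a-2) remains. -/
lemma integrableOn_rpow_mul_one_sub_exp {a : ℝ} (ha0 : 0 < a) (ha1 : a < 1) :
    IntegrableOn (fun t : ℝ => t ^ (a - 1) * (1 - Real.exp (-t)) * t ^ (-1 : ℝ)) (Set.Ioi 0) := by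
  have hc : ContinuousOn (fun t : ℝ => t ^ (a - 1) * (1 - Real.exp (-t)) * t ^ (-1 : ℝ))
      (Set.Ioi 0) := fun t ht => by
    have h1 := Real.continuousAt_rpow_const t (a - 1) (Or.inl (ne_of_gt ht))
    have h2 := Real.continuousAt_rpow_const t (-1) (Or.inl (ne_of_gt ht))
    have h3 : ContinuousAt (fun t : ℝ => 1 - Real.exp (-t)) t := by fun_prop
    exact ((h1.mul h3).mul h2).continuousWithinAt
  rw [← Set.Ioc_union_Ioi_eq_Ioi zero_le_one]
  have hb : ∀ t : ℝ, 0 < t → 0 ≤ 1 - Real.exp (-t) := fun t ht => by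
    have : Real.exp (-t) ≤ 1 := Real.exp_le_one_iff.2 (by linarith)
    linarith
  refine IntegrableOn.union ?_ ?_
  · have h1 : IntegrableOn (fun t : ℝ => t ^ (a - 1)) (Set.Ioc 0 1) :=
      (intervalIntegrable_iff_integrableOn_Ioc_of_le zero_le_one).1
        (intervalIntegral.intervalIntegrable_rpow' (by linarith))
    refine h1.mono' ((hc.mono fun t ht => ht.1).aestronglyMeasurable measurableSet_Ioc) ?_
    filter_upwards [ae_restrict_mem measurableSet_Ioc] with t ht
    have ht0 : 0 < t := ht.1
    have := hb t ht0
    rw [Real.norm_of_nonneg (by positivity), Real.rpow_neg_one, mul_assoc]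
    refine mul_le_of_le_one_right (by positivity) ?_
    rw [← div_eq_mul_inv, div_le_one ht0]
    linarith [Real.one_sub_le_exp_neg t]
  · have h1 : IntegrableOn (fun t : ℝ => t ^ (a - 2)) (Set.Ioi 1) :=
      integrableOn_Ioi_rpow_of_lt (by linarith) one_pos
    refine h1.mono' ((hc.mono (Set.Ioi_subset_Ioi zero_le_one)).aestronglyMeasurable
      measurableSet_Ioi) ?_
    filter_upwards [ae_restrict_mem measurableSet_Ioi] with t ht
    have ht0 : (0 : ℝ) < t := one_pos.trans ht
    have := hb t ht0
    rw [Real.norm_of_nonneg (by positivity)]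
    calc _ ≤ t ^ (a - 1) * 1 * t ^ (-1 : ℝ) := by
          gcongr; linarith [Real.exp_pos (-t)]
      _ = _ := by rw [mul_one, ← Real.rpow_add ht0]; congr 1; ring

/-- The regular part of the Laplacian of the potential. -/
def potentialRemainder (s : ℝ) (w : Cutoff n δ) : LpFull n 1 :=
  (scaling s w / subordConst n s) •
    subord (fun t => t ^ ((1 - s) / 2 - 1) * (1 - Real.exp (-t))) (gaussLap n) +
  ∑ i, toLOne (pd i (farField s w i))

/-- The field of the potential is the Riesz field minus the far field. In the time integral for the
Riesz field, 1 is split into e^(-t) and 1 - e^(-t): the first part gives `besselJ`, the second has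
an integrable Laplacian. The far field is smooth and contributes its integrable divergence. -/
lemma integral_potential_mul_lap (hs : 0 < s) (hδ : 0 < δ) (hs1 : s < 1) {Θ : Rn n → ℝ}
    (hΘ : IsTest Θ) : ∫ x, potential s w x * lap Θ x =
      scaling s w / subordConst n s * (∫ x, besselJ n ((1 - s) / 2) x * lap Θ x) +
        ∫ x, potentialRemainder s w x * Θ x := by
  set a := (1 - s) / 2 with ha
  have ha0 : 0 < a := by simp only [ha]; linarith
  have ha1 : a < 1 := by simp only [ha]; linarith
  have h1 : ∀ i : Fin n, ∫ x, potential s w x * pd i (pd i Θ) x =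
      scaling s w / subordConst n s *
        (∫ t in Set.Ioi (0 : ℝ), t ^ (a - 1) * ∫ x, gauss n t x * pd i (pd i Θ) x) +
      ∫ x, pd i (farField s w i) x * Θ x := by
    intro i
    obtain ⟨-, hI, he⟩ := integral_rieszField_mul (w := w) hs hδ hs1 (hΘ.pd i) i
    rw [integral_potential_mul_pd hs hδ hs1 (hΘ.pd i) i, ← he, ← sub_neg_eq_add,
      ← integral_farField_mul hδ hs hΘ i, ← integral_sub hI]
    · refine integral_congr_ae (Eventually.of_forall fun x => ?_)
      simp only [fieldProf_mul_eq]; ring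
    · refine (hI.sub (integrable_fieldProf_mul (w := w) hs hδ hs1 (hΘ.pd i) i)).congr
        (Eventually.of_forall fun x => ?_)
      simp only [Pi.sub_apply, fieldProf_mul_eq]; ring
  have hintP : ∀ {φ : Rn n → ℝ}, IsTest φ → Integrable fun x => potential s w x * φ x :=
    fun {φ} hφ => by
      obtain ⟨M, -, hM⟩ := hφ.exists_bound
      exact (integrable_potential hs hδ hs1).mul_bdd hφ.continuous.aestronglyMeasurable
        (Eventually.of_forall hM)
  have hintG : ∀ (t : ℝ) {φ : Rn n → ℝ}, IsTest φ → Integrable fun x => gauss n t x * φ x :=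
    fun t φ hφ => ((contDiff_gauss t).continuous.mul
      hφ.continuous).integrable_of_hasCompactSupport hφ.compact.mul_left
  have hm1 := continuousOn_rpow_mul_exp_neg (a - 1)
  have hi1 : IntegrableOn (fun t : ℝ => t ^ (a - 1) * Real.exp (-t) * t ^ (-0 : ℝ)) (Set.Ioi 0) :=
    integrableOn_rpow_mul_exp_neg_mul (by linarith)
  have hm2 : ContinuousOn (fun t : ℝ => t ^ (a - 1) * (1 - Real.exp (-t))) (Set.Ioi 0) :=
    ContinuousOn.mul (fun t ht => (Real.continuousAt_rpow_const t _
      (Or.inl (ne_of_gt ht))).continuousWithinAt) (by fun_prop)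
  have hi2 := integrableOn_rpow_mul_one_sub_exp ha0 ha1
  have eL : ∫ x, potential s w x * lap Θ x = ∑ i, ∫ x, potential s w x * pd i (pd i Θ) x := by
    rw [← integral_finsetSum _ fun i _ => hintP ((hΘ.pd i).pd i)]
    simp only [lap, Finset.mul_sum]
  have eT : ∑ i : Fin n, (∫ t in Set.Ioi (0 : ℝ),
      t ^ (a - 1) * ∫ x, gauss n t x * pd i (pd i Θ) x) =
      ∫ t in Set.Ioi (0 : ℝ), t ^ (a - 1) * ∫ x, gauss n t x * lap Θ x := by
    rw [← integral_finsetSum _ fun i _ =>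
      (integral_rieszField_mul (w := w) hs hδ hs1 (hΘ.pd i) i).1]
    refine setIntegral_congr_fun measurableSet_Ioi fun t _ => ?_
    simp only [lap, Finset.mul_sum]
    rw [integral_finsetSum _ fun i _ => hintG t ((hΘ.pd i).pd i), Finset.mul_sum]
  have hJ := heatFamily_gauss.integral_subord_mul hm1 hi1 hΘ.lap.allMemLp
  have hR := (heatFamily_gaussLap (n := n)).integral_subord_mul hm2 hi2 hΘ.allMemLp
  have eS : ∫ t in Set.Ioi (0 : ℝ), t ^ (a - 1) * ∫ x, gauss n t x * lap Θ x =
      (∫ x, besselJ n a x * lap Θ x) +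
      ∫ x, subord (fun t => t ^ (a - 1) * (1 - Real.exp (-t))) (gaussLap n) x * Θ x := by
    rw [besselJ, hJ, hR, ← integral_add]
    · refine setIntegral_congr_fun measurableSet_Ioi fun t ht => ?_
      rw [← integral_gauss_mul_lap hΘ ht]; ring
    · have := (pairing 1 hΘ.lap.allMemLp).integrable_comp (heatFamily_gauss.integrableOn hm1 hi1)
      refine IntegrableOn.congr_fun this (fun t ht => ?_) measurableSet_Ioi
      rw [map_smul, smul_eq_mul]
      rw [pairing_apply, integral_toLOne_mul (integrable_gauss ht)]
    · have := (pairing 1 hΘ.allMemLp).integrable_comp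
        ((heatFamily_gaussLap (n := n)).integrableOn hm2 hi2)
      refine IntegrableOn.congr_fun this (fun t ht => ?_) measurableSet_Ioi
      rw [map_smul, smul_eq_mul]
      rw [pairing_apply, integral_toLOne_mul (heatFamily_gaussLap.integrable ht)]
  have eR : ∫ x, potentialRemainder s w x * Θ x = scaling s w / subordConst n s *
      (∫ x, subord (fun t => t ^ (a - 1) * (1 - Real.exp (-t))) (gaussLap n) x * Θ x) +
      ∑ i, ∫ x, pd i (farField s w i) x * Θ x := by
    rw [← pairing_apply hΘ.allMemLp, ← pairing_apply hΘ.allMemLp, potentialRemainder, map_add,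
      map_smul, map_sum, smul_eq_mul]
    simp only [pairing_apply, integral_toLOne_mul (integrable_pd_farField hδ hs _), ← ha]
  rw [eL, Finset.sum_congr rfl fun i _ => h1 i, Finset.sum_add_distrib, ← Finset.mul_sum, eT, eS,
    eR]
  ring

/-- The `L¹` remainder in the factorization `conv_potential_besselB`. -/
def factorRemainder (s : ℝ) (w : Cutoff n δ) : LpFull n 1 :=
  toLOne (potential s w) - (scaling s w / subordConst n s) • besselJ n ((1 - s) / 2) -
    potentialRemainder s w

/-- `integral_potential_mul_lap` treats the Laplacian. The terms of order zero, in which the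
potential and `besselJ` act on φ itself, are L¹ kernels and are collected in `factorRemainder`. -/
lemma conv_potential (hs : 0 < s) (hδ : 0 < δ) (hs1 : s < 1) {φ : Rn n → ℝ} (hφ : IsTest φ) :
    conv 1 (toLOne (potential s w)) (toLOne fun x => φ x - lap φ x) =
      (scaling s w / subordConst n s) •
        conv 1 (besselJ n ((1 - s) / 2)) (toLOne fun x => φ x - lap φ x) +
      conv 1 (factorRemainder s w) (toLOne φ) := by
  have hL := hφ.sub hφ.lap
  have h1 := conv_toLOne_ae_eq (toLOne (potential s w)) hL.integrable
  have h2 := conv_toLOne_ae_eq (besselJ n ((1 - s) / 2)) hL.integrable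
  have h3 := conv_toLOne_ae_eq (factorRemainder s w) hφ.integrable
  refine Lp.ext ?_
  filter_upwards [h1, h2, h3, Lp.coeFn_add ((scaling s w / subordConst n s) •
    conv 1 (besselJ n ((1 - s) / 2)) (toLOne fun x => φ x - lap φ x))
    (conv 1 (factorRemainder s w) (toLOne φ)), Lp.coeFn_smul (scaling s w / subordConst n s)
    (conv 1 (besselJ n ((1 - s) / 2)) (toLOne fun x => φ x - lap φ x))] with x e1 e2 e3 e4 e5
  rw [e1, e4, Pi.add_apply, e5, Pi.smul_apply, e2, e3, smul_eq_mul]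
  have hΘ := hφ.comp_sub_left x
  have key := integral_potential_mul_lap (w := w) hs hδ hs1 hΘ
  simp only [lap_comp_sub_left hφ] at key
  have hA := hΘ.allMemLp
  have hl : AllMemLp fun y => lap φ (x - y) := (hφ.lap.comp_sub_left x).allMemLp
  have hd : ∀ k : LpFull n 1, ∫ y, k y * (φ (x - y) - lap φ (x - y)) =
      (∫ y, k y * φ (x - y)) - ∫ y, k y * lap φ (x - y) := fun k => by
    rw [← integral_sub (hA.integrable_mul k) (hl.integrable_mul k)]
    simp only [mul_sub]
  have hr : ∫ y, factorRemainder s w y * φ (x - y) =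
      (∫ y, toLOne (potential s w) y * φ (x - y)) - scaling s w / subordConst n s *
        (∫ y, besselJ n ((1 - s) / 2) y * φ (x - y)) -
        ∫ y, potentialRemainder s w y * φ (x - y) := by
    rw [← pairing_apply hA, factorRemainder, map_sub, map_sub, map_smul, smul_eq_mul]
    simp only [pairing_apply]
  rw [hd, hd, hr]
  have hp := integral_toLOne_mul (h := fun y => lap φ (x - y))
    (integrable_potential (w := w) hs hδ hs1)
  rw [hp, key]
  ring

/-- Factorization of the nonlocal potential through the fractional operator `(1 - Δ)^a`. -/
lemma conv_potential_besselB (hs : 0 < s) (hδ : 0 < δ) (hs1 : s < 1) {φ : Rn n → ℝ}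
    (hφ : IsTest φ) :
    conv 1 (toLOne (potential s w))
      (conv 1 (besselB n ((1 - s) / 2)) (toLOne fun x => φ x - lap φ x)) =
      (scaling s w / subordConst n s * betaConst ((1 - s) / 2)) • toLOne φ +
        conv 1 (conv 1 (besselB n ((1 - s) / 2)) (factorRemainder s w)) (toLOne φ) := by
  rw [conv_comm, conv_potential hs hδ hs1 hφ, map_add, map_smul, conv_comm, ← conv_conv,
    conv_besselJ_besselB (by linarith) (by linarith), conv_conv]
  simp only [map_smul, _root_.smul_apply]
  rw [conv_besselE hφ, smul_smul]

end FarField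

/-! ### A vector field in a cone with prescribed divergence -/

section RayAverage

variable {n : ℕ}

/-- Weighted average of a function over the dilations of a point. -/
def rayAverage {F : Type} [NormedAddCommGroup F] [NormedSpace ℝ F] (k : ℕ) (η : Rn n → F)
    (x : Rn n) : F := ∫ l in (1 : ℝ)..2, l ^ k • η (l • x)

lemma hasFDerivAt_rayAverage {F : Type} [NormedAddCommGroup F] [NormedSpace ℝ F] (k : ℕ)
    {η : Rn n → F} (h1 : ContDiff ℝ 1 η) (h2 : HasCompactSupport η) (x : Rn n) :
    HasFDerivAt (rayAverage k η) (rayAverage (k + 1) (fderiv ℝ η) x) x := by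
  have hd : Continuous (fderiv ℝ η) := h1.continuous_fderiv one_ne_zero
  have hη := h1.continuous
  obtain ⟨C, hC⟩ := (h2.fderiv (𝕜 := ℝ)).exists_bound_of_continuous hd
  refine intervalIntegral.hasFDerivAt_integral_of_dominated_of_fderiv_le
    (F := fun x l => l ^ k • η (l • x)) (F' := fun x l => l ^ (k + 1) • fderiv ℝ η (l • x))
    (bound := fun l => l ^ (k + 1) * C) (s := Set.univ) univ_mem
    (Eventually.of_forall fun y => Continuous.aestronglyMeasurable (by fun_prop))
    (Continuous.intervalIntegrable (by fun_prop) _ _)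
    (Continuous.aestronglyMeasurable (by fun_prop))
    (Eventually.of_forall fun l hl y _ => ?_)
    (Continuous.intervalIntegrable (by fun_prop) _ _)
    (Eventually.of_forall fun l _ y _ => ?_)
  · rw [Set.uIoc_of_le one_le_two] at hl
    have hl0 : 0 < l := one_pos.trans hl.1
    rw [norm_smul, Real.norm_of_nonneg (by positivity)]
    gcongr
    exact hC _
  · have h3 : HasFDerivAt (fun y : Rn n => l • y) (l • ContinuousLinearMap.id ℝ (Rn n)) y :=
      (hasFDerivAt_id y).const_smul l
    have h4 := ((h1.differentiable one_ne_zero (l • y)).hasFDerivAt.comp y h3).const_smul (l ^ k)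
    refine h4.congr_fderiv ?_
    ext v
    simp [pow_succ, mul_smul]

/-- Every derivative is again a ray average, with one more power of `l` and with values in a space
of linear maps; hence the induction over all `F` and `k`. -/
lemma contDiff_rayAverage {F : Type} [NormedAddCommGroup F] [NormedSpace ℝ F] (k : ℕ)
    {η : Rn n → F} (h1 : ContDiff ℝ ∞ η) (h2 : HasCompactSupport η) :
    ContDiff ℝ ∞ (rayAverage k η) := by
  refine contDiff_infty.2 fun m => ?_
  induction m generalizing F k with
  | zero =>
    exact contDiff_zero.2 (continuous_iff_continuousAt.2 fun x =>
      (hasFDerivAt_rayAverage k (h1.of_le (by simp)) h2 x).continuousAt)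
  | succ m ih =>
    refine contDiff_succ_iff_hasFDerivAt.2 ⟨_, ih (k + 1) (h1.fderiv_right (m := ∞) (by simp))
      (h2.fderiv (𝕜 := ℝ)), hasFDerivAt_rayAverage k (h1.of_le (by simp)) h2⟩

/-- The points on the segments joining the origin with a ball. -/
def coneHull (b : Rn n) (κ : ℝ) : Set (Rn n) :=
  {x | ∃ t : ℝ, 0 < t ∧ t ≤ 1 ∧ ∃ y ∈ Metric.closedBall b κ, x = t • y}

/-- The hull is closed under shrinking towards the origin, so rescaled fields stay in the same cone.
-/
lemma smul_mem_coneHull {b : Rn n} {κ L : ℝ} (hL : 1 ≤ L) {x : Rn n}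
    (h : L • x ∈ coneHull b κ) : x ∈ coneHull b κ := by
  obtain ⟨t, h0, h1, y, hy, he⟩ := h
  have hL0 : 0 < L := by linarith
  refine ⟨L⁻¹ * t, by positivity, ?_, y, hy, ?_⟩
  · have : L⁻¹ ≤ 1 := inv_le_one_of_one_le₀ hL
    nlinarith
  · rw [mul_smul, ← he, inv_smul_smul₀ hL0.ne']

/-- Vector field with divergence `2ⁿ η(2x) - η(x)`. -/
def rayField (η : Rn n → ℝ) (i : Fin n) (x : Rn n) : ℝ := x i * rayAverage (n - 1) η x

lemma tsupport_rayField_subset {η : Rn n → ℝ} {b : Rn n} {κ : ℝ}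
    (h : tsupport η ⊆ Metric.closedBall b κ) (i : Fin n) :
    IsCompact (tsupport (rayField η i)) ∧ tsupport (rayField η i) ⊆ coneHull b κ := by
  -- Scales below 1/2 do not occur because the average runs over l ≤ 2. This makes `T` compact, so
  -- closing the support does not leave the cone.
  let T : Set (Rn n) := (fun q : ℝ × Rn n => q.1 • q.2) ''
    (Set.Icc (1 / 2) 1 ×ˢ Metric.closedBall b κ)
  have hT : IsCompact T :=
    (isCompact_Icc.prod (isCompact_closedBall b κ)).image (by fun_prop)
  have hsub : tsupport (rayField η i) ⊆ T := by
    refine closure_minimal (fun x hx => ?_) hT.isClosed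
    by_contra hxT
    refine hx ?_
    have : rayAverage (n - 1) η x = 0 := by
      unfold rayAverage
      refine intervalIntegral.integral_zero_ae (Eventually.of_forall fun l hl => ?_)
      rw [Set.uIoc_of_le one_le_two] at hl
      have hl0 : 0 < l := one_pos.trans hl.1
      by_contra h0
      refine hxT ⟨(l⁻¹, l • x), ⟨⟨?_, inv_le_one_of_one_le₀ hl.1.le⟩, h (subset_tsupport _ ?_)⟩,
        inv_smul_smul₀ hl0.ne' x⟩
      · rw [one_div]; exact inv_anti₀ hl0 hl.2
      · intro h1; exact h0 (by simp [h1])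
    simp [rayField, this]
  refine ⟨hT.of_isClosed_subset (isClosed_tsupport _) hsub, hsub.trans ?_⟩
  rintro _ ⟨⟨t, y⟩, ⟨ht, hy⟩, rfl⟩
  exact ⟨t, by linarith [ht.1], ht.2, y, hy, rfl⟩

lemma isTest_rayField {η : Rn n → ℝ} {b : Rn n} {κ : ℝ} (hη : IsTest η)
    (h : tsupport η ⊆ Metric.closedBall b κ) (i : Fin n) : IsTest (rayField η i) :=
  ⟨ContDiff.mul (by fun_prop) (contDiff_rayAverage _ hη.smooth hη.compact),
    (tsupport_rayField_subset h i).1⟩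

lemma sum_single_smul (x : Rn n) : ∑ i, x i • EuclideanSpace.single i (1 : ℝ) = x := by
  ext j
  simp [Finset.sum_apply, Pi.single_apply]

lemma sum_mul_pd {f : Rn n → ℝ} (x y : Rn n) : ∑ i, y i * pd i f x = fderiv ℝ f x y := by
  conv_rhs => rw [← sum_single_smul y]
  simp [pd, map_sum]

/-- The divergence of x g(x) is n g + x · ∇g. For the ray average this is the integral over [1, 2]
of the derivative of l^n η(lx) in l. -/
lemma sum_pd_rayField [NeZero n] {η : Rn n → ℝ} (hη : IsTest η) (x : Rn n) :
    ∑ i, pd i (rayField η i) x = 2 ^ n * η ((2 : ℝ) • x) - η x := by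
  have hn : n - 1 + 1 = n := Nat.succ_pred_eq_of_pos (NeZero.pos n)
  have hC1 : ContDiff ℝ 1 η := hη.smooth.of_le (by simp)
  have hg := hasFDerivAt_rayAverage (n - 1) hC1 hη.compact x
  rw [hn] at hg
  have h1 : ∀ i, pd i (rayField η i) x =
      rayAverage (n - 1) η x + x i * pd i (rayAverage (n - 1) η) x := fun i => by
    have h := ((EuclideanSpace.proj i : Rn n →L[ℝ] ℝ).hasFDerivAt (x := x)).mul hg
    have h' : HasFDerivAt (rayField η i) _ x := h
    unfold pd
    rw [h'.fderiv, hg.fderiv]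
    simp
    ring
  simp only [h1, Finset.sum_add_distrib, sum_mul_pd, Finset.sum_const, Finset.card_univ,
    Fintype.card_fin, nsmul_eq_mul, hg.fderiv]
  have hd : Continuous (fderiv ℝ η) := hC1.continuous_fderiv one_ne_zero
  have hηc := hη.continuous
  have e1 : rayAverage n (fderiv ℝ η) x x = ∫ l in (1 : ℝ)..2, l ^ n * fderiv ℝ η (l • x) x := by
    unfold rayAverage
    rw [ContinuousLinearMap.intervalIntegral_apply
      (Continuous.intervalIntegrable (by fun_prop) _ _)]
    rfl
  rw [e1, rayAverage, ← intervalIntegral.integral_const_mul, ← intervalIntegral.integral_add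
    (Continuous.intervalIntegrable (by fun_prop) _ _)
    (Continuous.intervalIntegrable (by fun_prop) _ _)]
  have h2 : ∀ l : ℝ, HasDerivAt (fun l : ℝ => l ^ n * η (l • x))
      (n * (l ^ (n - 1) • η (l • x)) + l ^ n * fderiv ℝ η (l • x) x) l := fun l => by
    have h3 : HasDerivAt (fun l : ℝ => l • x) ((1 : ℝ) • x) l := (hasDerivAt_id l).smul_const x
    have h4 := (hη.differentiable (l • x)).hasFDerivAt.comp_hasDerivAt l h3
    refine ((hasDerivAt_pow n l).mul h4).congr_deriv ?_
    simp
    ring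
  rw [intervalIntegral.integral_eq_sub_of_hasDerivAt (fun l _ => h2 l)
    (Continuous.intervalIntegrable (by fun_prop) _ _)]
  simp

end RayAverage

/-! ### Dilations of test functions -/

section Dilation

variable {n : ℕ}

/-- The function `c f(Lx)`. -/
def dil (c L : ℝ) (f : Rn n → ℝ) (x : Rn n) : ℝ := c * f (L • x)

lemma pd_dil {f : Rn n → ℝ} (hf : Differentiable ℝ f) (c L : ℝ) (i : Fin n) :
    pd i (dil c L f) = dil (c * L) L (pd i f) := by
  funext x
  have h3 : HasFDerivAt (fun y : Rn n => L • y) (L • ContinuousLinearMap.id ℝ (Rn n)) x :=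
    (hasFDerivAt_id x).const_smul L
  have h4 : HasFDerivAt (dil c L f) _ x := ((hf (L • x)).hasFDerivAt.comp x h3).const_mul c
  unfold pd
  rw [h4.fderiv]
  simp [dil]
  ring

lemma IsTest.dil {f : Rn n → ℝ} (hf : IsTest f) (c : ℝ) {L : ℝ} (hL : 0 < L) :
    IsTest (dil c L f) :=
  ⟨contDiff_const.mul (hf.smooth.comp (contDiff_const_smul L)),
    (hf.compact.comp_smul hL.ne').mul_left⟩

lemma lap_dil {f : Rn n → ℝ} (hf : IsTest f) (c L : ℝ) :
    lap (dil c L f) = dil (c * L ^ 2) L (lap f) := by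
  funext x
  unfold lap
  simp only [pd_dil hf.differentiable, pd_dil (hf.pd _).differentiable]
  simp [dil, Finset.mul_sum]
  ring_nf

lemma norm_toLOne_dil {f : Rn n → ℝ} (hf : IsTest f) (c : ℝ) {L : ℝ} (hL : 0 < L) :
    ‖toLOne (dil c L f)‖ = |c| * (L ^ n)⁻¹ * ‖toLOne f‖ := by
  rw [norm_toLOne (hf.dil c hL).integrable, norm_toLOne hf.integrable]
  simp only [dil, abs_mul]
  rw [integral_const_mul, Measure.integral_comp_smul_of_nonneg volume (fun x => |f x|) L (hR := hL.le)]
  simp [mul_assoc]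

lemma tsupport_dil_subset {f : Rn n → ℝ} (c : ℝ) {L : ℝ} :
    tsupport (dil c L f) ⊆ (fun x => L • x) ⁻¹' tsupport f := by
  refine closure_minimal (fun x hx => subset_tsupport _ fun h => hx (by simp [dil, h])) ?_
  exact (isClosed_tsupport _).preimage (by fun_prop)

end Dilation

/-! ### Dyadic kernels recovering a function from its gradient -/

section Dyadic

variable {n : ℕ}

/-- Rescaled bump functions. -/
def dyBump (η : Rn n → ℝ) (k : ℕ) : Rn n → ℝ := dil ((2 ^ k) ^ n) (2 ^ k) η

/-- Rescaled vector fields whose divergence is the difference of two rescaled bump functions. -/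
def dyField (η : Rn n → ℝ) (k : ℕ) (i : Fin n) : Rn n → ℝ :=
  dil ((2 ^ k) ^ n * (2 ^ k)⁻¹) (2 ^ k) (rayField η i)

variable {η : Rn n → ℝ} {b : Rn n} {κ : ℝ}

lemma isTest_dyBump (hη : IsTest η) (k : ℕ) : IsTest (dyBump η k) :=
  hη.dil _ (by positivity)

lemma isTest_dyField (hη : IsTest η) (h : tsupport η ⊆ Metric.closedBall b κ) (k : ℕ) (i : Fin n) :
    IsTest (dyField η k i) :=
  (isTest_rayField hη h i).dil _ (by positivity)

lemma sum_pd_dyField [NeZero n] (hη : IsTest η) (h : tsupport η ⊆ Metric.closedBall b κ) (k : ℕ)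
    (x : Rn n) : ∑ i, pd i (dyField η k i) x = dyBump η (k + 1) x - dyBump η k x := by
  unfold dyField dyBump
  simp only [pd_dil (isTest_rayField hη h _).differentiable]
  simp only [dil, ← Finset.mul_sum, sum_pd_rayField hη, smul_smul]
  rw [inv_mul_cancel_right₀ (by positivity), pow_succ' 2 k, mul_pow]
  ring

lemma tsupport_dyField_subset (h : tsupport η ⊆ Metric.closedBall b κ) (k : ℕ) (i : Fin n) :
    tsupport (dyField η k i) ⊆ coneHull b κ := fun _ hx =>
  smul_mem_coneHull (one_le_pow₀ one_le_two)
    ((tsupport_rayField_subset h i).2 (tsupport_dil_subset _ hx))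

lemma norm_toLOne_dyField (hη : IsTest η) (h : tsupport η ⊆ Metric.closedBall b κ) (k : ℕ)
    (i : Fin n) : ‖toLOne (dyField η k i)‖ = (1 / 2) ^ k * ‖toLOne (rayField η i)‖ := by
  unfold dyField
  rw [norm_toLOne_dil (isTest_rayField hη h i) _ (by positivity), abs_of_pos (by positivity)]
  congr 1
  rw [one_div, inv_pow]
  field_simp

/-- The fields have L¹ norm of order 2^(-k), and two derivatives cost 4^k. -/
lemma norm_toLOne_lap_dyField (hη : IsTest η) (h : tsupport η ⊆ Metric.closedBall b κ) (k : ℕ)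
    (i : Fin n) :
    ‖toLOne (lap (dyField η k i))‖ = 2 ^ k * ‖toLOne (lap (rayField η i))‖ := by
  unfold dyField
  rw [lap_dil (isTest_rayField hη h i), norm_toLOne_dil (isTest_rayField hη h i).lap _
    (by positivity), abs_of_pos (by positivity)]
  congr 1
  field_simp

variable {p : ℝ≥0∞} [Fact (1 ≤ p)] [Fact (p ≠ ⊤)]

lemma conv_toLOne_apply {k : Rn n → ℝ} (hk : Integrable k) (f : LpFull n p) :
    conv p (toLOne k) f = ∫ y, k y • translate p y f := by
  rw [conv_apply]
  refine integral_congr_ae ?_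
  filter_upwards [coeFn_toLOne hk] with y hy
  rw [hy]

lemma tendsto_conv_dyBump (hη : IsTest η) (h1 : ∫ x, η x = 1) (f : LpFull n p) :
    Tendsto (fun k => conv p (toLOne (dyBump η k)) f) atTop (𝓝 f) := by
  have e : ∀ k, conv p (toLOne (dyBump η k)) f =
      ∫ y, η y • translate p (((2 : ℝ) ^ k)⁻¹ • y) f := fun k => by
    rw [conv_toLOne_apply (isTest_dyBump hη k).integrable]
    have := Measure.integral_comp_smul_of_nonneg (volume : Measure (Rn n))
      (fun y => η y • translate p (((2 : ℝ) ^ k)⁻¹ • y) f) (2 ^ k) (hR := by positivity)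
    rw [← inv_smul_eq_iff₀ (by positivity)] at this
    rw [← this, finrank_euclideanSpace_fin, inv_inv, ← integral_smul]
    refine integral_congr_ae (Eventually.of_forall fun y => ?_)
    simp only [dyBump, dil, inv_smul_smul₀ (show (2 : ℝ) ^ k ≠ 0 by positivity), smul_smul]
  simp only [e]
  have e2 : f = ∫ y, η y • f := by rw [integral_smul_const, h1, one_smul]
  have hc := continuous_translate f
  have hηc := hη.continuous
  conv => enter [3]; rw [e2]
  refine tendsto_integral_of_dominated_convergence (fun y => ‖η y‖ * ‖f‖)
    (fun k => Continuous.aestronglyMeasurable (by fun_prop)) (hη.integrable.norm.mul_const _)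
    (fun k => Eventually.of_forall fun y => by rw [norm_smul, LinearIsometry.norm_map])
    (Eventually.of_forall fun y => Tendsto.const_smul ?_ _)
  have h0 : Tendsto (fun k : ℕ => ((2 : ℝ) ^ k)⁻¹ • y) atTop (𝓝 ((0 : ℝ) • y)) := by
    refine Tendsto.smul_const ?_ y
    simpa using tendsto_pow_atTop_nhds_zero_of_lt_one (r := (2⁻¹ : ℝ)) (by norm_num) (by norm_num)
  have h2 := (hc.tendsto ((0 : ℝ) • y)).comp h0
  have h3 : translate p ((0 : ℝ) • y) f = f := by
    refine Lp.ext ((coeFn_translate _ f).trans ?_)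
    simp
  rwa [h3] at h2

lemma summable_dyField (hη : IsTest η) (h : tsupport η ⊆ Metric.closedBall b κ) (i : Fin n) :
    Summable fun k => toLOne (dyField η k i) := by
  refine Summable.of_norm ?_
  simp only [norm_toLOne_dyField hη h]
  exact (summable_geometric_of_lt_one (by norm_num) (by norm_num)).mul_right _

/-- Interpolation bounds the k-th term by a multiple of (2^k)^θ (2^(-k))^(1-θ) = 2^(-k(1-2θ)), so an
exponent θ strictly between a and 1/2 is needed. This is where losing 2a < 1 derivatives is
compensated by the one derivative gained. -/
lemma summable_besselB_dyField (hη : IsTest η) (h : tsupport η ⊆ Metric.closedBall b κ) {a : ℝ}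
    (ha0 : 0 < a) (ha1 : a < 1 / 2) (i : Fin n) :
    Summable fun k => conv 1 (besselB n a)
      (toLOne fun x => dyField η k i x - lap (dyField η k i) x) := by
  set θ := (a + 1 / 2) / 2 with hθ
  have h1 : a < θ := by linarith
  have h2 : θ < 1 / 2 := by linarith
  obtain ⟨C, hC0, hC⟩ := exists_norm_conv_besselB_le n ha0 h1 (by linarith)
  set A := ‖toLOne (rayField η i)‖
  set B := ‖toLOne (lap (rayField η i))‖
  have hA : 0 ≤ A := norm_nonneg _
  have hB : 0 ≤ B := norm_nonneg _
  have hr1 : (2 : ℝ) ^ θ * (1 / 2) ^ (1 - θ) < 1 := by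
    rw [one_div, Real.inv_rpow (by norm_num), ← Real.rpow_neg (by norm_num),
      ← Real.rpow_add (by norm_num)]
    exact Real.rpow_lt_one_of_one_lt_of_neg (by norm_num) (by linarith)
  refine Summable.of_norm_bounded ((summable_geometric_of_lt_one (by positivity) hr1).mul_left
    (C * ((A + B) ^ θ * A ^ (1 - θ)))) fun k => ?_
  have ht := isTest_dyField hη h k i
  refine (hC _ ht).trans ?_
  have hX : ‖toLOne fun x => dyField η k i x - lap (dyField η k i) x‖ ≤ 2 ^ k * (A + B) := by
    rw [toLOne_sub ht.integrable ht.lap.integrable]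
    refine (norm_sub_le _ _).trans ?_
    rw [norm_toLOne_dyField hη h, norm_toLOne_lap_dyField hη h, mul_add]
    have h3 : (1 / 2 : ℝ) ^ k ≤ 2 ^ k :=
      pow_le_pow_left₀ (by norm_num) (by norm_num) k
    exact add_le_add (mul_le_mul_of_nonneg_right h3 hA) le_rfl
  rw [norm_toLOne_dyField hη h]
  calc C * (‖toLOne fun x => dyField η k i x - lap (dyField η k i) x‖ ^ θ *
          ((1 / 2) ^ k * A) ^ (1 - θ))
      ≤ C * ((2 ^ k * (A + B)) ^ θ * ((1 / 2) ^ k * A) ^ (1 - θ)) := by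
        refine mul_le_mul_of_nonneg_left (mul_le_mul_of_nonneg_right
          (Real.rpow_le_rpow (norm_nonneg _) hX (by linarith)) (by positivity)) hC0
    _ = _ := by
      rw [Real.mul_rpow (by positivity) (by positivity), Real.mul_rpow (by positivity) hA,
        mul_pow, Real.rpow_pow_comm (by norm_num), Real.rpow_pow_comm (by norm_num)]
      ring

/-- The kernel `Φ_i` of the local representation of a function by its gradient. -/
def dyPhi (η : Rn n → ℝ) (i : Fin n) : LpFull n 1 := ∑' k, toLOne (dyField η k i)

/-- The image of `Φ_i` under a fractional operator. -/
def dyPsi (a : ℝ) (η : Rn n → ℝ) (i : Fin n) : LpFull n 1 :=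
  ∑' k, conv 1 (besselB n a) (toLOne fun x => dyField η k i x - lap (dyField η k i) x)

/-- The factorization for test functions, summed over the dyadic scales; both series converge in L¹.
-/
lemma conv_potential_dyPsi [NeZero n] {s δ : ℝ} {w : Cutoff n δ} (hs : 0 < s) (hδ : 0 < δ)
    (hs1 : s < 1) (hη : IsTest η) (h : tsupport η ⊆ Metric.closedBall b κ) (i : Fin n) :
    conv 1 (toLOne (potential s w)) (dyPsi ((1 - s) / 2) η i) =
      (scaling s w / subordConst n s * betaConst ((1 - s) / 2)) • dyPhi η i +
        conv 1 (conv 1 (besselB n ((1 - s) / 2)) (factorRemainder s w)) (dyPhi η i) := by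
  have h1 := summable_besselB_dyField hη h (a := (1 - s) / 2) (by linarith) (by linarith) i
  have h2 := summable_dyField hη h i
  unfold dyPsi dyPhi
  rw [ContinuousLinearMap.map_tsum _ h1, ContinuousLinearMap.map_tsum _ h2, ← h2.tsum_const_smul,
    ← (h2.const_smul _).tsum_add ((ContinuousLinearMap.summable _ h2))]
  exact tsum_congr fun k => conv_potential_besselB hs hδ hs1 (isTest_dyField hη h k i)

end Dyadic

/-! ### Multiplication operators and compactness of localized convolutions -/

section Multiplication

variable {n : ℕ} {p : ℝ≥0∞} [Fact (1 ≤ p)]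

/-- Bounded measurable functions. -/
structure BddMeas (m : Rn n → ℝ) : Prop where
  measurable : Measurable m
  bound : ∃ C, 0 ≤ C ∧ ∀ x, |m x| ≤ C

omit [Fact (1 ≤ p)] in
lemma BddMeas.memLp {m : Rn n → ℝ} (hm : BddMeas m) (f : LpFull n p) :
    MemLp (fun x => m x * f x) p volume := by
  obtain ⟨C, -, hC⟩ := hm.bound
  refine MemLp.of_le_mul (c := C) (Lp.memLp f)
    (hm.measurable.aestronglyMeasurable.mul (Lp.aestronglyMeasurable f))
    (Eventually.of_forall fun x => ?_)
  rw [norm_mul]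
  gcongr
  exact hC x

/-- Multiplication by a bounded measurable function. -/
def mulOp (p : ℝ≥0∞) [Fact (1 ≤ p)] {m : Rn n → ℝ} (hm : BddMeas m) : LpFull n p →L[ℝ] LpFull n p :=
  LinearMap.mkContinuousOfExistsBound
    { toFun := fun f => (hm.memLp f).toLp
      map_add' := fun f g => by
        refine Lp.ext ?_
        filter_upwards [(hm.memLp (f + g)).coeFn_toLp, (hm.memLp f).coeFn_toLp,
          (hm.memLp g).coeFn_toLp, Lp.coeFn_add f g,
          Lp.coeFn_add (hm.memLp f).toLp (hm.memLp g).toLp] with x h1 h2 h3 h4 h5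
        rw [h1, h5, Pi.add_apply, h2, h3, h4, Pi.add_apply, mul_add]
      map_smul' := fun c f => by
        refine Lp.ext ?_
        filter_upwards [(hm.memLp (c • f)).coeFn_toLp, (hm.memLp f).coeFn_toLp,
          Lp.coeFn_smul c f, Lp.coeFn_smul c (hm.memLp f).toLp] with x h1 h2 h3 h4
        rw [h1, RingHom.id_apply, h4, Pi.smul_apply, h2, h3, Pi.smul_apply, smul_eq_mul,
          smul_eq_mul, mul_left_comm] }
    (by
      obtain ⟨C, -, hC⟩ := hm.bound
      refine ⟨C, fun f => Lp.norm_le_mul_norm_of_ae_le_mul ?_⟩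
      filter_upwards [(hm.memLp f).coeFn_toLp] with x h
      change ‖((hm.memLp f).toLp : LpFull n p) x‖ ≤ _
      rw [h, norm_mul]
      gcongr
      exact hC x)

lemma coeFn_mulOp {m : Rn n → ℝ} (hm : BddMeas m) (f : LpFull n p) :
    mulOp p hm f =ᵐ[volume] fun x => m x * f x := (hm.memLp f).coeFn_toLp

lemma integral_mulOp_mul {m : Rn n → ℝ} (hm : BddMeas m) (f : LpFull n p) (h : Rn n → ℝ) :
    ∫ x, mulOp p hm f x * h x = ∫ x, f x * (m x * h x) := by
  refine integral_congr_ae ?_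
  filter_upwards [coeFn_mulOp hm f] with x hx
  rw [hx]; ring

lemma bddMeas_indicator {S : Set (Rn n)} (hS : MeasurableSet S) :
    BddMeas (S.indicator fun _ => (1 : ℝ)) :=
  ⟨measurable_const.indicator hS, 1, zero_le_one, fun x => by
    by_cases hx : x ∈ S <;> simp [hx]⟩

lemma IsTest.bddMeas {φ : Rn n → ℝ} (h : IsTest φ) : BddMeas φ :=
  ⟨h.continuous.measurable, h.exists_bound⟩

lemma BddMeas.allMemLp {m : Rn n → ℝ} (hm : BddMeas m) {R : ℝ}
    (hR : ∀ x, R < ‖x‖ → m x = 0) : AllMemLp m := fun q => by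
  obtain ⟨C, -, hC⟩ := hm.bound
  have h : MemLp m q (volume.restrict (Metric.closedBall 0 R)) := by
    have : IsFiniteMeasure (volume.restrict (Metric.closedBall (0 : Rn n) R)) :=
      ⟨by simpa using measure_closedBall_lt_top⟩
    exact MemLp.of_bound hm.measurable.aestronglyMeasurable C (Eventually.of_forall hC)
  have h2 := (memLp_indicator_iff_restrict Metric.isClosed_closedBall.measurableSet).2 h
  convert h2 using 1
  funext x
  by_cases hx : x ∈ Metric.closedBall (0 : Rn n) R
  · simp [hx]
  · rw [Set.indicator_of_notMem hx]
    exact hR x (by simpa using hx)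

variable [Fact (p ≠ ⊤)]

lemma isCompact_hull_translate (G : LpFull n p) (R C : ℝ) :
    IsCompact (closure (convexHull ℝ
      ((fun q : ℝ × Rn n => q.1 • translate p q.2 G) ''
        (Set.Icc (-C) C ×ˢ Metric.closedBall 0 R)))) := by
  refine isCompact_iff_totallyBounded_isComplete.2 ⟨TotallyBounded.closure
    (totallyBounded_convexHull.2 (IsCompact.totallyBounded ?_)), isClosed_closure.isComplete⟩
  have := continuous_translate G
  exact (isCompact_Icc.prod (isCompact_closedBall 0 R)).image (by fun_prop)

/-- A convolution is an average of translates; coefficients in [-C, C] account for the mass and the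
sign of `h`. A separating functional bounded by u/C on the translates would be at most u on the
average, contradicting separation. -/
lemma conv_mem_hull_translate (G : LpFull n p) {R C : ℝ} (hC : 0 < C) (hR : 0 ≤ R) {h : LpFull n 1}
    (hh : ∀ᵐ x, R < ‖x‖ → h x = 0) (hn : ‖h‖ ≤ C) :
    conv p h G ∈ closure (convexHull ℝ
      ((fun q : ℝ × Rn n => q.1 • translate p q.2 G) ''
        (Set.Icc (-C) C ×ˢ Metric.closedBall 0 R))) := by
  by_contra hnot
  obtain ⟨l, u, hl, hu⟩ := geometric_hahn_banach_closed_point (convex_convexHull ℝ _).closure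
    isClosed_closure hnot
  have h1 : ∀ c ∈ Set.Icc (-C) C, ∀ y ∈ Metric.closedBall (0 : Rn n) R,
      c * l (translate p y G) < u := fun c hc y hy => by
    have := hl _ (subset_closure (subset_convexHull ℝ _ ⟨(c, y), ⟨hc, hy⟩, rfl⟩))
    simpa using this
  have hu0 : 0 < u := by
    have := h1 0 ⟨by linarith, hC.le⟩ 0 (by simpa using hR)
    simpa using this
  have h2 : ∀ y ∈ Metric.closedBall (0 : Rn n) R, |l (translate p y G)| ≤ u / C := fun y hy => by
    have ha := h1 C ⟨by linarith, le_rfl⟩ y hy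
    have hb := h1 (-C) ⟨le_rfl, by linarith⟩ y hy
    rw [le_div_iff₀ hC, ← abs_of_pos hC, ← abs_mul]
    exact abs_le.2 ⟨by linarith, by linarith⟩
  have h3 : l (conv p h G) ≤ u := by
    rw [conv_apply, ← l.integral_comp_comm (integrable_smul_translate h G)]
    refine (Real.le_norm_self _).trans ((norm_integral_le_of_norm_le
      ((L1.integrable_coeFn h).norm.mul_const (u / C)) ?_).trans ?_)
    · filter_upwards [hh] with y hy
      rw [map_smul, norm_smul]
      by_cases hyR : R < ‖y‖
      · simp [hy hyR]
      · gcongr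
        exact h2 y (by simpa using hyR)
    · rw [integral_mul_const, ← L1.norm_eq_integral_norm]
      calc ‖h‖ * (u / C) ≤ C * (u / C) := by gcongr
        _ = u := by field_simp
  linarith

/-- The roles are exchanged: the localized function becomes the L¹ kernel, and the fixed continuous
kernel becomes the L^p function being convolved. -/
lemma conv_toLOne_mulOp {g m : Rn n → ℝ} (hg : Continuous g) (hgc : HasCompactSupport g)
    (hm : BddMeas m) (hmA : AllMemLp m) (f : LpFull n p) :
    conv p (toLOne g) (mulOp p hm f) =
      conv p (toLOne fun x => f x * m x) (allMemLp_of_continuous hg hgc p).toLp := by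
  have hgi : Integrable g := hg.integrable_of_hasCompactSupport hgc
  have hfm := hmA.integrable_mul f
  refine Lp.ext ((conv_ae_eq _ _).trans (EventuallyEq.trans (Eventually.of_forall fun x => ?_)
    (conv_ae_eq _ _).symm))
  have hq := (Measure.measurePreserving_sub_left volume x).quasiMeasurePreserving
  have e1 : ∫ y, toLOne g y * mulOp p hm f (x - y) = ∫ y, g y * (m (x - y) * f (x - y)) := by
    refine integral_congr_ae ?_
    filter_upwards [coeFn_toLOne hgi, hq.ae_eq_comp (coeFn_mulOp hm f)] with y h1 h2
    simp only [Function.comp_apply] at h2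
    rw [h1, h2]
  have e2 : ∫ y, toLOne (fun x => f x * m x) y * ((allMemLp_of_continuous hg hgc p).toLp : LpFull n p) (x - y) =
      ∫ y, f y * m y * g (x - y) := by
    refine integral_congr_ae ?_
    filter_upwards [coeFn_toLOne hfm,
      hq.ae_eq_comp (allMemLp_of_continuous hg hgc p).coeFn_toLp] with y h1 h2
    simp only [Function.comp_apply] at h2
    rw [h1, h2]
  simp only
  rw [e1, e2, ← integral_sub_left_eq_self _ volume x]
  refine integral_congr_ae (Eventually.of_forall fun y => ?_)
  simp only [sub_sub_cancel]; ring

/-- After the exchange of roles, the unit ball is mapped to convolutions of one fixed function with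
kernels of uniformly bounded mass and support. These lie in the closed convex hull of a compact set
of multiples of translates. -/
lemma isCompactOperator_conv_mulOp_of_continuous {g m : Rn n → ℝ} (hg : Continuous g)
    (hgc : HasCompactSupport g) (hm : BddMeas m) {R : ℝ} (hR : ∀ x, R < ‖x‖ → m x = 0) :
    IsCompactOperator (conv p (toLOne g) ∘L mulOp p hm) := by
  have hmA := hm.allMemLp hR
  set G : LpFull n p := (allMemLp_of_continuous hg hgc p).toLp
  set C := ‖pairing p hmA.abs‖ + 1 with hC
  have hC0 : 0 < C := by positivity
  refine ⟨_, isCompact_hull_translate G |R| C, ?_⟩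
  filter_upwards [Metric.ball_mem_nhds (0 : LpFull n p) one_pos] with f hf
  have hf1 : ‖f‖ ≤ 1 := (mem_ball_zero_iff.1 hf).le
  have hfm := hmA.integrable_mul f
  rw [Set.mem_preimage, ContinuousLinearMap.comp_apply, conv_toLOne_mulOp hg hgc hm hmA]
  refine conv_mem_hull_translate G hC0 (abs_nonneg R) ?_ ?_
  · filter_upwards [coeFn_toLOne hfm] with x hx hRx
    rw [hx, hR x ((le_abs_self R).trans_lt hRx), mul_zero]
  · rw [norm_toLOne hfm]
    have e : ∫ x, |f x * m x| = pairing p hmA.abs |f| := by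
      rw [pairing_apply]
      refine integral_congr_ae ?_
      filter_upwards [Lp.coeFn_abs f] with x h2
      rw [h2, abs_mul]
    rw [e]
    calc _ ≤ ‖pairing p hmA.abs |f|‖ := le_abs_self _
      _ ≤ ‖pairing p hmA.abs‖ * ‖f‖ := by
        simpa only [norm_abs_eq_norm] using (pairing p hmA.abs).le_opNorm |f|
      _ ≤ ‖pairing p hmA.abs‖ * 1 := by gcongr
      _ ≤ C := by linarith

/-- Convolution with an integrable kernel is compact on bounded sets. -/
lemma isCompactOperator_conv_mulOp (k : LpFull n 1) {m : Rn n → ℝ} (hm : BddMeas m) {R : ℝ}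
    (hR : ∀ x, R < ‖x‖ → m x = 0) : IsCompactOperator (conv p k ∘L mulOp p hm) := by
  have hk := L1.integrable_coeFn k
  -- Compactly supported continuous kernels converge to `k` in L¹, hence the operators converge in
  -- norm, and compactness is preserved.
  choose g hgc hgε hg hgi using fun j : ℕ =>
    hk.exists_hasCompactSupport_integral_sub_le (Nat.one_div_pos_of_nat (α := ℝ) (n := j))
  have hlim : Tendsto (fun j => toLOne (g j)) atTop (𝓝 k) := by
    rw [tendsto_iff_norm_sub_tendsto_zero]
    refine squeeze_zero (fun _ => norm_nonneg _) (fun j => ?_)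
      tendsto_one_div_add_atTop_nhds_zero_nat
    refine le_trans (le_of_eq ?_) (hgε j)
    rw [norm_sub_rev, L1.norm_eq_integral_norm]
    refine integral_congr_ae ?_
    filter_upwards [Lp.coeFn_sub k (toLOne (g j)), coeFn_toLOne (hgi j)] with x h1 h2
    rw [h1, Pi.sub_apply, h2]
  have h2 : Tendsto (fun j => conv p (toLOne (g j)) ∘L mulOp p hm) atTop
      (𝓝 (conv p k ∘L mulOp p hm)) := by
    have hc : Continuous fun T : LpFull n p →L[ℝ] LpFull n p => T ∘L mulOp p hm := by fun_prop
    exact (hc.tendsto _).comp (((conv p).continuous.tendsto k).comp hlim)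
  exact isCompactOperator_of_tendsto h2 (Eventually.of_forall fun j =>
    isCompactOperator_conv_mulOp_of_continuous (hg j) (hgc j) hm hR)

end Multiplication

/-! ### Interior cones, bump functions and partitions of unity -/

section Geometry

variable {n : ℕ}

/-- Interior cone property of Lipschitz domains. -/
lemma IsBoundedLipschitzDomain.exists_cone {Ω : Set (Rn n)} (hΩ : IsBoundedLipschitzDomain Ω)
    {x₀ : Rn n} (hx₀ : x₀ ∈ closure Ω) :
    ∃ r > 0, ∃ b : Rn n, ∃ κ > 0, coneHull b κ ⊆ Metric.ball 0 (r / 2) ∧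
      ∀ x ∈ Ω ∩ Metric.ball x₀ r, ∀ z ∈ coneHull b κ, x - z ∈ Ω := by
  by_cases hx : x₀ ∈ Ω
  · obtain ⟨ε, hε, hb⟩ := Metric.isOpen_iff.1 hΩ.isOpen x₀ hx
    -- At an interior point all small directions are allowed, and the cone may be a whole ball.
    have hsub : coneHull (0 : Rn n) (ε / 8) ⊆ Metric.ball 0 (ε / 2 / 2) := by
      rintro _ ⟨t, h0, h1, y, hy, rfl⟩
      rw [mem_ball_zero_iff, norm_smul, Real.norm_of_nonneg h0.le]
      rw [mem_closedBall_zero_iff] at hy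
      nlinarith [norm_nonneg y]
    refine ⟨ε / 2, by positivity, 0, ε / 8, by positivity, hsub, fun x hxr z hz => hb ?_⟩
    have h1 : ‖z‖ < ε / 2 / 2 := mem_ball_zero_iff.1 (hsub hz)
    have h2 : ‖x - x₀‖ < ε / 2 := mem_ball_iff_norm.1 hxr.2
    rw [mem_ball_iff_norm]
    calc ‖x - z - x₀‖ = ‖(x - x₀) - z‖ := by congr 1; abel
      _ ≤ ‖x - x₀‖ + ‖z‖ := norm_sub_le _ _
      _ < ε := by linarith
  · have hfr : x₀ ∈ frontier Ω := by
      rw [frontier, hΩ.isOpen.interior_eq]; exact ⟨hx₀, hx⟩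
    obtain ⟨ν, hν, K, g, hg, r, hr, hΩr⟩ := hΩ.lipschitz_boundary x₀ hfr
    set h : ℝ := r / 16 with hh
    have hh0 : 0 < h := by positivity
    -- Subtracting t y, with y within κ of -hν, raises the height by at least t(h - κ) and the graph
    -- by at most 2Ktκ. Equality of the two for this κ suffices, since x lies strictly above the
    -- graph. The choice h = r/16 keeps the cone inside the ball of radius r/4.
    set κ : ℝ := h / (2 * K + 1) with hκ
    have hK0 : (0 : ℝ) ≤ K := K.2
    have hκ0 : 0 < κ := by positivity
    have hκh : κ * (2 * K + 1) = h := by rw [hκ]; field_simp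
    have hκle : κ ≤ h := by nlinarith
    have hsub : coneHull (-h • ν) κ ⊆ Metric.ball 0 (r / 2 / 2) := by
      rintro _ ⟨t, h0, h1, y, hy, rfl⟩
      rw [mem_ball_zero_iff, norm_smul, Real.norm_of_nonneg h0.le]
      have hy1 : ‖y - -h • ν‖ ≤ κ := mem_closedBall_iff_norm.1 hy
      have hy2 : ‖y‖ ≤ 2 * h := by
        calc ‖y‖ = ‖(y - -h • ν) + -h • ν‖ := by congr 1; abel
          _ ≤ ‖y - -h • ν‖ + ‖-h • ν‖ := norm_add_le _ _
          _ ≤ κ + h := by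
            refine add_le_add hy1 (le_of_eq ?_)
            rw [norm_smul, hν, norm_neg, Real.norm_of_nonneg hh0.le, mul_one]
          _ ≤ 2 * h := by linarith
      nlinarith [norm_nonneg y]
    refine ⟨r / 2, by positivity, -h • ν, κ, hκ0, hsub, fun x hxr z hz => ?_⟩
    have hz1 : ‖z‖ < r / 2 / 2 := mem_ball_zero_iff.1 (hsub hz)
    have hx1 : ‖x - x₀‖ < r / 2 := mem_ball_iff_norm.1 hxr.2
    have hxin : x ∈ Metric.ball x₀ r := by rw [mem_ball_iff_norm]; linarith
    have hxz : x - z ∈ Metric.ball x₀ r := by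
      rw [mem_ball_iff_norm]
      calc ‖x - z - x₀‖ = ‖(x - x₀) - z‖ := by congr 1; abel
        _ ≤ ‖x - x₀‖ + ‖z‖ := norm_sub_le _ _
        _ < r := by linarith
    have hgx := (hΩr x hxin).1 hxr.1
    rw [hΩr _ hxz]
    obtain ⟨t, h0, h1, y, hy, rfl⟩ := hz
    set e : Rn n := y - -h • ν with he
    have he1 : ‖e‖ ≤ κ := mem_closedBall_iff_norm.1 hy
    have hy' : y = e - h • ν := by rw [he, neg_smul]; abel
    have hνν : inner ℝ ν ν = (1 : ℝ) := by rw [real_inner_self_eq_norm_sq, hν, one_pow]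
    have hνe : |inner ℝ ν e| ≤ κ := by
      refine (abs_real_inner_le_norm ν e).trans ?_
      rw [hν, one_mul]; exact he1
    have e1 : inner ℝ ν (x - t • y) = inner ℝ ν x - t * inner ℝ ν e + t * h := by
      rw [hy', inner_sub_right, real_inner_smul_right, inner_sub_right, real_inner_smul_right, hνν]
      ring
    have e2 : (x - t • y) - inner ℝ ν (x - t • y) • ν -
        (x - inner ℝ ν x • ν) = -(t • (e - inner ℝ ν e • ν)) := by
      rw [e1, hy']
      module
    have e3 : ‖e - inner ℝ ν e • ν‖ ≤ 2 * κ := by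
      refine (norm_sub_le _ _).trans ?_
      rw [norm_smul, hν, mul_one, Real.norm_eq_abs]
      linarith
    have e4 : g ((x - t • y) - inner ℝ ν (x - t • y) • ν) - g (x - inner ℝ ν x • ν) ≤
        K * (t * (2 * κ)) := by
      refine (le_abs_self _).trans ((hg.norm_sub_le _ _).trans ?_)
      rw [e2, norm_neg, norm_smul, Real.norm_of_nonneg h0.le]
      gcongr
    have e5 : t * inner ℝ ν e ≤ t * κ := by
      gcongr
      exact (le_abs_self _).trans hνe
    rw [e1] at e4 ⊢
    have e6 : t * h = t * κ * (2 * K + 1) := by rw [← hκh]; ring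
    nlinarith

lemma exists_bump (b : Rn n) {κ : ℝ} (hκ : 0 < κ) :
    ∃ η : Rn n → ℝ, IsTest η ∧ tsupport η ⊆ Metric.closedBall b κ ∧ ∫ x, η x = 1 := by
  let f : ContDiffBump b := ⟨κ / 2, κ, by positivity, by linarith⟩
  refine ⟨f.normed volume, ⟨f.contDiff_normed, f.hasCompactSupport_normed⟩, ?_, f.integral_normed⟩
  rw [f.tsupport_normed_eq]

lemma exists_partition {ι : Type} [Fintype ι] {S : Set (Rn n)} (hS : IsClosed S)
    (x : ι → Rn n) (r : ι → ℝ) (hcov : S ⊆ ⋃ i, Metric.ball (x i) (r i)) :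
    ∃ χ : ι → Rn n → ℝ, (∀ i, IsTest (χ i)) ∧ (∀ i, tsupport (χ i) ⊆ Metric.ball (x i) (r i)) ∧
      ∀ y ∈ S, ∑ i, χ i y = 1 := by
  obtain ⟨ρ, hρ⟩ := SmoothPartitionOfUnity.exists_isSubordinate (modelWithCornersSelf ℝ (Rn n)) hS
    (fun i => Metric.ball (x i) (r i)) (fun i => Metric.isOpen_ball) hcov
  refine ⟨fun i => ρ i, fun i => ⟨(ρ i).contMDiff.contDiff, ?_⟩, hρ, fun y hy => ?_⟩
  · exact Metric.isCompact_of_isClosed_isBounded (isClosed_tsupport _)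
      (Metric.isBounded_ball.subset (hρ i))
  · rw [← finsum_eq_sum_of_fintype]
    exact ρ.sum_eq_one hy

end Geometry

/-! ### Weak gradients and the local representation formula -/

section WeakPair

variable {n : ℕ} {p : ℝ≥0∞} [Fact (1 ≤ p)] {Ω : Set (Rn n)}

/-- `v` is the weak gradient of `f` in `Ω`. -/
def IsWeakPair (Ω : Set (Rn n)) (f : LpFull n p) (v : Fin n → LpFull n p) : Prop :=
  ∀ i, ∀ ψ : Rn n → ℝ, IsTest ψ → tsupport ψ ⊆ Ω →
    ∫ x, f x * pd i ψ x = -∫ x, v i x * ψ x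

lemma pd_mul {f g : Rn n → ℝ} (hf : Differentiable ℝ f) (hg : Differentiable ℝ g) (i : Fin n)
    (x : Rn n) : pd i (fun x => f x * g x) x = f x * pd i g x + pd i f x * g x := by
  unfold pd
  rw [fderiv_fun_mul (hf x) (hg x)]
  simp
  ring

lemma IsWeakPair.mul {f : LpFull n p} {v : Fin n → LpFull n p} (h : IsWeakPair Ω f v)
    {χ : Rn n → ℝ} (hχ : IsTest χ) :
    IsWeakPair Ω (mulOp p hχ.bddMeas f)
      (fun i => mulOp p hχ.bddMeas (v i) + mulOp p (hχ.pd i).bddMeas f) := by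
  intro i ψ hψ hs
  have h1 := h i _ (hψ.mul_left hχ.smooth) ((tsupport_mul_subset_right).trans hs)
  simp only [pd_mul hχ.differentiable hψ.differentiable] at h1
  have hA := (hψ.mul_left (hχ.pd i).smooth).allMemLp
  have hB := ((hψ.pd i).mul_left hχ.smooth).allMemLp
  have e1 : ∫ x, (mulOp p hχ.bddMeas (v i) + mulOp p (hχ.pd i).bddMeas f) x * ψ x =
      (∫ x, mulOp p hχ.bddMeas (v i) x * ψ x) + ∫ x, mulOp p (hχ.pd i).bddMeas f x * ψ x := by
    simp only [← pairing_apply hψ.allMemLp, map_add]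
  rw [e1, integral_mulOp_mul, integral_mulOp_mul, integral_mulOp_mul]
  simp only [mul_add] at h1
  rw [integral_add (hB.integrable_mul f) (hA.integrable_mul f)] at h1
  linarith

variable [Fact (p ≠ ⊤)]

lemma conv_toLOne_ae_eq' {g : Rn n → ℝ} (hg : Integrable g) (f : LpFull n p) :
    conv p (toLOne g) f =ᵐ[volume] fun x => ∫ y, f y * g (x - y) := by
  refine (conv_ae_eq _ _).trans (Eventually.of_forall fun x => ?_)
  simp only
  rw [integral_toLOne_mul (h := fun y => f (x - y)) hg, ← integral_sub_left_eq_self _ volume x]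
  simp [mul_comm]

/-- The difference of consecutive bumps is the divergence of `dyField`. For x ∈ Ω near x₀ the field
reflected at x is supported in x minus the cone, hence in Ω, and is an admissible test field. For x
outside the larger ball both sides vanish, since f and v live in the ball of half the radius and the
cone is shorter than r/2. -/
lemma conv_difference_ae [NeZero n] {η : Rn n → ℝ} {b x₀ : Rn n} {κ r : ℝ} (hη : IsTest η)
    (hηs : tsupport η ⊆ Metric.closedBall b κ) (hball : coneHull b κ ⊆ Metric.ball 0 (r / 2))
    (hcone : ∀ x ∈ Ω ∩ Metric.ball x₀ r, ∀ z ∈ coneHull b κ, x - z ∈ Ω)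
    {f : LpFull n p} {v : Fin n → LpFull n p} (h : IsWeakPair Ω f v)
    (hf : ∀ᵐ x, x ∉ Metric.ball x₀ (r / 2) → f x = 0)
    (hv : ∀ i, ∀ᵐ x, x ∉ Metric.ball x₀ (r / 2) → v i x = 0) (k : ℕ) :
    ∀ᵐ x, x ∈ Ω → (conv p (toLOne (dyBump η (k + 1))) f - conv p (toLOne (dyBump η k)) f) x =
      (∑ i, conv p (toLOne (dyField η k i)) (v i)) x := by
  have ht := isTest_dyField hη hηs k
  have hs := tsupport_dyField_subset hηs k
  have h3 : ∀ᵐ x, ∀ i, conv p (toLOne (dyField η k i)) (v i) x =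
      ∫ y, v i y * dyField η k i (x - y) :=
    ae_all_iff.2 fun i => conv_toLOne_ae_eq' (ht i).integrable (v i)
  filter_upwards [conv_toLOne_ae_eq' (isTest_dyBump hη (k + 1)).integrable f,
    conv_toLOne_ae_eq' (isTest_dyBump hη k).integrable f, h3,
    Lp.coeFn_sub (conv p (toLOne (dyBump η (k + 1))) f) (conv p (toLOne (dyBump η k)) f),
    Lp.coeFn_finsetSum Finset.univ fun i => conv p (toLOne (dyField η k i)) (v i)]
    with x e1 e2 e3 e4 e5 hxΩ
  rw [e4, Pi.sub_apply, e1, e2, e5, Finset.sum_apply]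
  simp only [e3]
  have hb1 := ((isTest_dyBump hη (k + 1)).comp_sub_left x).allMemLp
  have hb2 := ((isTest_dyBump hη k).comp_sub_left x).allMemLp
  rw [← integral_sub (hb1.integrable_mul f) (hb2.integrable_mul f)]
  simp only [← mul_sub, ← sum_pd_dyField hη hηs, Finset.mul_sum]
  rw [integral_finsetSum _ fun i _ => (((ht i).pd i).comp_sub_left x).allMemLp.integrable_mul f]
  refine Finset.sum_congr rfl fun i _ => ?_
  by_cases hx : x ∈ Metric.ball x₀ r
  · have hsub : tsupport (fun y => dyField η k i (x - y)) ⊆ Ω := by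
      intro y hy
      have h1 : x - y ∈ tsupport (dyField η k i) := by
        have := tsupport_comp_subset_preimage (dyField η k i)
          (f := fun y => x - y) (by fun_prop)
        exact this hy
      have := hcone x ⟨hxΩ, hx⟩ _ (hs i h1)
      simpa using this
    have h1 := h i _ ((ht i).comp_sub_left x) hsub
    simp only [pd_comp_sub_left (ht i).differentiable, mul_neg, integral_neg, neg_inj] at h1
    exact h1
  · have hz : ∀ y, x - y ∈ tsupport (dyField η k i) → y ∉ Metric.ball x₀ (r / 2) := by
      intro y hy hyb
      have h1 : ‖x - y‖ < r / 2 := mem_ball_zero_iff.1 (hball (hs i hy))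
      have h2 : ‖y - x₀‖ < r / 2 := mem_ball_iff_norm.1 hyb
      refine hx (mem_ball_iff_norm.2 ?_)
      calc ‖x - x₀‖ = ‖(x - y) + (y - x₀)‖ := by congr 1; abel
        _ ≤ ‖x - y‖ + ‖y - x₀‖ := norm_add_le _ _
        _ < r := by linarith
    have z1 : ∫ y, f y * pd i (dyField η k i) (x - y) = 0 := by
      refine integral_eq_zero_of_ae ?_
      filter_upwards [hf] with y hy
      by_cases hm : x - y ∈ tsupport (dyField η k i)
      · simp [hy (hz y hm)]
      · have : pd i (dyField η k i) (x - y) = 0 := by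
          by_contra h0
          exact hm (tsupport_pd_subset _ i (subset_tsupport _ h0))
        simp [this]
    have z2 : ∫ y, v i y * dyField η k i (x - y) = 0 := by
      refine integral_eq_zero_of_ae ?_
      filter_upwards [hv i] with y hy
      by_cases hm : x - y ∈ tsupport (dyField η k i)
      · simp [hy (hz y hm)]
      · simp [image_eq_zero_of_notMem_tsupport hm]
    rw [z1, z2]

/-- Restriction to `Ω`, extended by zero. -/
def cut (p : ℝ≥0∞) [Fact (1 ≤ p)] {Ω : Set (Rn n)} (hΩ : MeasurableSet Ω) :
    LpFull n p →L[ℝ] LpFull n p := mulOp p (bddMeas_indicator hΩ)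

omit [Fact (p ≠ ⊤)] in
lemma cut_congr (hΩ : MeasurableSet Ω) {f g : LpFull n p} (h : ∀ᵐ x, x ∈ Ω → f x = g x) :
    cut p hΩ f = cut p hΩ g := by
  refine Lp.ext ?_
  filter_upwards [h, coeFn_mulOp (bddMeas_indicator hΩ) f,
    coeFn_mulOp (bddMeas_indicator hΩ) g] with x h1 h2 h3
  change mulOp p _ f x = mulOp p _ g x
  rw [h2, h3]
  by_cases hx : x ∈ Ω
  · rw [h1 hx]
  · simp [hx]

/-- The differences telescope over the dyadic scales, and the bumps are an approximate identity. -/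
lemma local_representation [NeZero n] (hΩ : MeasurableSet Ω) {η : Rn n → ℝ} {b x₀ : Rn n}
    {κ r : ℝ} (hη : IsTest η) (h1 : ∫ x, η x = 1)
    (hηs : tsupport η ⊆ Metric.closedBall b κ) (hball : coneHull b κ ⊆ Metric.ball 0 (r / 2))
    (hcone : ∀ x ∈ Ω ∩ Metric.ball x₀ r, ∀ z ∈ coneHull b κ, x - z ∈ Ω)
    {f : LpFull n p} {v : Fin n → LpFull n p} (h : IsWeakPair Ω f v)
    (hf : ∀ᵐ x, x ∉ Metric.ball x₀ (r / 2) → f x = 0)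
    (hv : ∀ i, ∀ᵐ x, x ∉ Metric.ball x₀ (r / 2) → v i x = 0) :
    cut p hΩ f = cut p hΩ (conv p (toLOne (dyBump η 0)) f + ∑ i, conv p (dyPhi η i) (v i)) := by
  have hk : ∀ N, cut p hΩ (conv p (toLOne (dyBump η N)) f) =
      cut p hΩ (conv p (toLOne (dyBump η 0)) f +
        ∑ i, conv p (∑ k ∈ Finset.range N, toLOne (dyField η k i)) (v i)) := by
    intro N
    induction N with
    | zero => simp
    | succ N ih =>
      have := cut_congr hΩ (conv_difference_ae hη hηs hball hcone h hf hv N)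
      rw [map_sub, sub_eq_iff_eq_add] at this
      rw [this, ih, ← map_add]
      congr 1
      simp only [Finset.sum_range_succ, map_add, _root_.add_apply, Finset.sum_add_distrib]
      abel
  have l1 : Tendsto (fun N => cut p hΩ (conv p (toLOne (dyBump η N)) f)) atTop
      (𝓝 (cut p hΩ f)) :=
    ((cut p hΩ).continuous.tendsto f).comp (tendsto_conv_dyBump hη h1 f)
  have l2 : Tendsto (fun N => cut p hΩ (conv p (toLOne (dyBump η 0)) f +
        ∑ i, conv p (∑ k ∈ Finset.range N, toLOne (dyField η k i)) (v i))) atTop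
      (𝓝 (cut p hΩ (conv p (toLOne (dyBump η 0)) f + ∑ i, conv p (dyPhi η i) (v i)))) := by
    refine ((cut p hΩ).continuous.tendsto _).comp (tendsto_const_nhds.add
      (tendsto_finsetSum _ fun i _ => ?_))
    exact (((conv p).flip (v i)).continuous.tendsto (dyPhi η i)).comp
      (summable_dyField hη hηs i).hasSum.tendsto_sum_nat
  simp only [hk] at l1
  exact tendsto_nhds_unique l1 l2

/-- Representation of Sobolev functions on a Lipschitz domain by their gradients. -/
lemma IsBoundedLipschitzDomain.exists_representation [NeZero n]
    (hΩ : IsBoundedLipschitzDomain Ω) (p : ℝ≥0∞) [Fact (1 ≤ p)] [Fact (p ≠ ⊤)] :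
    ∃ (ι : Type) (_ : Fintype ι) (χ η : ι → Rn n → ℝ) (hχ : ∀ j, IsTest (χ j)),
      (∀ j, IsTest (η j)) ∧ (∀ j, ∃ b κ, tsupport (η j) ⊆ Metric.closedBall b κ) ∧
      (∀ x ∈ Ω, ∑ j, χ j x = 1) ∧
      ∀ j (f : LpFull n p) (v : Fin n → LpFull n p), IsWeakPair Ω f v →
        cut p hΩ.isOpen.measurableSet (mulOp p (hχ j).bddMeas f) =
        cut p hΩ.isOpen.measurableSet
          (conv p (toLOne (dyBump (η j) 0)) (mulOp p (hχ j).bddMeas f) +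
            ∑ i, conv p (dyPhi (η j) i)
              (mulOp p (hχ j).bddMeas (v i) + mulOp p ((hχ j).pd i).bddMeas f)) := by
  have hcomp : IsCompact (closure Ω) := hΩ.isBounded.isCompact_closure
  choose! r hr b κ hκ hball hcone using fun x₀ (hx₀ : x₀ ∈ closure Ω) => hΩ.exists_cone hx₀
  -- Half radii, so that the localized functions vanish outside the ball required by
  -- `local_representation`.
  obtain ⟨t, ht, hcov⟩ := hcomp.elim_nhds_subcover (fun x => Metric.ball x (r x / 2))
    fun x hx => Metric.ball_mem_nhds x (by have := hr x hx; positivity)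
  have hcov' : closure Ω ⊆ ⋃ j : t, Metric.ball (j : Rn n) (r j / 2) := by
    intro x hx
    simpa using hcov hx
  obtain ⟨χ, hχ, hχs, hχ1⟩ := exists_partition isClosed_closure (fun j : t => (j : Rn n))
    (fun j => r j / 2) hcov'
  choose η hη hηs hη1 using fun j : t => exists_bump (b j) (hκ j (ht j j.2))
  refine ⟨t, inferInstance, χ, η, hχ, hη, fun j => ⟨_, _, hηs j⟩,
    fun x hx => hχ1 x (subset_closure hx), fun j f v h => ?_⟩
  have z1 : ∀ x ∉ Metric.ball (j : Rn n) (r j / 2), χ j x = 0 := fun x hx =>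
    image_eq_zero_of_notMem_tsupport fun h => hx (hχs j h)
  have z2 : ∀ i, ∀ x ∉ Metric.ball (j : Rn n) (r j / 2), pd i (χ j) x = 0 := fun i x hx =>
    image_eq_zero_of_notMem_tsupport fun h => hx (hχs j (tsupport_pd_subset _ i h))
  refine local_representation hΩ.isOpen.measurableSet (hη j) (hη1 j) (hηs j) (hball j (ht j j.2))
    (hcone j (ht j j.2)) (h.mul (hχ j)) ?_ fun i => ?_
  · filter_upwards [coeFn_mulOp (hχ j).bddMeas f] with x hx hxb
    rw [hx, z1 x hxb, zero_mul]
  · filter_upwards [coeFn_mulOp (hχ j).bddMeas (v i), coeFn_mulOp ((hχ j).pd i).bddMeas f,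
      Lp.coeFn_add (mulOp p (hχ j).bddMeas (v i)) (mulOp p ((hχ j).pd i).bddMeas f)]
      with x h1 h2 h3 hxb
    rw [h3, Pi.add_apply, h1, h2, z1 x hxb, z2 i x hxb, zero_mul, zero_mul, add_zero]

end WeakPair

/-! ### Kernels with integrable weak derivatives -/

section WeakDeriv

variable {n : ℕ} {p : ℝ≥0∞} [Fact (1 ≤ p)] [Fact (p ≠ ⊤)]

/-- `k'` is the weak derivative of the integrable function `k` in direction `l`. -/
def IsWeakDeriv (l : Fin n) (k k' : LpFull n 1) : Prop :=
  ∀ Θ : Rn n → ℝ, IsTest Θ → ∫ x, k x * pd l Θ x = -∫ x, k' x * Θ x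

lemma pd_comp_add_right {f : Rn n → ℝ} (l : Fin n) (x y : Rn n) :
    pd l (fun y => f (y + x)) y = pd l f (y + x) := by
  unfold pd
  rw [fderiv_comp_add_right]

/-- By the adjoint formula the pairing becomes one of the kernel with a translated test function, so
the derivative falls on the kernel and none is required of `g`. -/
lemma IsWeakDeriv.conv {l : Fin n} {k k' : LpFull n 1} (h : IsWeakDeriv l k k') (g : LpFull n p)
    {ψ : Rn n → ℝ} (hψ : IsTest ψ) :
    ∫ x, FiniteHorizon.conv p k g x * pd l ψ x = -∫ x, FiniteHorizon.conv p k' g x * ψ x := by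
  rw [integral_conv_mul_eq (hψ.pd l).allMemLp, integral_conv_mul_eq hψ.allMemLp, ← integral_neg]
  refine integral_congr_ae (Eventually.of_forall fun x => ?_)
  have e := h _ (hψ.comp_add_right x)
  simp only [pd_comp_add_right] at e
  simp only [add_comm x, e, mul_neg]

lemma IsWeakDeriv.conv_right {l : Fin n} {k k' : LpFull n 1} (h : IsWeakDeriv l k k')
    (g : LpFull n 1) : IsWeakDeriv l (FiniteHorizon.conv 1 k g) (FiniteHorizon.conv 1 k' g) :=
  fun _ hΘ => h.conv g hΘ

lemma IsWeakDeriv.smul {l : Fin n} {k k' : LpFull n 1} (h : IsWeakDeriv l k k') (c : ℝ) :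
    IsWeakDeriv l (c • k) (c • k') := fun Θ hΘ => by
  have := h Θ hΘ
  rw [← pairing_apply (hΘ.pd l).allMemLp, ← pairing_apply hΘ.allMemLp] at this ⊢
  rw [map_smul, map_smul, this, smul_neg]

lemma isWeakDeriv_toLOne {φ : Rn n → ℝ} (hφ : IsTest φ) (l : Fin n) :
    IsWeakDeriv l (toLOne φ) (toLOne (pd l φ)) := fun Θ hΘ => by
  rw [integral_toLOne_mul hφ.integrable, integral_toLOne_mul (hφ.pd l).integrable]
  exact integral_mul_pd (hφ.smooth.of_le (by simp)) hΘ l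

lemma isWeakDeriv_besselB {a : ℝ} (ha0 : 0 < a) (ha1 : a < 1 / 2) (l : Fin n) :
    IsWeakDeriv l (besselB n a) (besselBDeriv a l) := fun _ hΘ =>
  integral_besselB_mul_pd ha0 ha1 hΘ l

end WeakDeriv

/-! ### The local Sobolev space as a closed subspace -/

section Sobolev

variable {n : ℕ} {p : ℝ≥0∞} [Fact (1 ≤ p)] {Ω : Set (Rn n)}

/-- Pairs of a function and a vector field. -/
abbrev LpPair (n : ℕ) (p : ℝ≥0∞) : Type := LpFull n p × (Fin n → LpFull n p)

lemma isWeakPair_iff {f : LpFull n p} {v : Fin n → LpFull n p} : IsWeakPair Ω f v ↔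
    ∀ (i : Fin n) (ψ : Rn n → ℝ) (hψ : IsTest ψ), tsupport ψ ⊆ Ω →
      pairing p (hψ.pd i).allMemLp f + pairing p hψ.allMemLp (v i) = 0 := by
  simp only [pairing_apply, ← eq_neg_iff_add_eq_zero]
  exact Iff.rfl

/-- The Sobolev space `W^{1,p}(Ω)`, as a space of functions extended by zero together with their
weak gradients. -/
def sobolev (p : ℝ≥0∞) [Fact (1 ≤ p)] {Ω : Set (Rn n)} (hΩ : MeasurableSet Ω) :
    Submodule ℝ (LpPair n p) where
  carrier := {z | cut p hΩ z.1 = z.1 ∧ (∀ i, cut p hΩ (z.2 i) = z.2 i) ∧ IsWeakPair Ω z.1 z.2}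
  zero_mem' := by
    refine ⟨map_zero _, fun i => map_zero _, isWeakPair_iff.2 fun i ψ hψ _ => ?_⟩
    simp
  add_mem' := fun {a b} ha hb => by
    refine ⟨?_, fun i => ?_, isWeakPair_iff.2 fun i ψ hψ hs => ?_⟩
    · rw [Prod.fst_add, map_add, ha.1, hb.1]
    · rw [Prod.snd_add, Pi.add_apply, map_add, ha.2.1, hb.2.1]
    · have h1 := isWeakPair_iff.1 ha.2.2 i ψ hψ hs
      have h2 := isWeakPair_iff.1 hb.2.2 i ψ hψ hs
      rw [Prod.fst_add, Prod.snd_add, Pi.add_apply, map_add, map_add]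
      linarith
  smul_mem' := fun c a ha => by
    refine ⟨?_, fun i => ?_, isWeakPair_iff.2 fun i ψ hψ hs => ?_⟩
    · rw [Prod.smul_fst, map_smul, ha.1]
    · rw [Prod.smul_snd, Pi.smul_apply, map_smul, ha.2.1]
    · have h1 := isWeakPair_iff.1 ha.2.2 i ψ hψ hs
      rw [Prod.smul_fst, Prod.smul_snd, Pi.smul_apply, map_smul, map_smul, ← smul_add, h1,
        smul_zero]

/-- All conditions are equations between continuous linear maps. The resulting completeness is what
the open mapping argument needs. -/
lemma isClosed_sobolev (hΩ : MeasurableSet Ω) : IsClosed (sobolev p hΩ : Set (LpPair n p)) := by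
  have h : (sobolev p hΩ : Set (LpPair n p)) = {z | cut p hΩ z.1 = z.1} ∩
      ({z | ∀ i, cut p hΩ (z.2 i) = z.2 i} ∩ {z | ∀ (i : Fin n) (ψ : Rn n → ℝ) (hψ : IsTest ψ),
        tsupport ψ ⊆ Ω →
        pairing p (hψ.pd i).allMemLp z.1 + pairing p hψ.allMemLp (z.2 i) = 0}) := by
    ext z
    change (_ ∧ _ ∧ _) ↔ (_ ∧ _ ∧ _)
    rw [isWeakPair_iff]
    rfl
  rw [h]
  refine IsClosed.inter (isClosed_eq (by fun_prop) (by fun_prop)) (IsClosed.inter ?_ ?_)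
  · simp only [Set.ofPred_forall]
    exact isClosed_iInter fun i => isClosed_eq (by fun_prop) (by fun_prop)
  · simp only [Set.ofPred_forall]
    exact isClosed_iInter fun i => isClosed_iInter fun ψ => isClosed_iInter fun hψ =>
      isClosed_iInter fun _ => isClosed_eq (by fun_prop) continuous_const

lemma cut_cut (hΩ : MeasurableSet Ω) (f : LpFull n p) : cut p hΩ (cut p hΩ f) = cut p hΩ f := by
  refine cut_congr hΩ ?_
  filter_upwards [coeFn_mulOp (bddMeas_indicator hΩ) f] with x hx hxΩ
  change mulOp p _ f x = _
  rw [hx]; simp [hxΩ]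

lemma integral_cut_mul (hΩ : MeasurableSet Ω) (f : LpFull n p) {h : Rn n → ℝ}
    (hh : ∀ x ∉ Ω, h x = 0) : ∫ x, cut p hΩ f x * h x = ∫ x, f x * h x := by
  unfold cut
  rw [integral_mulOp_mul]
  refine integral_congr_ae (Eventually.of_forall fun x => ?_)
  by_cases hx : x ∈ Ω
  · simp [hx]
  · simp [hx, hh x hx]

end Sobolev

/-! ### Operators built from localizations and convolutions -/

section Synthesis

variable {n : ℕ} {p : ℝ≥0∞} [Fact (1 ≤ p)] [Fact (p ≠ ⊤)] {ι : Type} [Fintype ι]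
  {χ : ι → Rn n → ℝ}

/-- Superposition of convolutions of localizations of a function and its gradient. -/
def synth (p : ℝ≥0∞) [Fact (1 ≤ p)] [Fact (p ≠ ⊤)] (hχ : ∀ j, IsTest (χ j))
    (k₀ : ι → LpFull n 1) (k₁ : ι → Fin n → LpFull n 1) : LpPair n p →L[ℝ] LpFull n p :=
  ∑ j, ((conv p (k₀ j) ∘L mulOp p (hχ j).bddMeas) ∘L .fst ℝ _ _ +
    ∑ i, ((conv p (k₁ j i) ∘L mulOp p (hχ j).bddMeas) ∘L (.proj i ∘L .snd ℝ _ _) +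
      (conv p (k₁ j i) ∘L mulOp p ((hχ j).pd i).bddMeas) ∘L .fst ℝ _ _))

variable {hχ : ∀ j, IsTest (χ j)}

lemma synth_apply (k₀ : ι → LpFull n 1) (k₁ : ι → Fin n → LpFull n 1) (z : LpPair n p) :
    synth p hχ k₀ k₁ z = ∑ j, (conv p (k₀ j) (mulOp p (hχ j).bddMeas z.1) +
      ∑ i, conv p (k₁ j i)
        (mulOp p (hχ j).bddMeas (z.2 i) + mulOp p ((hχ j).pd i).bddMeas z.1)) := by
  simp [synth]

lemma synth_add (k₀ k₀' : ι → LpFull n 1) (k₁ k₁' : ι → Fin n → LpFull n 1) (z : LpPair n p) :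
    synth p hχ (k₀ + k₀') (k₁ + k₁') z = synth p hχ k₀ k₁ z + synth p hχ k₀' k₁' z := by
  simp only [synth_apply, ← Finset.sum_add_distrib, Pi.add_apply, map_add (conv p),
    _root_.add_apply]
  refine Finset.sum_congr rfl fun j _ => ?_
  rw [Finset.sum_add_distrib]
  abel

/-- Together with `synth_add` this reduces identities between such operators to identities between
their kernels. -/
lemma conv_synth (k : LpFull n 1) (k₀ : ι → LpFull n 1) (k₁ : ι → Fin n → LpFull n 1)
    (z : LpPair n p) : conv p k (synth p hχ k₀ k₁ z) =
      synth p hχ (fun j => conv 1 k (k₀ j)) (fun j i => conv 1 k (k₁ j i)) z := by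
  simp only [synth_apply, map_sum, map_add (conv p k), conv_conv]

lemma IsTest.exists_radius {φ : Rn n → ℝ} (h : IsTest φ) : ∃ R, ∀ x, R < ‖x‖ → φ x = 0 := by
  obtain ⟨R, hR⟩ := h.compact.isCompact.isBounded.subset_closedBall 0
  refine ⟨R, fun x hx => image_eq_zero_of_notMem_tsupport fun hm => ?_⟩
  have := hR hm
  rw [mem_closedBall_zero_iff] at this
  linarith

/-- Every convolution is preceded by multiplication with a compactly supported function, so each
summand is a localized convolution with an L¹ kernel. -/
lemma isCompactOperator_synth (k₀ : ι → LpFull n 1) (k₁ : ι → Fin n → LpFull n 1) :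
    IsCompactOperator (synth p hχ k₀ k₁) := by
  have hc : ∀ (k : LpFull n 1) {φ : Rn n → ℝ} (hφ : IsTest φ) (T : LpPair n p →L[ℝ] LpFull n p),
      (conv p k ∘L mulOp p hφ.bddMeas) ∘L T ∈ {T : LpPair n p →L[ℝ] LpFull n p |
        IsCompactOperator T} := fun k φ hφ T => by
    obtain ⟨R, hR⟩ := hφ.exists_radius
    exact (isCompactOperator_conv_mulOp k hφ.bddMeas hR).comp_clm T
  have hm : ∀ T : LpPair n p →L[ℝ] LpFull n p, T ∈ compactOperator (RingHom.id ℝ) (LpPair n p)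
      (LpFull n p) ↔ IsCompactOperator T := fun T => Iff.rfl
  rw [← hm]
  exact Submodule.sum_mem _ fun j _ => Submodule.add_mem _ (hc (k₀ j) (hχ j) _)
    (Submodule.sum_mem _ fun i _ => Submodule.add_mem _ (hc (k₁ j i) (hχ j) _)
      (hc (k₁ j i) ((hχ j).pd i) _))

lemma integral_synth_mul_pd {l : Fin n} {k₀ k₀' : ι → LpFull n 1}
    {k₁ k₁' : ι → Fin n → LpFull n 1} (h₀ : ∀ j, IsWeakDeriv l (k₀ j) (k₀' j))
    (h₁ : ∀ j i, IsWeakDeriv l (k₁ j i) (k₁' j i)) (z : LpPair n p) {ψ : Rn n → ℝ}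
    (hψ : IsTest ψ) :
    ∫ x, synth p hχ k₀ k₁ z x * pd l ψ x = -∫ x, synth p hχ k₀' k₁' z x * ψ x := by
  have e : ∀ {k k' : LpFull n 1}, IsWeakDeriv l k k' → ∀ g : LpFull n p,
      pairing p (hψ.pd l).allMemLp (conv p k g) = -pairing p hψ.allMemLp (conv p k' g) :=
    fun h g => by rw [pairing_apply, pairing_apply]; exact h.conv g hψ
  rw [← pairing_apply (hψ.pd l).allMemLp, ← pairing_apply hψ.allMemLp, synth_apply, synth_apply]
  simp only [map_sum, map_add (pairing p _), ← Finset.sum_neg_distrib, neg_add]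
  refine Finset.sum_congr rfl fun j _ => ?_
  rw [e (h₀ j)]
  congr 1
  exact Finset.sum_congr rfl fun i _ => e (h₁ j i) _

end Synthesis

/-! ### The right parametrix of the convolution with the potential -/

section Parametrix

variable {n : ℕ} [NeZero n] {p : ℝ≥0∞} [Fact (1 ≤ p)] [Fact (p ≠ ⊤)] {Ω : Set (Rn n)}
  {s δ : ℝ} {w : Cutoff n δ}

/-- Sequences whose convolution with the potential is weakly null in `W^{1,p}(Ω)` approach the
kernel of this convolution. -/
theorem exists_ker_approx_potential (hs : 0 < s) (hδ : 0 < δ) (hs1 : s < 1)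
    (hΩ : IsBoundedLipschitzDomain Ω) {u : ℕ → LpFull n p}
    {z : ℕ → sobolev p hΩ.isOpen.measurableSet}
    (huz : ∀ j, cut p hΩ.isOpen.measurableSet (conv p (toLOne (potential s w)) (u j)) =
      (z j : LpPair n p).1)
    (hz : ∀ g : sobolev p hΩ.isOpen.measurableSet →L[ℝ] ℝ,
      Tendsto (fun j => g (z j)) atTop (𝓝 0)) :
    ∃ k : ℕ → LpFull n p,
      (∀ j, cut p hΩ.isOpen.measurableSet (conv p (toLOne (potential s w)) (k j)) = 0) ∧
      Tendsto (fun j => u j - k j) atTop (𝓝 0) := by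
  have hm := hΩ.isOpen.measurableSet
  set a := (1 - s) / 2 with ha
  have ha0 : 0 < a := by simp only [ha]; linarith
  have ha1 : a < 1 / 2 := by simp only [ha]; linarith
  set C := scaling s w / subordConst n s * betaConst a with hC
  have hC0 : C ≠ 0 := mul_ne_zero (div_pos (scaling_spec hs1 hδ (NeZero.pos n) w).1
    (subordConst_pos hs)).ne' (betaConst_ne_zero ha0 (by linarith))
  obtain ⟨ι, _, χ, η, hχ, hη, hηs, hχ1, hrep⟩ := hΩ.exists_representation p
  have : CompleteSpace (sobolev p hm) := (isClosed_sobolev hm).completeSpace_coe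
  let S := (sobolev p hm).subtypeL
  -- Kernels of the error. The potential turns C⁻¹Ψ_i into Φ_i plus `k₁`, while f is the bump term
  -- plus the Φ_i terms; the missing bump term enters with a minus sign. The primed kernels are the
  -- weak derivatives, in L¹ because a < 1/2.
  let k₀ : ι → LpFull n 1 := fun j => (-1 : ℝ) • toLOne (dyBump (η j) 0)
  let k₀' : Fin n → ι → LpFull n 1 := fun l j => (-1 : ℝ) • toLOne (pd l (dyBump (η j) 0))
  let k₁ : ι → Fin n → LpFull n 1 := fun j i =>
    C⁻¹ • conv 1 (besselB n a) (conv 1 (factorRemainder s w) (dyPhi (η j) i))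
  let k₁' : Fin n → ι → Fin n → LpFull n 1 := fun l j i =>
    C⁻¹ • conv 1 (besselBDeriv a l) (conv 1 (factorRemainder s w) (dyPhi (η j) i))
  have hk₀ : ∀ l j, IsWeakDeriv l (k₀ j) (k₀' l j) := fun l j =>
    (isWeakDeriv_toLOne (isTest_dyBump (hη j) 0) l).smul _
  have hk₁ : ∀ l j i, IsWeakDeriv l (k₁ j i) (k₁' l j i) := fun l j i =>
    ((isWeakDeriv_besselB ha0 ha1 l).conv_right _).smul _
  -- The representation of f with each Φ_i replaced by C⁻¹Ψ_i and the bump term dropped.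
  let A : sobolev p hm →L[ℝ] LpFull n p :=
    synth p hχ 0 (fun j i => C⁻¹ • dyPsi a (η j) i) ∘L S
  -- The error together with its gradient, so that it takes values in the Sobolev space and is
  -- compact there, not merely in L^p.
  let K' : LpPair n p →L[ℝ] LpPair n p :=
    (cut p hm ∘L synth p hχ k₀ k₁).prod
      (ContinuousLinearMap.pi fun l => cut p hm ∘L synth p hχ (k₀' l) (k₁' l))
  have hK'mem : ∀ y, K' y ∈ sobolev p hm := by
    refine fun y => ⟨cut_cut hm _, fun i => cut_cut hm _, fun i ψ hψ hsψ => ?_⟩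
    have hψ0 : ∀ x ∉ Ω, ψ x = 0 := fun x hx =>
      image_eq_zero_of_notMem_tsupport fun h => hx (hsψ h)
    have hψ1 : ∀ x ∉ Ω, pd i ψ x = 0 := fun x hx =>
      image_eq_zero_of_notMem_tsupport fun h => hx (hsψ (tsupport_pd_subset ψ i h))
    exact (integral_cut_mul hm _ hψ1).trans ((integral_synth_mul_pd (hk₀ i) (hk₁ i) y hψ).trans
      (congrArg Neg.neg (integral_cut_mul hm _ hψ0).symm))
  have hK'c : IsCompactOperator K' := by
    have e : K' = (ContinuousLinearMap.inl ℝ _ _) ∘L (cut p hm ∘L synth p hχ k₀ k₁) +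
        ∑ l, (ContinuousLinearMap.inr ℝ _ _ ∘L ContinuousLinearMap.single ℝ _ l) ∘L
          (cut p hm ∘L synth p hχ (k₀' l) (k₁' l)) := by
      refine ContinuousLinearMap.ext fun y => Prod.ext ?_ (funext fun l => ?_)
      · simp [K', _root_.sum_apply, Prod.fst_sum]
      · simp [K', _root_.sum_apply, Prod.snd_sum, Finset.sum_apply, Pi.single_apply]
    have hmem : ∀ T : LpPair n p →L[ℝ] LpPair n p,
        T ∈ compactOperator (RingHom.id ℝ) (LpPair n p) (LpPair n p) ↔ IsCompactOperator T :=
      fun T => Iff.rfl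
    rw [← hmem, e]
    have hT : ∀ (T : LpFull n p →L[ℝ] LpPair n p) (b₀ : ι → LpFull n 1)
        (b₁ : ι → Fin n → LpFull n 1), T ∘L (cut p hm ∘L synth p hχ b₀ b₁) ∈
          compactOperator (RingHom.id ℝ) (LpPair n p) (LpPair n p) := fun T b₀ b₁ =>
      ((isCompactOperator_synth (p := p) (hχ := hχ) b₀ b₁).clm_comp (cut p hm)).clm_comp T
    exact Submodule.add_mem _ (hT _ _ _) (Submodule.sum_mem _ fun l _ => hT _ _ _)
  let K : sobolev p hm →L[ℝ] sobolev p hm := (K' ∘L S).codRestrict _ fun y => hK'mem _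
  have hKc : IsCompactOperator K :=
    (hK'c.comp_clm S).codRestrict (fun y => hK'mem _) (isClosed_sobolev hm)
  refine exists_ker_approx (Q := cut p hm ∘L conv p (toLOne (potential s w)))
    (ι := (ContinuousLinearMap.fst ℝ _ _) ∘L S) (A := A) (K := K)
    ((isCompactOperator_synth _ _).comp_clm S) hKc (fun y => ?_) huz hz
  obtain ⟨⟨f, v⟩, hf, -, hw⟩ := y
  replace hf : cut p hm f = f := hf
  change cut p hm (conv p (toLOne (potential s w)) (synth p hχ 0 _ (f, v))) =
    f + cut p hm (synth p hχ k₀ k₁ (f, v))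
  -- The local representations add up to f on Ω, because the cut-offs add up to 1 there.
  have e1 : cut p hm (synth p hχ (fun j => toLOne (dyBump (η j) 0))
      (fun j i => dyPhi (η j) i) (f, v)) = f := by
    rw [synth_apply, map_sum]
    simp only [← hrep _ f v hw]
    rw [← map_sum]
    rw [← hf]
    refine (cut_congr hm ?_).trans (cut_cut hm f)
    have h2 : ∀ᵐ x, ∀ j, mulOp p (hχ j).bddMeas (cut p hm f) x = χ j x * cut p hm f x :=
      ae_all_iff.2 fun j => coeFn_mulOp _ _
    filter_upwards [h2, Lp.coeFn_finsetSum Finset.univ fun j =>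
      mulOp p (hχ j).bddMeas (cut p hm f)] with x h3 h4 hx
    rw [h4, Finset.sum_apply]
    simp only [h3]
    rw [← Finset.sum_mul, hχ1 x hx, one_mul]
  have e2 : synth p hχ (fun j => conv 1 (toLOne (potential s w)) ((0 : ι → LpFull n 1) j))
      (fun j i => conv 1 (toLOne (potential s w)) (C⁻¹ • dyPsi a (η j) i)) (f, v) =
      synth p hχ (fun j => toLOne (dyBump (η j) 0)) (fun j i => dyPhi (η j) i) (f, v) +
        synth p hχ k₀ k₁ (f, v) := by
    rw [← synth_add]
    congr 2
    · funext j
      simp [k₀]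
    · funext j i
      obtain ⟨b, κ, hb⟩ := hηs j
      simp only [Pi.add_apply, k₁]
      rw [map_smul, conv_potential_dyPsi hs hδ hs1 (hη j) hb i, conv_conv, smul_add, smul_smul,
        inv_mul_cancel₀ hC0, one_smul]
  rw [conv_synth, e2, map_add, e1]

end Parametrix

/-! ### Extension by zero and restriction -/

section ZeroExtension

variable {n : ℕ} {p : ℝ≥0∞} [Fact (1 ≤ p)] {S : Set (Rn n)}

/-- Extension by zero. -/
def zeroExt (p : ℝ≥0∞) [Fact (1 ≤ p)] (hS : MeasurableSet S) :
    Lp ℝ p (volume.restrict S) →ₗᵢ[ℝ] LpFull n p where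
  toFun f := ((memLp_indicator_iff_restrict hS).2 (Lp.memLp f)).toLp
  map_add' f g := by
    rw [← MemLp.toLp_add]
    refine MemLp.toLp_congr _ _ ?_
    filter_upwards [(ae_restrict_iff' hS).1 (Lp.coeFn_add f g)] with x hx
    by_cases h : x ∈ S
    · simpa [h] using hx h
    · simp [h]
  map_smul' c f := by
    rw [RingHom.id_apply, ← MemLp.toLp_const_smul]
    refine MemLp.toLp_congr _ _ ?_
    filter_upwards [(ae_restrict_iff' hS).1 (Lp.coeFn_smul c f)] with x hx
    by_cases h : x ∈ S
    · simp [h, hx h]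
    · simp [h]
  norm_map' f := by
    change ‖((memLp_indicator_iff_restrict hS).2 (Lp.memLp f)).toLp‖ = _
    rw [Lp.norm_toLp, eLpNorm_indicator_eq_eLpNorm_restrict hS, Lp.norm_def]

lemma coeFn_zeroExt (hS : MeasurableSet S) (f : Lp ℝ p (volume.restrict S)) :
    zeroExt p hS f =ᵐ[volume] S.indicator f :=
  ((memLp_indicator_iff_restrict hS).2 (Lp.memLp f)).coeFn_toLp

lemma integral_zeroExt_mul (hS : MeasurableSet S) (f : Lp ℝ p (volume.restrict S))
    (h : Rn n → ℝ) : ∫ x, zeroExt p hS f x * h x = ∫ x in S, f x * h x := by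
  rw [← integral_indicator hS]
  refine integral_congr_ae ?_
  filter_upwards [coeFn_zeroExt hS f] with x hx
  rw [hx, Set.indicator_mul_left]

/-- Restriction to a subset. -/
def restr (p : ℝ≥0∞) [Fact (1 ≤ p)] (S : Set (Rn n)) :
    LpFull n p →L[ℝ] Lp ℝ p (volume.restrict S) :=
  LpToLpRestrictCLM (Rn n) ℝ ℝ volume p S

lemma restr_zeroExt (hS : MeasurableSet S) (f : Lp ℝ p (volume.restrict S)) :
    restr p S (zeroExt p hS f) = f := by
  refine Lp.ext ((LpToLpRestrictCLM_coeFn ℝ S _).trans ?_)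
  exact EventuallyEq.trans (ae_restrict_of_ae (coeFn_zeroExt hS f)) (indicator_ae_eq_restrict hS)

lemma cut_zeroExt (hS : MeasurableSet S) (f : Lp ℝ p (volume.restrict S)) :
    cut p hS (zeroExt p hS f) = zeroExt p hS f := by
  refine Lp.ext ?_
  filter_upwards [coeFn_mulOp (bddMeas_indicator hS) (zeroExt p hS f), coeFn_zeroExt hS f]
    with x hx h2
  change mulOp p _ _ x = _
  rw [hx, h2]
  by_cases h : x ∈ S <;> simp [h]

lemma locallyIntegrableOn_Lp {E : Type*} [NormedAddCommGroup E]
    (f : Lp E p (volume.restrict S)) : LocallyIntegrableOn f S :=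
  locallyIntegrableOn_of_locallyIntegrable_restrict ((Lp.memLp f).locallyIntegrable Fact.out)

end ZeroExtension

/-! ### The nonlocal divergence as an adjoint of convolution and differentiation -/

section Divergence

variable {n : ℕ} {p : ℝ≥0∞} [Fact (1 ≤ p)] {Ω : Set (Rn n)} {s δ : ℝ} {w : Cutoff n δ}
  {ψ : Rn n → Rn n}

/-- The vector field with a single nonzero component. -/
def axisField (i : Fin n) (φ : Rn n → ℝ) (x : Rn n) : Rn n := φ x • EuclideanSpace.single i 1

lemma axisField_apply (i j : Fin n) (φ : Rn n → ℝ) (x : Rn n) :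
    axisField i φ x j = if j = i then φ x else 0 := by
  simp [axisField]

lemma IsTest.contDiff_axisField {φ : Rn n → ℝ} (h : IsTest φ) (i : Fin n) :
    ContDiff ℝ ∞ (axisField i φ) := h.smooth.smul contDiff_const

lemma IsTest.hasCompactSupport_axisField {φ : Rn n → ℝ} (h : IsTest φ) (i : Fin n) :
    HasCompactSupport (axisField i φ) := h.compact.smul_right

lemma tsupport_axisField_subset (φ : Rn n → ℝ) (i : Fin n) :
    tsupport (axisField i φ) ⊆ tsupport φ := tsupport_smul_subset_left φ _

lemma isTest_component (h1 : ContDiff ℝ ∞ ψ) (h2 : HasCompactSupport ψ) (i : Fin n) :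
    IsTest fun x => ψ x i :=
  ⟨contDiff_euclidean.1 h1 i, h2.comp_left (g := fun v : Rn n => v i) rfl⟩

lemma tsupport_component_subset (ψ : Rn n → Rn n) (i : Fin n) :
    tsupport (fun x => ψ x i) ⊆ tsupport ψ :=
  closure_mono fun x hx h => hx (by simp [h])

lemma allMemLp_nonlocalDiv (s : ℝ) (w : Cutoff n δ) (h1 : ContDiff ℝ ∞ ψ)
    (h2 : HasCompactSupport ψ) : AllMemLp (nonlocalDiv s w ψ) := by
  obtain ⟨K, hK⟩ := h1.lipschitzWith_of_hasCompactSupport h2 (by simp)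
  have hb : BddMeas (nonlocalDiv s w ψ) :=
    ⟨(stronglyMeasurable_nonlocalDiv s w h1.continuous).measurable, K * ∫ z, ‖kernel s w z‖,
      by positivity, norm_nonlocalDiv_le s w hK⟩
  obtain ⟨R, hR⟩ :=
    (h2.isCompact.add w.hasCompactSupport.isCompact).isBounded.subset_closedBall 0
  refine hb.allMemLp (R := R) fun x hx => nonlocalDiv_eq_zero s w fun h => ?_
  have := hR h
  rw [mem_closedBall_zero_iff] at this
  linarith

lemma nonlocalDiv_eq_zero_of_notMem (s : ℝ) (w : Cutoff n δ) (h3 : tsupport ψ ⊆ Ω) {x : Rn n}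
    (hx : x ∉ Metric.thickening δ Ω) : nonlocalDiv s w ψ x = 0 := by
  refine nonlocalDiv_eq_zero s w fun h => hx ?_
  rw [← add_ball_zero]
  exact Set.add_subset_add h3 w.tsupport_subset h

variable [NeZero n]

lemma nonlocalDiv_axisField (hs : 0 < s) (hδ : 0 < δ) (hs1 : s < 1) {φ : Rn n → ℝ}
    (hφ : IsTest φ) (i : Fin n) (x : Rn n) :
    nonlocalDiv s w (axisField i φ) x = ∫ z, potential s w z * pd i φ (x - z) := by
  have hc : ∀ j, (fun x => axisField i φ x j) = if j = i then φ else fun _ => 0 := fun j => by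
    funext x
    rw [axisField_apply]
    split_ifs <;> rfl
  rw [nonlocalDiv_eq hs hδ hs1 (isTest_component (hφ.contDiff_axisField i)
    (hφ.hasCompactSupport_axisField i)), Finset.sum_eq_single i]
  · simp [hc]
  · intro j _ hj
    simp [hc, hj, pd]
  · simp

lemma nonlocalDiv_eq_sum_axisField (hs : 0 < s) (hδ : 0 < δ) (hs1 : s < 1)
    (h1 : ContDiff ℝ ∞ ψ) (h2 : HasCompactSupport ψ) (x : Rn n) :
    nonlocalDiv s w ψ x = ∑ i, nonlocalDiv s w (axisField i fun x => ψ x i) x := by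
  rw [nonlocalDiv_eq hs hδ hs1 (isTest_component h1 h2)]
  exact Finset.sum_congr rfl fun i _ =>
    (nonlocalDiv_axisField hs hδ hs1 (isTest_component h1 h2 i) i x).symm

variable [Fact (p ≠ ⊤)]

lemma potential_neg (x : Rn n) : potential s w (-x) = potential s w x := by
  simp [potential]

/-- The nonlocal gradient is the gradient of the convolution with the potential. -/
lemma integral_conv_potential_mul_pd (hs : 0 < s) (hδ : 0 < δ) (hs1 : s < 1) (f : LpFull n p)
    {φ : Rn n → ℝ} (hφ : IsTest φ) (i : Fin n) :
    ∫ x, conv p (toLOne (potential s w)) f x * pd i φ x =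
      ∫ x, f x * nonlocalDiv s w (axisField i φ) x := by
  rw [integral_conv_mul_eq (hφ.pd i).allMemLp]
  refine integral_congr_ae (Eventually.of_forall fun x => ?_)
  simp only
  rw [integral_toLOne_mul (integrable_potential hs hδ hs1), nonlocalDiv_axisField hs hδ hs1 hφ,
    ← integral_neg_eq_self]
  simp [potential_neg, sub_eq_add_neg]

lemma sum_integral_conv_potential_mul_pd (hs : 0 < s) (hδ : 0 < δ) (hs1 : s < 1)
    (f : LpFull n p) (h1 : ContDiff ℝ ∞ ψ) (h2 : HasCompactSupport ψ) :
    ∑ i, ∫ x, conv p (toLOne (potential s w)) f x * pd i (fun x => ψ x i) x =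
      ∫ x, f x * nonlocalDiv s w ψ x := by
  have ht := isTest_component h1 h2
  simp only [nonlocalDiv_eq_sum_axisField hs hδ hs1 h1 h2, Finset.mul_sum]
  rw [integral_finsetSum _ fun i _ => (allMemLp_nonlocalDiv s w ((ht i).contDiff_axisField i)
    ((ht i).hasCompactSupport_axisField i)).integrable_mul f]
  exact Finset.sum_congr rfl fun i _ => integral_conv_potential_mul_pd hs hδ hs1 f (ht i) i

end Divergence

/-! ### The subspace of functions with zero nonlocal gradient -/

section ZeroGradient

variable {n : ℕ} {p : ℝ≥0∞} [Fact (1 ≤ p)] {Ω : Set (Rn n)} {s δ : ℝ} {w : Cutoff n δ}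

lemma measurableSet_thickening (δ : ℝ) (Ω : Set (Rn n)) :
    MeasurableSet (Metric.thickening δ Ω) := Metric.isOpen_thickening.measurableSet

/-- A description by the vanishing of continuous linear functionals on L^p(Ω_δ), from which
linearity and closedness of N are immediate. -/
lemma mem_zeroGrad_iff {h : LpThick n δ p Ω} : h ∈ zeroGrad s w p Ω ↔
    ∀ (ψ : Rn n → Rn n) (h1 : ContDiff ℝ ∞ ψ) (h2 : HasCompactSupport ψ), tsupport ψ ⊆ Ω →
      pairing p (allMemLp_nonlocalDiv s w h1 h2)
        (zeroExt p (measurableSet_thickening δ Ω) h) = 0 := by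
  simp only [pairing_apply, integral_zeroExt_mul]
  constructor
  · rintro ⟨u, rfl, hu⟩ ψ h1 h2 h3
    have e := u.2.integral_by_parts ψ h1 h2 h3
    change ∫ x in Ω, inner ℝ (HSpace.grad u x) (ψ x) =
      -∫ x in Metric.thickening δ Ω, HSpace.fn u x * nonlocalDiv s w ψ x at e
    rw [hu, integral_eq_zero_of_ae] at e
    · linarith
    · filter_upwards [Lp.coeFn_zero (Rn n) p (volume.restrict Ω)] with x hx
      rw [hx]; simp
  · intro H
    have hw : IsWeakNonlocalGradient s w Ω h (0 : Rn n → Rn n) :=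
      { locallyIntegrableOn_fun := locallyIntegrableOn_Lp h
        locallyIntegrableOn_grad := locallyIntegrableOn_zero
        integral_by_parts := fun ψ h1 h2 h3 => by
          rw [H ψ h1 h2 h3]; simp }
    exact ⟨⟨WithLp.toLp p (h, 0), hw.congr EventuallyEq.rfl (Lp.coeFn_zero _ _ _).symm⟩, rfl, rfl⟩

/-- The closed subspace of functions with zero nonlocal gradient. -/
def zeroGradSubmodule (s : ℝ) (w : Cutoff n δ) (p : ℝ≥0∞) [Fact (1 ≤ p)] (Ω : Set (Rn n)) : Submodule ℝ (LpThick n δ p Ω) where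
  carrier := zeroGrad s w p Ω
  zero_mem' := (mem_zeroGrad_iff).2 fun ψ h1 h2 _ => by rw [map_zero, map_zero]
  add_mem' := fun {a b} ha hb => (mem_zeroGrad_iff).2 fun ψ h1 h2 h3 => by
    rw [map_add, map_add, (mem_zeroGrad_iff).1 ha ψ h1 h2 h3,
      (mem_zeroGrad_iff).1 hb ψ h1 h2 h3, add_zero]
  smul_mem' := fun c a ha => (mem_zeroGrad_iff).2 fun ψ h1 h2 h3 => by
    rw [map_smul, map_smul, (mem_zeroGrad_iff).1 ha ψ h1 h2 h3, smul_zero]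

lemma isClosed_zeroGrad : IsClosed (zeroGrad s w p Ω) := by
  have e : zeroGrad s w p Ω = {h : LpThick n δ p Ω | ∀ (ψ : Rn n → Rn n) (h1 : ContDiff ℝ ∞ ψ)
      (h2 : HasCompactSupport ψ), tsupport ψ ⊆ Ω → pairing p (allMemLp_nonlocalDiv s w h1 h2)
        (zeroExt p (measurableSet_thickening δ Ω) h) = 0} := Set.ext fun h => mem_zeroGrad_iff
  rw [e]
  simp only [Set.ofPred_forall]
  exact isClosed_iInter fun ψ => isClosed_iInter fun h1 => isClosed_iInter fun h2 =>
    isClosed_iInter fun _ => isClosed_eq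
      ((pairing p _).continuous.comp (zeroExt p _).continuous) continuous_const

variable [NeZero n] [Fact (p ≠ ⊤)]

/-- The nonlocal divergence of a field supported in Ω vanishes outside Ω_δ, so nothing is lost by
restriction. Its pairing with `k` is that of the convolution with a divergence supported in Ω, where
the convolution is zero. -/
lemma restr_mem_zeroGrad (hs : 0 < s) (hδ : 0 < δ) (hs1 : s < 1) (hΩ : MeasurableSet Ω)
    {k : LpFull n p} (hk : cut p hΩ (conv p (toLOne (potential s w)) k) = 0) :
    restr p (Metric.thickening δ Ω) k ∈ zeroGrad s w p Ω := by
  refine (mem_zeroGrad_iff).2 fun ψ h1 h2 h3 => ?_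
  rw [pairing_apply, integral_zeroExt_mul]
  have e : ∫ x in Metric.thickening δ Ω, restr p (Metric.thickening δ Ω) k x *
      nonlocalDiv s w ψ x = ∫ x in Metric.thickening δ Ω, k x * nonlocalDiv s w ψ x := by
    refine integral_congr_ae ?_
    filter_upwards [LpToLpRestrictCLM_coeFn ℝ (Metric.thickening δ Ω) k] with x hx
    exact congrArg (· * _) hx
  rw [e, setIntegral_eq_integral_of_forall_compl_eq_zero fun x hx => by
      rw [nonlocalDiv_eq_zero_of_notMem s w h3 hx, mul_zero],
    ← sum_integral_conv_potential_mul_pd hs hδ hs1 k h1 h2]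
  refine Finset.sum_eq_zero fun i _ => ?_
  rw [← integral_cut_mul hΩ _ fun x hx => image_eq_zero_of_notMem_tsupport fun h => hx (h3
    (tsupport_component_subset ψ i (tsupport_pd_subset _ i h))), hk,
    ← pairing_apply ((isTest_component h1 h2 i).pd i).allMemLp, map_zero]

end ZeroGradient

/-! ### From the nonlocal space to the local Sobolev space -/

section ToSobolev

variable {n : ℕ} [NeZero n] {p : ℝ≥0∞} [Fact (1 ≤ p)] [Fact (p ≠ ⊤)] {Ω : Set (Rn n)}
  {s δ : ℝ} {w : Cutoff n δ}

/-- Functions in the nonlocal space as a pair of the convolution with the potential and its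
gradient. -/
def toPair (s : ℝ) (w : Cutoff n δ) (p : ℝ≥0∞) [Fact (1 ≤ p)] [Fact (p ≠ ⊤)] {Ω : Set (Rn n)}
    (hΩ : MeasurableSet Ω) : LpThick n δ p Ω × LpVec n p Ω →L[ℝ] LpPair n p :=
  (cut p hΩ ∘L conv p (toLOne (potential s w)) ∘L
    (zeroExt p (measurableSet_thickening δ Ω)).toContinuousLinearMap).prodMap
  (.pi fun i => (zeroExt p hΩ).toContinuousLinearMap ∘L
    (EuclideanSpace.proj i : Rn n →L[ℝ] ℝ).compLpL p (volume.restrict Ω))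

/-- Testing the definition of the nonlocal gradient with fields along the coordinate axes shows that
it is the weak gradient of the convolution with the potential. -/
lemma toPair_mem_sobolev (hs : 0 < s) (hδ : 0 < δ) (hs1 : s < 1) (hΩ : MeasurableSet Ω)
    (u : HSpace s w p Ω) : toPair s w p hΩ (HSpace.fn u, HSpace.grad u) ∈ sobolev p hΩ := by
  refine ⟨cut_cut hΩ _, fun i => cut_zeroExt hΩ _, fun i φ hφ hsφ => ?_⟩
  change ∫ x, cut p hΩ (conv p (toLOne (potential s w))
    (zeroExt p (measurableSet_thickening δ Ω) (HSpace.fn u))) x * pd i φ x =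
    -∫ x, zeroExt p hΩ ((EuclideanSpace.proj i : Rn n →L[ℝ] ℝ).compLpL p (volume.restrict Ω)
      (HSpace.grad u)) x * φ x
  rw [integral_cut_mul hΩ _ fun x hx => image_eq_zero_of_notMem_tsupport fun h => hx (hsφ
    (tsupport_pd_subset φ i h)), integral_conv_potential_mul_pd hs hδ hs1 _ hφ,
    integral_zeroExt_mul, integral_zeroExt_mul, eq_neg_iff_add_eq_zero, ← neg_eq_iff_add_eq_zero]
  refine (u.2.integral_by_parts _ (hφ.contDiff_axisField i) (hφ.hasCompactSupport_axisField i)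
    ((tsupport_axisField_subset φ i).trans hsφ)).symm.trans (integral_congr_ae ?_)
  filter_upwards [ContinuousLinearMap.coeFn_compLpL (EuclideanSpace.proj i : Rn n →L[ℝ] ℝ)
    (HSpace.grad u)] with x hx
  rw [hx]
  simp [axisField, real_inner_smul_right, EuclideanSpace.inner_single_right, mul_comm]
  exact .inl rfl

/-- Functions in the nonlocal space together with their gradients. -/
def HSpace.toProd (s : ℝ) (w : Cutoff n δ) (p : ℝ≥0∞) [Fact (1 ≤ p)] (Ω : Set (Rn n)) :
    HSpace s w p Ω →L[ℝ] LpThick n δ p Ω × LpVec n p Ω :=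
  (WithLp.prodContinuousLinearEquiv p ℝ (LpThick n δ p Ω)
    (LpVec n p Ω)).toContinuousLinearMap ∘L (HSpace s w p Ω).subtypeL

omit [NeZero n] [Fact (p ≠ ⊤)] in
lemma HSpace.toProd_apply (u : HSpace s w p Ω) :
    HSpace.toProd s w p Ω u = (HSpace.fn u, HSpace.grad u) := rfl

/-- The map from the nonlocal space to the local Sobolev space. -/
def toSobolev (p : ℝ≥0∞) [Fact (1 ≤ p)] [Fact (p ≠ ⊤)] (hs : 0 < s) (hδ : 0 < δ) (hs1 : s < 1)
    {Ω : Set (Rn n)} (hΩ : MeasurableSet Ω) : HSpace s w p Ω →L[ℝ] sobolev p hΩ :=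
  (toPair s w p hΩ ∘L HSpace.toProd s w p Ω).codRestrict (sobolev p hΩ) fun u => by
    rw [ContinuousLinearMap.comp_apply, HSpace.toProd_apply]
    exact toPair_mem_sobolev hs hδ hs1 hΩ u

/-- `toSobolev` is bounded and linear, so it maps u_j - u₀ to a weakly null sequence. The
parametrix, applied to the extensions by zero, then yields elements of the kernel on ℝⁿ, and these
are restricted to Ω_δ. -/
lemma exists_zeroGrad_approx (hs : 0 < s) (hδ : 0 < δ) (hs1 : s < 1)
    (hΩ : IsBoundedLipschitzDomain Ω) {u : ℕ → HSpace s w p Ω} {u₀ : HSpace s w p Ω}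
    (hu : Tendsto (fun j => toWeakSpace ℝ (HSpace s w p Ω) (u j)) atTop
      (𝓝 (toWeakSpace ℝ (HSpace s w p Ω) u₀))) :
    ∃ k : ℕ → LpThick n δ p Ω, (∀ j, k j ∈ zeroGrad s w p Ω) ∧
      Tendsto (fun j => HSpace.fn (u j) - HSpace.fn u₀ - k j) atTop (𝓝 0) := by
  have hm := hΩ.isOpen.measurableSet
  have hD := measurableSet_thickening δ Ω
  obtain ⟨k, hk, hk0⟩ := exists_ker_approx_potential hs hδ hs1 hΩ
    (u := fun j => zeroExt p hD (HSpace.fn (u j - u₀)))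
    (z := fun j => toSobolev p hs hδ hs1 hm (u j - u₀)) (fun j => rfl) (fun g => by
      have h : Tendsto (fun j => g (toSobolev p hs hδ hs1 hm (u j))) atTop
          (𝓝 (g (toSobolev p hs hδ hs1 hm u₀))) :=
        ((WeakBilin.eval_continuous (topDualPairing ℝ (HSpace s w p Ω)).flip
          (g ∘L toSobolev p hs hδ hs1 hm)).tendsto _).comp hu
      simpa only [map_sub, sub_self] using h.sub_const (g (toSobolev p hs hδ hs1 hm u₀)))
  refine ⟨fun j => restr p _ (k j), fun j => restr_mem_zeroGrad hs hδ hs1 hm (hk j), ?_⟩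
  have h := ((restr p (Metric.thickening δ Ω)).continuous.tendsto 0).comp hk0
  simp only [Function.comp_def, map_sub, restr_zeroExt, map_zero] at h
  exact h

end ToSobolev

end FiniteHorizon

end

theorem lemma4p6 (n : ℕ) (hn : 0 < n) (s δ : ℝ) (hs0 : 0 < s) (hs1 : s < 1) (hδ : 0 < δ)
    (w : FiniteHorizon.Cutoff n δ) (Ω : Set (FiniteHorizon.Rn n))
    (hΩ : FiniteHorizon.IsBoundedLipschitzDomain Ω)
    (p : ℝ≥0∞) [Fact (1 ≤ p)] (hp1 : 1 < p) (hp : p ≠ ⊤)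
    (u : ℕ → FiniteHorizon.HSpace s w p Ω) (u₀ : FiniteHorizon.HSpace s w p Ω)
    (hu : Tendsto (fun j => toWeakSpace ℝ (FiniteHorizon.HSpace s w p Ω) (u j)) atTop
      (𝓝 (toWeakSpace ℝ (FiniteHorizon.HSpace s w p Ω) u₀))) :
    (∀ v : FiniteHorizon.LpThick n δ p Ω,
      ∃! h, FiniteHorizon.IsNearestPoint (FiniteHorizon.zeroGrad s w p Ω) v h) ∧
    Tendsto
      (fun j => FiniteHorizon.HSpace.fn (u j) -
        FiniteHorizon.proj s w p Ω (FiniteHorizon.HSpace.fn (u j)))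
      atTop
      (𝓝 (FiniteHorizon.HSpace.fn u₀ -
        FiniteHorizon.proj s w p Ω (FiniteHorizon.HSpace.fn u₀))) := by
  have : NeZero n := ⟨hn.ne'⟩
  have : Fact (p ≠ ⊤) := ⟨hp⟩
  have hr : 0 < p.toReal := ENNReal.toReal_pos (one_pos.trans hp1).ne' hp
  have hX := FiniteHorizon.powUniformConvex_Lp
    (μ := volume.restrict (Metric.thickening δ Ω)) hp1 hp
  have hN := FiniteHorizon.isClosed_zeroGrad (s := s) (w := w) (p := p) (Ω := Ω)
  obtain ⟨k, hk, hk0⟩ := FiniteHorizon.exists_zeroGrad_approx hs0 hδ hs1 hΩ hu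
  refine ⟨fun v => ?_, ?_⟩
  · obtain ⟨h, hh⟩ := hX.exists_isNearestPoint hr
      (N := FiniteHorizon.zeroGradSubmodule s w p Ω) hN v
    exact ⟨h, hh, fun h' hh' => FiniteHorizon.IsNearestPoint.unique hX hr
      (N := FiniteHorizon.zeroGradSubmodule s w p Ω) hh' hh⟩
  · exact FiniteHorizon.tendsto_sub_metricProj hX hr
      (N := FiniteHorizon.zeroGradSubmodule s w p Ω) hN hk hk0
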